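/- Let $(\Omega,\mathcal F,\mathbb P)$ be a probability space carrying a fractional Gaussian field $Z=(Z_H(t))_{(t,H)\in[0,\infty)\times(0,1)}$, i.e. a centred Gaussian process with $$\mathbb E[Z_H(t)Z_{H'}(s)]=\tfrac{a_{H,H'}}{2}\bigl(t^{H+H'}+s^{H+H'}-|t-s|^{H+H'}\bigr),$$ where, for $H+H'\ne1$, $$a_{H,H'}=-\tfrac2\pi\sqrt{\Gamma(2H+1)\sin(\pi H)}\sqrt{\Gamma(2H'+1)\sin(\pi H')}\,\Gamma(-(H+H'))\cos\bigl((H'-H)\tfrac\pi2\bigr)\cos\bigl((H+H')\tfrac\pi2\bigr),$$ and $a_{H,1-H}=a_H:=\sqrt{\Gamma(2H+1)\Gamma(3-2H)}\,\sin^2(\pi H)$. Fix $H\in(0,1)$, put $\mathcal F^H_t=\sigma(Z_H(r):0\le r\le t)$, $M_H(t)=\mathbb E[Z_{1-H}(t)\mid\mathcal F^H_t]$, $$c_M=\frac{a_H^2\,\Gamma(3/2-H)}{2H\,\Gamma(H+1/2)\,\Gamma(3-2H)},\qquad c_\Psi=\frac{2H\,\Gamma(3-2H)\,\Gamma(H+1/2)}{a_H\,\Gamma(3/2-H)},\qquad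 C=c_\Psi\sqrt{c_M(2-2H)},$$ and let $V_H(t)=c_\Psi t^{2H-1}M_H(t)$ be the Dobrić–Ojeda process. For a process $X$ on $[0,\infty)$, $[X,X]_t$ denotes the limit, in probability and in $L^2(\mathbb P)$, of $\sum_i (X_{t_i}-X_{t_{i-1}})^2$ along every sequence of (deterministic) finite partitions of $[0,t]$ whose mesh tends to $0$. 1. The quadratic variation of the Dobrić–Ojeda process (and of each of its modifications) exists and is $[V_H,V_H]_t=\dfrac{C^2}{2H}t^{2H}$ for all $t\ge0$. 2. There are a measurable modification $(M_t)$ of $M_H$ and a process $(W_t)$ with the finite-dimensional laws of Brownian motion, adapted to the completion of $(\mathcal F^H_t)$, such that for every $t\ge 0$, almost surely, $$V_H(t)=C\int_0^t s^{H-1/2}\,dW_s+(2H-1)\int_0^t s^{-1}V_H(s)\,ds ,$$ where $V_H(s)=c_\Psi s^{2H-1}M_s$ under the $ds$-integral, which converges absolutely almost surely. For every such pair $(M,W)$ (in particular for those with continuous paths) and every $\epsilon>0$, the modified Dobrić–Ojeda process $$V^\epsilon_t=C\int_0^t s^{H-1/2}\,dW_s+\int_0^t c_\Psi(2H-1)s^{2H-2}M_s\mathbf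 1_{[\epsilon,\infty)}(s)\,ds$$ (and each of its modifications) has the same quadratic variation: $[V^\epsilon,V^\epsilon]_t=\dfrac{C^2}{2H}t^{2H}$ for all $t\ge0$. -/

import Mathlib

open MeasureTheory ProbabilityTheory Filter Topology
open scoped NNReal ENNReal

namespace DobricOjeda

noncomputable section

/-! ### Constants -/

/-- The constant `a_H` of the fractional Gaussian field for complementary Hurst indices. -/
def aConst (H : ℝ) : ℝ :=
  √(Real.Gamma (2 * H + 1) * Real.Gamma (3 - 2 * H)) * Real.sin (Real.pi * H) ^ 2

/-- The constant `a_{H,H'}` of the fractional Gaussian field. -/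
def aCross (H H' : ℝ) : ℝ :=
  open Classical in
  if H + H' = 1 then aConst H
  else
    -(2 / Real.pi) * √(Real.Gamma (2 * H + 1) * Real.sin (Real.pi * H))
      * √(Real.Gamma (2 * H' + 1) * Real.sin (Real.pi * H'))
      * Real.Gamma (-(H + H')) * Real.cos ((H' - H) * (Real.pi / 2))
      * Real.cos ((H + H') * (Real.pi / 2))

/-- `c_M = a_H² Γ(3/2 - H) / (2H Γ(H + 1/2) Γ(3 - 2H))`. -/
def cM (H : ℝ) : ℝ :=
  aConst H ^ 2 * Real.Gamma (3 / 2 - H)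
    / (2 * H * Real.Gamma (H + 1 / 2) * Real.Gamma (3 - 2 * H))

/-- `c_Ψ = 2H Γ(3 - 2H) Γ(H + 1/2) / (a_H Γ(3/2 - H))`. -/
def cPsi (H : ℝ) : ℝ :=
  2 * H * Real.Gamma (3 - 2 * H) * Real.Gamma (H + 1 / 2)
    / (aConst H * Real.Gamma (3 / 2 - H))

/-- `C = c_Ψ √(c_M (2 - 2H))`. -/
def cDO (H : ℝ) : ℝ := cPsi H * √(cM H * (2 - 2 * H))

/-! ### The fractional Gaussian field and the Dobrić–Ojeda process -/

/-- Hurst indices. -/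
abbrev Hurst : Type := Set.Ioo (0 : ℝ) 1

/-- The complementary Hurst index `H' = 1 - H`. -/
def Hurst.compl (H : Hurst) : Hurst :=
  ⟨1 - (H : ℝ), by linarith [H.2.2], by linarith [H.2.1]⟩

/-- `Z = (Z_H(t))` is a fractional Gaussian field on the probability space `(Ω, μ)`: a centred
Gaussian process indexed by `(0,1) × [0,∞)` with
`E[Z_H(t) Z_{H'}(s)] = (a_{H,H'} / 2) (t^{H+H'} + s^{H+H'} - |t - s|^{H+H'})`. -/
structure IsFractionalGaussianField {Ω : Type*} [MeasurableSpace Ω] (μ : Measure Ω)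
    (Z : Hurst → ℝ≥0 → Ω → ℝ) : Prop where
  measurable : ∀ H t, Measurable (Z H t)
  gaussian : IsGaussianProcess (fun p : Hurst × ℝ≥0 => Z p.1 p.2) μ
  centered : ∀ H t, ∫ ω, Z H t ω ∂μ = 0
  covariance : ∀ (H H' : Hurst) (t s : ℝ≥0),
    ∫ ω, Z H t ω * Z H' s ω ∂μ
      = aCross H H' / 2 * ((t : ℝ) ^ ((H : ℝ) + H') + (s : ℝ) ^ ((H : ℝ) + H')
          - |(t : ℝ) - s| ^ ((H : ℝ) + H'))

/-- `F_t^H = σ(Z_H(r) : 0 ≤ r ≤ t)`. -/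
abbrev pastSigma {Ω : Type*} (Z : Hurst → ℝ≥0 → Ω → ℝ) (H : Hurst) (t : ℝ≥0) :
    MeasurableSpace Ω :=
  ⨆ r : Set.Iic t, MeasurableSpace.comap (Z H r) inferInstance

/-- `M_H(t) = E[Z_{1-H}(t) | F_t^H]`. -/
def martM {Ω : Type*} [MeasurableSpace Ω] (μ : Measure Ω) (Z : Hurst → ℝ≥0 → Ω → ℝ)
    (H : Hurst) (t : ℝ≥0) : Ω → ℝ :=
  μ[Z H.compl t | pastSigma Z H t]

/-- The Dobrić–Ojeda process `V_H(t) = Ψ_H(t) M_H(t)`, where `Ψ_H(t) = c_Ψ t^{2H-1}`. -/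
def procV {Ω : Type*} [MeasurableSpace Ω] (μ : Measure Ω) (Z : Hurst → ℝ≥0 → Ω → ℝ)
    (H : Hurst) (t : ℝ≥0) (ω : Ω) : ℝ :=
  cPsi H * (t : ℝ) ^ (2 * (H : ℝ) - 1) * martM μ Z H t ω

/-! ### Partitions and quadratic variation -/

/-- A finite partition `0 = t_0 ≤ t_1 ≤ ⋯ ≤ t_n = t` of `[0, t]`. The values `node i` for `i > n`
play no role. -/
structure TimePartition (t : ℝ≥0) where
  n : ℕ
  node : ℕ → ℝ≥0
  mono : Monotone node
  node_zero : node 0 = 0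
  node_last : node n = t

/-- The mesh `max_i (t_{i+1} - t_i)`. -/
def TimePartition.mesh {t : ℝ≥0} (P : TimePartition t) : ℝ≥0 :=
  (Finset.range P.n).sup fun i => P.node (i + 1) - P.node i

/-- The sum `∑_i (X_{t_{i+1}} - X_{t_i})²` of squared increments along a partition. -/
def TimePartition.sumSq {t : ℝ≥0} (P : TimePartition t) {Ω : Type*} (X : ℝ≥0 → Ω → ℝ)
    (ω : Ω) : ℝ :=
  ∑ i ∈ Finset.range P.n, (X (P.node (i + 1)) ω - X (P.node i) ω) ^ 2

/-- `A` is the quadratic variation `[X, X]` of the process `X`: for every `t` and every sequence of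
partitions of `[0, t]` with mesh tending to `0`, the sums of squared increments converge to `A_t`,
both in probability and in `L²`. -/
def IsQuadraticVariation {Ω : Type*} [MeasurableSpace Ω] (μ : Measure Ω) (X A : ℝ≥0 → Ω → ℝ) :
    Prop :=
  ∀ (t : ℝ≥0) (P : ℕ → TimePartition t), Tendsto (fun k => (P k).mesh) atTop (𝓝 0) →
    TendstoInMeasure μ (fun k => (P k).sumSq X) atTop (A t) ∧
      Tendsto (fun k => eLpNorm (fun ω => (P k).sumSq X ω - A t ω) 2 μ) atTop (𝓝 0)

/-! ### Wiener integrals of deterministic functions -/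

/-- The step function `∑_i c_i 1_{(t_i, t_{i+1}]}`. -/
def TimePartition.step {t : ℝ≥0} (P : TimePartition t) (c : ℕ → ℝ) (s : ℝ) : ℝ :=
  ∑ i ∈ Finset.range P.n,
    (Set.Ioc (P.node i : ℝ) (P.node (i + 1) : ℝ)).indicator (fun _ => c i) s

/-- The integral `∑_i c_i (W_{t_{i+1}} - W_{t_i})` of a step function with respect to `W`. -/
def TimePartition.stepIntegral {t : ℝ≥0} (P : TimePartition t) (c : ℕ → ℝ) {Ω : Type*}
    (W : ℝ≥0 → Ω → ℝ) (ω : Ω) : ℝ :=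
  ∑ i ∈ Finset.range P.n, c i * (W (P.node (i + 1)) ω - W (P.node i) ω)

/-- `I` is (a version of) `∫_0^t f(s) dW_s` for deterministic `f`: step functions converge to `f` in
`L²([0, t])` while their integrals converge to `I` in `L²(Ω)`. -/
def IsWienerIntegral {Ω : Type*} [MeasurableSpace Ω] (μ : Measure Ω) (W : ℝ≥0 → Ω → ℝ)
    (f : ℝ → ℝ) (t : ℝ≥0) (I : Ω → ℝ) : Prop :=
  AEStronglyMeasurable I μ ∧
    ∃ (P : ℕ → TimePartition t) (c : ℕ → ℕ → ℝ),
      Tendsto (fun k => eLpNorm (fun s => f s - (P k).step (c k) s) 2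
        (volume.restrict (Set.Ioc (0 : ℝ) t))) atTop (𝓝 0) ∧
      Tendsto (fun k => eLpNorm (fun ω => I ω - (P k).stepIntegral (c k) W ω) 2 μ) atTop (𝓝 0)

/-- The Wiener integral `∫_0^t f(s) dW_s`. For a Brownian motion `W` and `f ∈ L²([0, t])` it exists
and is unique up to almost sure equality; the value `0` is a default for other arguments. -/
def wienerIntegral {Ω : Type*} [MeasurableSpace Ω] (μ : Measure Ω) (W : ℝ≥0 → Ω → ℝ)
    (f : ℝ → ℝ) (t : ℝ≥0) : Ω → ℝ :=
  open Classical in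
  if h : ∃ I, IsWienerIntegral μ W f t I then h.choose else 0

/-! ### The diffusion representation and the modified process -/

/-- `M` is a measurable version of the martingale `M_H`, and `W` is a Brownian motion, adapted to
the (completed) filtration `(F_t^H)`, that drives the Dobrić–Ojeda process:
`dV_H(t) = C t^{H-1/2} dW_t + (2H-1) t⁻¹ V_H(t) dt`, `V_H(0) = 0`, in integrated form, where
`V_H(s) = c_Ψ s^{2H-1} M_s` under the time integral. Continuity of the paths of `M` and `W` is
allowed but not required. -/
structure IsDriving {Ω : Type*} [MeasurableSpace Ω] (μ : Measure Ω)
    (Z : Hurst → ℝ≥0 → Ω → ℝ) (H : Hurst) (M W : ℝ≥0 → Ω → ℝ) : Prop where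
  measurable : Measurable (Function.uncurry M)
  version : ∀ t, M t =ᵐ[μ] martM μ Z H t
  brownian : IsPreBrownianReal W μ
  adapted : ∀ t, AEStronglyMeasurable[pastSigma Z H t] (W t) μ
  drift_integrable : ∀ t : ℝ≥0, ∀ᵐ ω ∂μ, IntervalIntegrable
    (fun s : ℝ => s⁻¹ * (cPsi H * s ^ (2 * (H : ℝ) - 1) * M s.toNNReal ω)) volume 0 t
  sde : ∀ t : ℝ≥0, ∀ᵐ ω ∂μ,
    procV μ Z H t ω
      = cDO H * wienerIntegral μ W (fun s => s ^ ((H : ℝ) - 1 / 2)) t ω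
        + (2 * (H : ℝ) - 1)
          * ∫ s in (0 : ℝ)..t, s⁻¹ * (cPsi H * s ^ (2 * (H : ℝ) - 1) * M s.toNNReal ω)

/-- The modified Dobrić–Ojeda process
`V^ε_t = C ∫_0^t s^{H-1/2} dW_s + ∫_0^t c_Ψ (2H-1) s^{2H-2} M_s 1_{[ε,∞)}(s) ds`. -/
def modV {Ω : Type*} [MeasurableSpace Ω] (μ : Measure Ω) (H : Hurst) (M W : ℝ≥0 → Ω → ℝ)
    (ε : ℝ) (t : ℝ≥0) (ω : Ω) : ℝ :=
  cDO H * wienerIntegral μ W (fun s => s ^ ((H : ℝ) - 1 / 2)) t ω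
    + ∫ s in (0 : ℝ)..t, (Set.Ici ε).indicator
        (fun s => cPsi H * (2 * (H : ℝ) - 1) * s ^ (2 * (H : ℝ) - 2) * M s.toNNReal ω) s

end

end DobricOjeda

/-! Everything is transferred to the Gaussian Hilbert space spanned by the field in L². Conditioning
on the past of `Z_H` up to t is there the orthogonal projection onto a closed subspace `A t`
(`condExp_gaussian`), so the martingale becomes a curve `m`. Complementary Hurst indices add up to
1, hence E[Z_{1-H}(t) Z_H(s)] = a_H s for s ≤ t, whatever t is. Increments of Z_{1-H} after time s
are therefore orthogonal to `A s`, and ⟨m s, m t⟩ = ‖m s‖² for s ≤ t.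

The norm comes from the kernel (u(1-u))^{1/2-H}. Integrated against the derivative of the fractional
Brownian covariance it gives a linear function (`martKernel_mul_fbmCovDeriv`), so step sums with
this kernel converge weakly on `A t` to a multiple of m t. Pairing them with m t yields ‖m t‖² = c_M
t^{2-2H} (`norm_sq_of_fbm_projection`). Linearity is a fact about an Abel-type integral: a Möbius
substitution computes its second derivative, which is invariant under s ↦ 1 - s, so the integral
minus its reflection is affine.

From here on the metric structure ⟨m s, m t⟩ = K s^q and Gaussianity suffice
(`IsGaussianMartingale`). Integration by parts reads t^p m_t = ∫ s^p dm_s + p ∫ s^{p-1} m_s ds. With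
p = 2H - 1 and the factor c_Ψ, the first term has orthogonal increments and variance C² t^{2H}/(2H),
while the second has bounded variation in L² norm. Gaussian fourth moments are controlled by second
moments, so the squared increments of the first term concentrate at their mean and all terms
involving the second vanish (`isQuadraticVariation_of_gaussian`).

A driving Brownian motion is the normalised ∫ s^{H-1/2} dm_s, and its Wiener integrals are
recognised by their inner products (`wienerIntegral_ae_eq`). For an arbitrary driving pair the
integral equation itself expresses C∫ s^{H-1/2} dW as V minus its drift. Truncating at ε thus only
replaces the drift D_t by D_t - D_{min(t,ε)}, again of bounded variation. -/

namespace DobricOjeda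

/-! ### Beta integrals -/

theorem ofReal_rpow_mul_one_sub_rpow {a b x : ℝ} (hx : x ∈ Set.Ioo (0 : ℝ) 1) :
    (x : ℂ) ^ ((a + 1 : ℝ) - 1 : ℂ) * (1 - (x : ℂ)) ^ ((b + 1 : ℝ) - 1 : ℂ)
      = ((x ^ a * (1 - x) ^ b : ℝ) : ℂ) := by
  have h1 : ((a + 1 : ℝ) - 1 : ℂ) = (a : ℂ) := by push_cast; ring
  have h2 : ((b + 1 : ℝ) - 1 : ℂ) = (b : ℂ) := by push_cast; ring
  rw [h1, h2, Complex.ofReal_mul, Complex.ofReal_cpow hx.1.le,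
    Complex.ofReal_cpow (by linarith [hx.2])]
  push_cast
  rfl

theorem integrableOn_rpow_mul_one_sub_rpow {a b : ℝ} (ha : -1 < a) (hb : -1 < b) :
    IntegrableOn (fun x : ℝ => x ^ a * (1 - x) ^ b) (Set.Ioo 0 1) := by
  have h := Complex.betaIntegral_convergent (u := (a + 1 : ℝ)) (v := (b + 1 : ℝ))
    (by rw [Complex.ofReal_re]; linarith) (by rw [Complex.ofReal_re]; linarith)
  rw [intervalIntegrable_iff_integrableOn_Ioo_of_le zero_le_one] at h
  refine (h.re).congr ?_
  filter_upwards [ae_restrict_mem measurableSet_Ioo] with x hx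
  rw [ofReal_rpow_mul_one_sub_rpow hx]
  simp

theorem setIntegral_rpow_mul_one_sub_rpow {a b : ℝ} (ha : -1 < a) (hb : -1 < b) :
    ∫ x in Set.Ioo (0 : ℝ) 1, x ^ a * (1 - x) ^ b = beta (a + 1) (b + 1) := by
  rw [beta_eq_betaIntegralReal _ _ (by linarith) (by linarith), Complex.betaIntegral,
    intervalIntegral.integral_of_le zero_le_one, integral_Ioc_eq_integral_Ioo,
    setIntegral_congr_fun measurableSet_Ioo fun x hx => ofReal_rpow_mul_one_sub_rpow hx,
    integral_complex_ofReal, Complex.ofReal_re]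

/-! ### Differentiation under the integral sign against an integrable weight -/

/-- The endpoint singularities in x sit in the fixed weight `ρ`, and `φ`, `φ'` are continuous up to
x = 0 and x = 1. On a compact window of s the derivative is then dominated by a constant times |ρ|.
-/
theorem hasDerivAt_integral_weight {ρ : ℝ → ℝ} (hρ : IntegrableOn ρ (Set.Ioo 0 1))
    {φ φ' : ℝ → ℝ → ℝ} {s₀ : ℝ} (hs : s₀ ∈ Set.Ioo (0 : ℝ) 1)
    (hφ : ContinuousOn (Function.uncurry φ) (Set.Ioo 0 1 ×ˢ Set.Icc 0 1))
    (hφ' : ContinuousOn (Function.uncurry φ') (Set.Ioo 0 1 ×ˢ Set.Icc 0 1))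
    (hd : ∀ s ∈ Set.Ioo (0 : ℝ) 1, ∀ x ∈ Set.Icc (0 : ℝ) 1,
      HasDerivAt (fun s => φ s x) (φ' s x) s) :
    HasDerivAt (fun s => ∫ x in Set.Ioo (0 : ℝ) 1, ρ x * φ s x)
      (∫ x in Set.Ioo (0 : ℝ) 1, ρ x * φ' s₀ x) s₀ := by
  have hsec : ∀ ψ : ℝ → ℝ → ℝ,
      ContinuousOn (Function.uncurry ψ) (Set.Ioo 0 1 ×ˢ Set.Icc 0 1) →
      ∀ s ∈ Set.Ioo (0 : ℝ) 1, ContinuousOn (ψ s) (Set.Icc 0 1) := fun ψ hψ s hs =>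
    hψ.comp (f := fun x => (s, x)) (by fun_prop) fun x hx => ⟨hs, hx⟩
  have hmeas : ∀ ψ : ℝ → ℝ → ℝ,
      ContinuousOn (Function.uncurry ψ) (Set.Ioo 0 1 ×ˢ Set.Icc 0 1) →
      ∀ s ∈ Set.Ioo (0 : ℝ) 1,
        AEStronglyMeasurable (fun x => ρ x * ψ s x) (volume.restrict (Set.Ioo 0 1)) :=
    fun ψ hψ s hs => hρ.aestronglyMeasurable.mul
      (((hsec ψ hψ s hs).mono Set.Ioo_subset_Icc_self).aestronglyMeasurable measurableSet_Ioo)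
  obtain ⟨a, b, hab, hK⟩ : ∃ a b, s₀ ∈ Set.Ioo a b ∧ Set.Icc a b ⊆ Set.Ioo (0 : ℝ) 1 :=
    ⟨s₀ / 2, (1 + s₀) / 2, ⟨by linarith [hs.1], by linarith [hs.2]⟩, fun x hx =>
      ⟨by linarith [hs.1, hx.1], by linarith [hs.2, hx.2]⟩⟩
  obtain ⟨C, hC⟩ := (isCompact_Icc.prod isCompact_Icc).exists_bound_of_continuousOn
    (hφ'.mono (Set.prod_mono hK subset_rfl))
  obtain ⟨D, hD⟩ := isCompact_Icc.exists_bound_of_continuousOn (hsec φ hφ s₀ hs)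
  refine (hasDerivAt_integral_of_dominated_loc_of_deriv_le (s := Set.Ioo a b)
    (F' := fun s x => ρ x * φ' s x)
    (bound := fun x => C * |ρ x|) (Ioo_mem_nhds hab.1 hab.2) ?_ ?_ (hmeas φ' hφ' s₀ hs) ?_
    ((hρ.abs).const_mul C) ?_).2
  · filter_upwards [Ioo_mem_nhds hs.1 hs.2] with s hs using hmeas φ hφ s hs
  · refine ((hρ.abs).const_mul D).mono' (hmeas φ hφ s₀ hs) ?_
    filter_upwards [ae_restrict_mem measurableSet_Ioo] with x hx
    rw [norm_mul, mul_comm, Real.norm_eq_abs (ρ x)]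
    exact mul_le_mul_of_nonneg_right (hD x ⟨hx.1.le, hx.2.le⟩) (abs_nonneg _)
  · filter_upwards [ae_restrict_mem measurableSet_Ioo] with x hx s hs
    rw [norm_mul, mul_comm, Real.norm_eq_abs (ρ x)]
    exact mul_le_mul_of_nonneg_right (hC (s, x) ⟨⟨hs.1.le, hs.2.le⟩, hx.1.le, hx.2.le⟩)
      (abs_nonneg _)
  · filter_upwards [ae_restrict_mem measurableSet_Ioo] with x hx s hs
    exact (hd s (hK ⟨hs.1.le, hs.2.le⟩) x ⟨hx.1.le, hx.2.le⟩).const_mul _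

/-! ### A Möbius substitution -/

/-- The substitution `y = (1 - x) / (1 - s x)`. -/
theorem integral_moebius {a b s : ℝ} (hs : s ∈ Set.Ioo (0 : ℝ) 1) :
    ∫ x in Set.Ioo (0 : ℝ) 1, x ^ a * (1 - x) ^ b * (1 - s * x) ^ (-(a + b) - 2)
      = (1 - s) ^ (-1 - a) * ∫ y in Set.Ioo (0 : ℝ) 1, y ^ b * (1 - y) ^ a := by
  have hpos : ∀ x ∈ Set.Ioo (0 : ℝ) 1, 0 < 1 - s * x := fun x hx => by
    nlinarith [hs.1, hs.2, hx.1, hx.2]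
  have h1s : 0 < 1 - s := by linarith [hs.2]
  -- This Möbius map is an involution of (0,1), which gives both injectivity and the image. The
  -- exponent -(a+b)-2 absorbs the powers of 1 - s x produced by y^b, (1-y)^a and the Jacobian.
  set f : ℝ → ℝ := fun x => (1 - x) / (1 - s * x)
  have hinv : ∀ x ∈ Set.Ioo (0 : ℝ) 1, f x ∈ Set.Ioo (0 : ℝ) 1 ∧ f (f x) = x := by
    intro x hx
    have h := hpos x hx
    have hne := h.ne'
    have h3 : 1 - s * f x = (1 - s) / (1 - s * x) := by
      change 1 - s * ((1 - x) / (1 - s * x)) = _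
      rw [eq_div_iff hne, sub_mul, mul_assoc s, div_mul_cancel₀ _ hne]
      ring
    refine ⟨⟨div_pos (by linarith [hx.2]) h, (div_lt_one h).2 (by nlinarith [hs.2, hx.1])⟩, ?_⟩
    have h4 : 1 - f x = x * (1 - s) / (1 - s * x) := by
      change 1 - (1 - x) / (1 - s * x) = _
      rw [eq_div_iff hne, sub_mul, div_mul_cancel₀ _ hne]
      ring
    change (1 - f x) / (1 - s * f x) = x
    rw [h3, h4, div_div_div_cancel_right₀ hne, mul_div_cancel_right₀ _ h1s.ne']
  have himg : f '' Set.Ioo 0 1 = Set.Ioo 0 1 := by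
    refine Set.Subset.antisymm (by rintro _ ⟨x, hx, rfl⟩; exact (hinv x hx).1) fun x hx =>
      ⟨f x, (hinv x hx).1, (hinv x hx).2⟩
  have hinj : Set.InjOn f (Set.Ioo 0 1) := fun x hx y hy hxy => by
    rw [← (hinv x hx).2, ← (hinv y hy).2, hxy]
  have hder : ∀ x ∈ Set.Ioo (0 : ℝ) 1,
      HasDerivWithinAt f (-(1 - s) / (1 - s * x) ^ 2) (Set.Ioo 0 1) x := by
    intro x hx
    have h := (hpos x hx).ne'
    have := ((hasDerivAt_id x).const_sub 1).div (((hasDerivAt_id x).const_mul s).const_sub 1) h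
    refine (this.congr_deriv ?_).hasDerivWithinAt
    simp only [id]
    congr 1
    ring
  have key := integral_image_eq_integral_abs_deriv_smul measurableSet_Ioo hder hinj
    (fun y => y ^ b * (1 - y) ^ a)
  rw [himg] at key
  rw [key, ← integral_const_mul]
  refine setIntegral_congr_fun measurableSet_Ioo fun x hx => ?_
  have h := hpos x hx
  have hne := h.ne'
  have hx1 : 0 < 1 - x := by linarith [hx.2]
  have h2 : 1 - f x = x * (1 - s) / (1 - s * x) := by
    change 1 - (1 - x) / (1 - s * x) = _
    rw [eq_div_iff hne, sub_mul, div_mul_cancel₀ _ hne]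
    ring
  simp only [smul_eq_mul]
  rw [h2, abs_div, abs_neg, abs_of_pos h1s, abs_of_pos (pow_pos h 2),
    Real.div_rpow hx1.le h.le, Real.div_rpow (mul_pos hx.1 h1s).le h.le,
    Real.mul_rpow hx.1.le h1s.le, Real.rpow_sub h, Real.rpow_neg h.le, Real.rpow_add h,
    Real.rpow_sub h1s, Real.rpow_neg_one]
  have e1 := (Real.rpow_pos_of_pos h1s a).ne'
  have e2 := (Real.rpow_pos_of_pos h a).ne'
  have e3 := (Real.rpow_pos_of_pos h b).ne'
  rw [show (1 - s * x) ^ (2 : ℝ) = (1 - s * x) ^ 2 by norm_cast]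
  field_simp

end DobricOjeda

namespace DobricOjeda

/-! ### The Abel-type integral `∫₀ˢ (u (1 - u))^β (s - u)^(-2β) du` -/

/-- `∫₀ˢ (u (1 - u))^β (s - u)^(-2β) du`, rescaled to `(0, 1)`. -/
noncomputable def abelInt (β s : ℝ) : ℝ :=
  ∫ x in Set.Ioo (0 : ℝ) 1, x ^ β * (1 - x) ^ (-2 * β) * (s ^ (1 - β) * (1 - s * x) ^ β)

/-- The derivative of `abelInt β`. -/
noncomputable def abelIntDeriv (β s : ℝ) : ℝ :=
  ∫ x in Set.Ioo (0 : ℝ) 1, x ^ β * (1 - x) ^ (-2 * β)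
    * (s ^ (-β) * (1 - s * x) ^ (β - 1) * (1 - β - s * x))

theorem one_sub_mul_pos {s x : ℝ} (hs : s ∈ Set.Ioo (0 : ℝ) 1) (hx : x ∈ Set.Icc (0 : ℝ) 1) :
    0 < 1 - s * x := by nlinarith [hs.1, hs.2, hx.1, hx.2]

theorem continuousOn_fst_rpow (p : ℝ) :
    ContinuousOn (fun q : ℝ × ℝ => q.1 ^ p) (Set.Ioo 0 1 ×ˢ Set.Icc 0 1) :=
  continuousOn_fst.rpow_const fun _ hq => Or.inl hq.1.1.ne'

theorem continuousOn_one_sub_mul_rpow (p : ℝ) :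
    ContinuousOn (fun q : ℝ × ℝ => (1 - q.1 * q.2) ^ p) (Set.Ioo 0 1 ×ˢ Set.Icc 0 1) :=
  ContinuousOn.rpow_const (by fun_prop) fun q hq => Or.inl (one_sub_mul_pos hq.1 hq.2).ne'

theorem hasDerivAt_abelInt {β s : ℝ} (h₁ : -(1 / 2) < β) (h₂ : β < 1 / 2)
    (hs : s ∈ Set.Ioo (0 : ℝ) 1) : HasDerivAt (abelInt β) (abelIntDeriv β s) s := by
  refine hasDerivAt_integral_weight (φ := fun s x => s ^ (1 - β) * (1 - s * x) ^ β)
    (φ' := fun s x => s ^ (-β) * (1 - s * x) ^ (β - 1) * (1 - β - s * x))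
    (integrableOn_rpow_mul_one_sub_rpow (by linarith) (by linarith)) hs
    ((continuousOn_fst_rpow _).mul (continuousOn_one_sub_mul_rpow _))
    (((continuousOn_fst_rpow _).mul (continuousOn_one_sub_mul_rpow _)).mul
      (by fun_prop)) fun s hs x hx => ?_
  have h := one_sub_mul_pos hs hx
  have hne := h.ne'
  have h0 := hs.1.ne'
  have d1 := (Real.hasDerivAt_rpow_const (p := 1 - β) (Or.inl h0)).mul
    ((((hasDerivAt_id s).mul_const x).const_sub 1).rpow_const (p := β) (Or.inl hne))
  refine d1.congr_deriv ?_
  simp only [id]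
  rw [show 1 - β - 1 = -β by ring, show (1 - β) = -β + 1 by ring, Real.rpow_add_one h0,
    show (1 - s * x) ^ β = (1 - s * x) ^ (β - 1 + 1) by ring_nf, Real.rpow_add_one hne]
  ring

/-- Differentiating twice collapses the integrand to a multiple of (1 - s x)^(β-2), exactly the
exponent of `integral_moebius` for a = β, b = -2β. The point is that the result depends on s only
through s(1-s). -/
theorem hasDerivAt_abelIntDeriv {β s : ℝ} (h₁ : -(1 / 2) < β) (h₂ : β < 1 / 2)
    (hs : s ∈ Set.Ioo (0 : ℝ) 1) :
    HasDerivAt (abelIntDeriv β)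
      (-β * (1 - β) * (∫ y in Set.Ioo (0 : ℝ) 1, y ^ (-2 * β) * (1 - y) ^ β)
        * (s ^ (-1 - β) * (1 - s) ^ (-1 - β))) s := by
  have hd := hasDerivAt_integral_weight
    (φ := fun s x => s ^ (-β) * (1 - s * x) ^ (β - 1) * (1 - β - s * x))
    (φ' := fun s x => -β * (1 - β) * (s ^ (-1 - β) * (1 - s * x) ^ (β - 2)))
    (integrableOn_rpow_mul_one_sub_rpow (a := β) (b := -2 * β) (by linarith) (by linarith)) hs
    (((continuousOn_fst_rpow _).mul (continuousOn_one_sub_mul_rpow _)).mul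
      (by fun_prop))
    (((continuousOn_fst_rpow _).mul (continuousOn_one_sub_mul_rpow _)).const_mul _)
    fun s hs x hx => ?_
  · refine hd.congr_deriv ?_
    have hm := integral_moebius (a := β) (b := -2 * β) hs
    rw [show -(β + -2 * β) - 2 = β - 2 by ring] at hm
    calc _ = ∫ x in Set.Ioo (0 : ℝ) 1, (-β * (1 - β) * s ^ (-1 - β))
          * (x ^ β * (1 - x) ^ (-2 * β) * (1 - s * x) ^ (β - 2)) := by
          refine integral_congr_ae (Eventually.of_forall fun x => ?_)
          simp only
          ring
      _ = _ := by
          rw [integral_const_mul, hm]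
          ring
  · have h := one_sub_mul_pos hs hx
    have hne := h.ne'
    have h0 := hs.1.ne'
    have dx := ((hasDerivAt_id s).mul_const x)
    have d1 := ((Real.hasDerivAt_rpow_const (p := -β) (Or.inl h0)).mul
      ((dx.const_sub 1).rpow_const (p := β - 1) (Or.inl hne))).mul (dx.const_sub (1 - β))
    refine d1.congr_deriv ?_
    simp only [id, Pi.mul_apply]
    rw [show -β - 1 = -1 - β by ring, show (-β) = -1 - β + 1 by ring, Real.rpow_add_one h0,
      show (1 - s * x) ^ (β - 1) = (1 - s * x) ^ (β - 2 + 1) by ring_nf, Real.rpow_add_one hne,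
      show β - 1 - 1 = β - 2 by ring]
    ring

theorem abelInt_zero {β : ℝ} (h₂ : β < 1 / 2) : abelInt β 0 = 0 := by
  simp [abelInt, Real.zero_rpow (show 1 - β ≠ 0 by linarith)]

theorem abelInt_one {β : ℝ} (h₁ : -(1 / 2) < β) (h₂ : β < 1 / 2) :
    abelInt β 1 = beta (1 + β) (1 - β) := by
  rw [add_comm, show 1 - β = -β + 1 by ring,
    ← setIntegral_rpow_mul_one_sub_rpow (a := β) (b := -β) (by linarith) (by linarith), abelInt]
  refine setIntegral_congr_fun measurableSet_Ioo fun x hx => ?_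
  have : 0 < 1 - x := by linarith [hx.2]
  simp only [Real.one_rpow, one_mul]
  rw [mul_assoc, ← Real.rpow_add this]
  ring_nf

/-- An integrable majorant of the integrand of `abelInt`. -/
theorem abelInt_majorant {β s x : ℝ} (hs : s ∈ Set.Icc (0 : ℝ) 1) (hx : x ∈ Set.Ioo (0 : ℝ) 1) :
    (1 - s * x) ^ β ≤ 1 + (1 - x) ^ β := by
  have h1 : 1 - x ≤ 1 - s * x := by nlinarith [hs.2, hx.1]
  have h2 : 0 < 1 - x := by linarith [hx.2]
  -- The sum 1 + (1-x)^β serves both signs of β: the first summand is needed when β ≥ 0, the second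
  -- when β ≤ 0. It does not depend on s.
  rcases le_total 0 β with h | h
  · exact (Real.rpow_le_one (by linarith) (by nlinarith [hs.1, hx.1]) h).trans
      (by linarith [Real.rpow_nonneg h2.le β])
  · exact (Real.rpow_le_rpow_of_nonpos h2 h1 h).trans (by linarith)

theorem norm_abelInt_integrand_le {β s x : ℝ} (h₂ : β < 1 / 2) (hs : s ∈ Set.Icc (0 : ℝ) 1)
    (hx : x ∈ Set.Ioo (0 : ℝ) 1) :
    ‖x ^ β * (1 - x) ^ (-2 * β) * (s ^ (1 - β) * (1 - s * x) ^ β)‖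
      ≤ x ^ β * (1 - x) ^ (-2 * β) + x ^ β * (1 - x) ^ (-β) := by
  have h2 : 0 < 1 - x := by linarith [hx.2]
  have h3 : 0 < 1 - s * x := by nlinarith [hs.1, hs.2, hx.1, hx.2]
  have hρ : 0 ≤ x ^ β * (1 - x) ^ (-2 * β) := mul_nonneg (Real.rpow_nonneg hx.1.le _)
    (Real.rpow_nonneg h2.le _)
  have hφ : 0 ≤ (1 - s * x) ^ β := Real.rpow_nonneg h3.le _
  rw [Real.norm_eq_abs, abs_of_nonneg (mul_nonneg hρ (mul_nonneg (Real.rpow_nonneg hs.1 _) hφ)),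
    show -β = -2 * β + β by ring, Real.rpow_add h2]
  calc _ ≤ x ^ β * (1 - x) ^ (-2 * β) * (1 * (1 + (1 - x) ^ β)) := by
        gcongr
        · exact Real.rpow_le_one hs.1 hs.2 (by linarith)
        · exact abelInt_majorant hs hx
    _ = _ := by ring

theorem continuousOn_abelInt_integrand {β s : ℝ} (hs : s ∈ Set.Icc (0 : ℝ) 1) :
    ContinuousOn (fun x : ℝ => x ^ β * (1 - x) ^ (-2 * β) * (s ^ (1 - β) * (1 - s * x) ^ β))
      (Set.Ioo 0 1) :=
  ((continuousOn_id.rpow_const fun x hx => Or.inl hx.1.ne').mul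
    (ContinuousOn.rpow_const (by fun_prop) fun x hx => Or.inl (by linarith [hx.2]))).mul
    (continuousOn_const.mul (ContinuousOn.rpow_const (by fun_prop)
      fun x hx => Or.inl (by nlinarith [hs.1, hs.2, hx.1, hx.2])))

theorem integrableOn_abelInt_majorant {β : ℝ} (h₁ : -(1 / 2) < β) (h₂ : β < 1 / 2) :
    IntegrableOn (fun x : ℝ => x ^ β * (1 - x) ^ (-2 * β) + x ^ β * (1 - x) ^ (-β))
      (Set.Ioo 0 1) :=
  (integrableOn_rpow_mul_one_sub_rpow (by linarith) (by linarith)).add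
    (integrableOn_rpow_mul_one_sub_rpow (by linarith) (by linarith))

theorem integrableOn_abelInt_integrand {β s : ℝ} (h₁ : -(1 / 2) < β) (h₂ : β < 1 / 2)
    (hs : s ∈ Set.Icc (0 : ℝ) 1) :
    IntegrableOn (fun x : ℝ => x ^ β * (1 - x) ^ (-2 * β) * (s ^ (1 - β) * (1 - s * x) ^ β))
      (Set.Ioo 0 1) := by
  refine (integrableOn_abelInt_majorant h₁ h₂).mono'
    ((continuousOn_abelInt_integrand hs).aestronglyMeasurable measurableSet_Ioo) ?_
  filter_upwards [ae_restrict_mem measurableSet_Ioo] with x hx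
    using norm_abelInt_integrand_le h₂ hs hx

theorem continuousOn_abelInt {β : ℝ} (h₁ : -(1 / 2) < β) (h₂ : β < 1 / 2) :
    ContinuousOn (abelInt β) (Set.Icc 0 1) := by
  refine continuousOn_of_dominated
    (fun s hs => (continuousOn_abelInt_integrand hs).aestronglyMeasurable measurableSet_Ioo)
    (fun s hs => ?_) (integrableOn_abelInt_majorant h₁ h₂) ?_
  · filter_upwards [ae_restrict_mem measurableSet_Ioo] with x hx
      using norm_abelInt_integrand_le h₂ hs hx
  · filter_upwards [ae_restrict_mem measurableSet_Ioo] with x hx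
    exact continuousOn_const.mul
      ((continuousOn_id.rpow_const fun s _ => Or.inr (by linarith)).mul
        (ContinuousOn.rpow_const (by fun_prop)
          fun s hs => Or.inl (by nlinarith [hs.1, hs.2, hx.1, hx.2])))

/-- The second derivatives of both terms agree by the symmetry s ↔ 1 - s, so the difference is
affine. Continuity up to the endpoints, where it equals -B and B for B = `beta (1 + β) (1 - β)`,
fixes the slope. -/
theorem abelInt_sub_abelInt_one_sub {β y : ℝ} (h₁ : -(1 / 2) < β) (h₂ : β < 1 / 2)
    (hy : y ∈ Set.Icc (0 : ℝ) 1) :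
    abelInt β y - abelInt β (1 - y) = beta (1 + β) (1 - β) * (2 * y - 1) := by
  have hrefl : ∀ y ∈ Set.Ioo (0 : ℝ) 1, 1 - y ∈ Set.Ioo (0 : ℝ) 1 := fun y hy =>
    ⟨by linarith [hy.2], by linarith [hy.1]⟩
  have d1 : ∀ y ∈ Set.Ioo (0 : ℝ) 1, HasDerivAt (fun y => abelInt β y - abelInt β (1 - y))
      (abelIntDeriv β y + abelIntDeriv β (1 - y)) y := fun y hy => by
    have := (hasDerivAt_abelInt h₁ h₂ hy).sub
      ((hasDerivAt_abelInt h₁ h₂ (hrefl y hy)).comp_const_sub 1 y)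
    exact this.congr_deriv (by ring)
  have d2 : ∀ y ∈ Set.Ioo (0 : ℝ) 1,
      HasDerivAt (fun y => abelIntDeriv β y + abelIntDeriv β (1 - y)) 0 y := fun y hy => by
    have := (hasDerivAt_abelIntDeriv h₁ h₂ hy).add
      ((hasDerivAt_abelIntDeriv h₁ h₂ (hrefl y hy)).comp_const_sub 1 y)
    refine this.congr_deriv ?_
    rw [sub_sub_cancel]
    ring
  obtain ⟨c, hc⟩ := isOpen_Ioo.exists_is_const_of_deriv_eq_zero isPreconnected_Ioo
    (fun y hy => (d2 y hy).differentiableAt.differentiableWithinAt) (fun y hy => (d2 y hy).deriv)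
  have hcont : ContinuousOn (fun y => abelInt β y - abelInt β (1 - y)) (Set.Icc 0 1) :=
    (continuousOn_abelInt h₁ h₂).sub ((continuousOn_abelInt h₁ h₂).comp (by fun_prop)
      fun y hy => ⟨by linarith [hy.2], by linarith [hy.1]⟩)
  have hlin : ∀ y ∈ Set.Icc (0 : ℝ) 1, c * y = abelInt β y - abelInt β (1 - y)
      + beta (1 + β) (1 - β) := fun y hy => by
    have := intervalIntegral.integral_eq_sub_of_hasDerivAt_of_le (f' := fun _ => c) hy.1
      (hcont.mono (Set.Icc_subset_Icc_right hy.2))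
      (fun x hx => (d1 x ⟨hx.1, hx.2.trans_le hy.2⟩).congr_deriv
        (hc x ⟨hx.1, hx.2.trans_le hy.2⟩)) (by simp)
    rw [intervalIntegral.integral_const, sub_zero, sub_zero, abelInt_zero h₂, abelInt_one h₁ h₂,
      smul_eq_mul] at this
    linarith
  have hc2 := hlin 1 ⟨zero_le_one, le_rfl⟩
  rw [sub_self, abelInt_zero h₂, abelInt_one h₁ h₂] at hc2
  have := hlin y hy
  rw [show c = 2 * beta (1 + β) (1 - β) by linarith] at this
  linarith

end DobricOjeda

namespace DobricOjeda

/-! ### Odd powers -/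

/-- The odd power function `sign x |x|^r`. -/
noncomputable def oddPow (r x : ℝ) : ℝ := Real.sign x * |x| ^ r

theorem oddPow_of_pos {r x : ℝ} (hx : 0 < x) : oddPow r x = x ^ r := by
  rw [oddPow, Real.sign_of_pos hx, abs_of_pos hx, one_mul]

theorem oddPow_of_neg {r x : ℝ} (hx : x < 0) : oddPow r x = -(-x) ^ r := by
  rw [oddPow, Real.sign_of_neg hx, abs_of_neg hx, neg_one_mul]

theorem oddPow_zero (r : ℝ) : oddPow r 0 = 0 := by rw [oddPow, Real.sign_zero, zero_mul]

theorem oddPow_mono {r : ℝ} (hr : 0 ≤ r) : Monotone (oddPow r) := by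
  intro x y hxy
  rcases lt_trichotomy x 0 with hx | rfl | hx
  · rcases lt_trichotomy y 0 with hy | rfl | hy
    · rw [oddPow_of_neg hx, oddPow_of_neg hy, neg_le_neg_iff]
      exact Real.rpow_le_rpow (by linarith) (by linarith) hr
    · rw [oddPow_of_neg hx, oddPow_zero]
      linarith [Real.rpow_nonneg (by linarith : 0 ≤ -x) r]
    · rw [oddPow_of_neg hx, oddPow_of_pos hy]
      linarith [Real.rpow_nonneg (by linarith : 0 ≤ -x) r, Real.rpow_nonneg hy.le r]
  · rcases hxy.eq_or_lt with rfl | hy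
    · rfl
    · rw [oddPow_zero, oddPow_of_pos hy]
      exact Real.rpow_nonneg hy.le r
  · rw [oddPow_of_pos hx, oddPow_of_pos (hx.trans_le hxy)]
    exact Real.rpow_le_rpow hx.le hxy hr

theorem abs_oddPow_le (r x : ℝ) : |oddPow r x| ≤ |x| ^ r := by
  rcases lt_trichotomy x 0 with hx | rfl | hx
  · rw [oddPow_of_neg hx, abs_neg, abs_of_neg hx,
      abs_of_nonneg (Real.rpow_nonneg (by linarith) r)]
  · rw [oddPow_zero, abs_zero]
    exact Real.rpow_nonneg le_rfl r
  · rw [oddPow_of_pos hx, abs_of_pos hx, abs_of_nonneg (Real.rpow_nonneg hx.le r)]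

theorem measurable_oddPow (r : ℝ) : Measurable (oddPow r) := by
  unfold oddPow Real.sign
  exact (Measurable.ite measurableSet_Iio measurable_const
    (Measurable.ite measurableSet_Ioi measurable_const measurable_const)).mul
    (by fun_prop)

theorem intervalIntegrable_abs_rpow {r : ℝ} (hr : -1 < r) (a b : ℝ) :
    IntervalIntegrable (fun x : ℝ => |x| ^ r) volume a b := by
  have hpos : ∀ c : ℝ, 0 ≤ c → IntervalIntegrable (fun x : ℝ => |x| ^ r) volume 0 c := by
    intro c hc
    refine (intervalIntegral.intervalIntegrable_rpow' hr).congr fun x hx => ?_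
    rw [Set.uIoc_of_le hc] at hx
    simp only [abs_of_pos hx.1]
  have h : ∀ c : ℝ, IntervalIntegrable (fun x : ℝ => |x| ^ r) volume 0 c := by
    intro c
    rcases le_total 0 c with hc | hc
    · exact hpos c hc
    · rw [IntervalIntegrable.iff_comp_neg]
      simpa using hpos (-c) (by linarith)
  exact (h a).symm.trans (h b)

theorem intervalIntegrable_oddPow {r : ℝ} (hr : -1 < r) (a b : ℝ) :
    IntervalIntegrable (oddPow r) volume a b := by
  refine (intervalIntegrable_abs_rpow hr a b).mono_fun
    (measurable_oddPow r).aestronglyMeasurable (Eventually.of_forall fun x => ?_)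
  exact (abs_oddPow_le r x).trans (le_abs_self _)

theorem integral_oddPow {r : ℝ} (hr : -1 < r) (a b : ℝ) :
    ∫ x in a..b, (r + 1) * oddPow r x = |b| ^ (r + 1) - |a| ^ (r + 1) := by
  -- For r < 0 the derivative blows up at 0. The primitive |x|^(r+1) is still continuous, so one
  -- exceptional point is harmless.
  refine MeasureTheory.integral_eq_of_hasDerivAt_off_countable _ _ (Set.countable_singleton 0)
    (ContinuousOn.rpow_const (by fun_prop) fun x _ => Or.inr (by linarith)) ?_
    ((intervalIntegrable_oddPow hr a b).const_mul _)
  rintro x ⟨-, hx⟩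
  rcases lt_or_gt_of_ne (show x ≠ 0 from hx) with h | h
  · refine ((hasDerivAt_neg x).rpow_const (p := r + 1) (Or.inl (by linarith))).congr_of_eventuallyEq
      ?_ |>.congr_deriv ?_
    · filter_upwards [Iio_mem_nhds h] with y hy
      rw [abs_of_neg hy]
    · rw [oddPow_of_neg h, add_sub_cancel_right]
      ring
  · refine ((hasDerivAt_id x).rpow_const (p := r + 1) (Or.inl h.ne')).congr_of_eventuallyEq
      ?_ |>.congr_deriv ?_
    · filter_upwards [Ioi_mem_nhds h] with y hy
      rw [abs_of_pos hy, id]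
    · rw [oddPow_of_pos h, add_sub_cancel_right, id]
      ring

/-! ### The covariance of fractional Brownian motion -/

/-- The covariance of fractional Brownian motion. -/
noncomputable def fbmCov (H u s : ℝ) : ℝ := (u ^ (2 * H) + s ^ (2 * H) - |u - s| ^ (2 * H)) / 2

/-- The derivative of `fbmCov` in its first variable. -/
noncomputable def fbmCovDeriv (H u s : ℝ) : ℝ :=
  H * (oddPow (2 * H - 1) u - oddPow (2 * H - 1) (u - s))

theorem intervalIntegrable_fbmCovDeriv {H : ℝ} (hH : 0 < H) (s a b : ℝ) :
    IntervalIntegrable (fun u => fbmCovDeriv H u s) volume a b :=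
  ((intervalIntegrable_oddPow (by linarith) a b).sub
    (by simpa using (intervalIntegrable_oddPow (r := 2 * H - 1) (by linarith)
      (a - s) (b - s)).comp_sub_right s)).const_mul H

theorem integral_fbmCovDeriv {H s a b : ℝ} (hH : 0 < H) (ha : 0 ≤ a) (hb : 0 ≤ b) :
    ∫ u in a..b, fbmCovDeriv H u s = fbmCov H b s - fbmCov H a s := by
  have h1 := integral_oddPow (r := 2 * H - 1) (by linarith) a b
  have h2 := integral_oddPow (r := 2 * H - 1) (by linarith) (a - s) (b - s)
  rw [intervalIntegral.integral_const_mul, sub_add_cancel] at h1 h2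
  unfold fbmCovDeriv
  rw [intervalIntegral.integral_const_mul, intervalIntegral.integral_sub
    (intervalIntegrable_oddPow (by linarith) a b)
    (by simpa using (intervalIntegrable_oddPow (r := 2 * H - 1) (by linarith)
      (a - s) (b - s)).comp_sub_right s),
    intervalIntegral.integral_comp_sub_right (fun u => oddPow (2 * H - 1) u)]
  rw [abs_of_nonneg ha, abs_of_nonneg hb] at h1
  unfold fbmCov
  linarith

/-! ### The kernel of the fundamental martingale -/

/-- The kernel `(u (1 - u))^(1/2 - H)`. -/
noncomputable def martKernel (H u : ℝ) : ℝ := u ^ (1 / 2 - H) * (1 - u) ^ (1 / 2 - H)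

theorem martKernel_one_sub (H u : ℝ) : martKernel H (1 - u) = martKernel H u := by
  rw [martKernel, martKernel, sub_sub_cancel, mul_comm]

/-- The substitution u = y x turns the Abel integral with β = 1/2 - H into its rescaled form on
(0,1). -/
theorem abelInt_eq {H y : ℝ} (h0 : 0 < H) (h1 : H < 1) (hy : y ∈ Set.Icc (0 : ℝ) 1) :
    IntegrableOn (fun u => martKernel H u * (y - u) ^ (2 * H - 1)) (Set.Ioo 0 y) ∧
      ∫ u in Set.Ioo 0 y, martKernel H u * (y - u) ^ (2 * H - 1) = abelInt (1 / 2 - H) y := by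
  rcases hy.1.eq_or_lt with rfl | hy0
  · rw [abelInt_zero (show 1 / 2 - H < 1 / 2 by linarith)]
    simp
  have himg : (fun x => y * x) '' Set.Ioo 0 1 = Set.Ioo 0 y := by
    rw [Set.image_mul_left_Ioo hy0, mul_zero, mul_one]
  have hd : ∀ x ∈ Set.Ioo (0 : ℝ) 1,
      HasDerivWithinAt (fun x => y * x) y (Set.Ioo 0 1) x := fun x _ => by
    simpa using ((hasDerivAt_id x).const_mul y).hasDerivWithinAt
  have hinj : Set.InjOn (fun x => y * x) (Set.Ioo 0 1) := fun a _ b _ h =>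
    mul_left_cancel₀ hy0.ne' h
  have hcongr : ∀ x ∈ Set.Ioo (0 : ℝ) 1,
      |y| • (martKernel H (y * x) * (y - y * x) ^ (2 * H - 1))
        = x ^ (1 / 2 - H) * (1 - x) ^ (-2 * (1 / 2 - H))
          * (y ^ (1 - (1 / 2 - H)) * (1 - y * x) ^ (1 / 2 - H)) := by
    intro x hx
    have hx1 : 0 < 1 - x := by linarith [hx.2]
    rw [abs_of_pos hy0, smul_eq_mul, martKernel, show y - y * x = y * (1 - x) by ring,
      Real.mul_rpow hy0.le hx.1.le, Real.mul_rpow hy0.le hx1.le,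
      show -2 * (1 / 2 - H) = 2 * H - 1 by ring,
      show 1 - (1 / 2 - H) = 1 + (1 / 2 - H) + (2 * H - 1) by ring,
      Real.rpow_add hy0, Real.rpow_add hy0, Real.rpow_one]
    ring
  rw [← himg, integrableOn_image_iff_integrableOn_abs_deriv_smul measurableSet_Ioo hd hinj,
    integral_image_eq_integral_abs_deriv_smul measurableSet_Ioo hd hinj]
  refine ⟨(integrableOn_abelInt_integrand (β := 1 / 2 - H) (by linarith) (by linarith) hy).congr_fun
    (fun x hx => (hcongr x hx).symm) measurableSet_Ioo, ?_⟩
  exact setIntegral_congr_fun measurableSet_Ioo hcongr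

theorem abelInt_one_sub_eq {H y : ℝ} (h0 : 0 < H) (h1 : H < 1) (hy : y ∈ Set.Icc (0 : ℝ) 1) :
    IntegrableOn (fun u => martKernel H u * (u - y) ^ (2 * H - 1)) (Set.Ioo y 1) ∧
      ∫ u in Set.Ioo y 1, martKernel H u * (u - y) ^ (2 * H - 1)
        = abelInt (1 / 2 - H) (1 - y) := by
  have key := abelInt_eq h0 h1 (y := 1 - y) ⟨by linarith [hy.2], by linarith [hy.1]⟩
  have himg : (fun x => 1 - x) '' Set.Ioo 0 (1 - y) = Set.Ioo y 1 := by
    rw [Set.image_const_sub_Ioo]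
    simp
  have hd : ∀ x ∈ Set.Ioo (0 : ℝ) (1 - y),
      HasDerivWithinAt (fun x => 1 - x) (-1) (Set.Ioo 0 (1 - y)) x := fun x _ => by
    simpa using ((hasDerivAt_id x).const_sub 1).hasDerivWithinAt
  have hinj : Set.InjOn (fun x : ℝ => 1 - x) (Set.Ioo 0 (1 - y)) := fun a _ b _ h => by
    simpa using h
  have hcongr : ∀ x ∈ Set.Ioo (0 : ℝ) (1 - y),
      |(-1 : ℝ)| • (martKernel H (1 - x) * (1 - x - y) ^ (2 * H - 1))
        = martKernel H x * (1 - y - x) ^ (2 * H - 1) := by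
    intro x hx
    rw [abs_neg, abs_one, one_smul, martKernel_one_sub, sub_right_comm]
  rw [← himg, integrableOn_image_iff_integrableOn_abs_deriv_smul measurableSet_Ioo hd hinj,
    integral_image_eq_integral_abs_deriv_smul measurableSet_Ioo hd hinj]
  exact ⟨key.1.congr_fun (fun x hx => (hcongr x hx).symm) measurableSet_Ioo,
    (setIntegral_congr_fun measurableSet_Ioo hcongr).trans key.2⟩

/-- The odd power changes sign at y. The part left of y is an Abel integral up to y, and the part
right of y is its mirror image under u ↦ 1 - u. -/
theorem martKernel_mul_oddPow {H y : ℝ} (h0 : 0 < H) (h1 : H < 1) (hy : y ∈ Set.Icc (0 : ℝ) 1) :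
    IntegrableOn (fun u => martKernel H u * oddPow (2 * H - 1) (u - y)) (Set.Ioo 0 1) ∧
      ∫ u in Set.Ioo (0 : ℝ) 1, martKernel H u * oddPow (2 * H - 1) (u - y)
        = abelInt (1 / 2 - H) (1 - y) - abelInt (1 / 2 - H) y := by
  obtain ⟨i1, e1⟩ := abelInt_eq h0 h1 hy
  obtain ⟨i2, e2⟩ := abelInt_one_sub_eq h0 h1 hy
  have c1 : ∀ u ∈ Set.Ioo 0 y, -(martKernel H u * (y - u) ^ (2 * H - 1))
      = martKernel H u * oddPow (2 * H - 1) (u - y) := fun u hu => by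
    rw [oddPow_of_neg (by linarith [hu.2]), neg_sub, mul_neg]
  have c2 : ∀ u ∈ Set.Ioo y 1, martKernel H u * (u - y) ^ (2 * H - 1)
      = martKernel H u * oddPow (2 * H - 1) (u - y) := fun u hu => by
    rw [oddPow_of_pos (by linarith [hu.1])]
  have j1 := i1.neg.congr_fun c1 measurableSet_Ioo
  have j2 := i2.congr_fun c2 measurableSet_Ioo
  rw [setIntegral_congr_fun measurableSet_Ioo c2] at e2
  have f1 : ∫ u in Set.Ioo 0 y, martKernel H u * oddPow (2 * H - 1) (u - y)
      = -abelInt (1 / 2 - H) y := by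
    rw [← setIntegral_congr_fun measurableSet_Ioo c1, integral_neg, e1]
  -- Closed and half-open intervals replace the open ones because (0,y) and (y,1) do not cover the
  -- point y.
  rw [← integrableOn_Icc_iff_integrableOn_Ioo] at j1 j2 ⊢
  rw [← integral_Icc_eq_integral_Ioo, integral_Icc_eq_integral_Ioc] at e2 f1 ⊢
  refine ⟨?_, ?_⟩
  · rw [← Set.Icc_union_Icc_eq_Icc hy.1 hy.2]
    exact j1.union j2
  · rw [← Set.Ioc_union_Ioc_eq_Ioc hy.1 hy.2, setIntegral_union
      (Set.Ioc_disjoint_Ioc_of_le le_rfl) measurableSet_Ioc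
      (j1.mono_set Set.Ioc_subset_Icc_self) (j2.mono_set Set.Ioc_subset_Icc_self), e2, f1]
    ring

/-- The fundamental martingale kernel reproduces linear functions. -/
theorem martKernel_mul_fbmCovDeriv {H y : ℝ} (h0 : 0 < H) (h1 : H < 1)
    (hy : y ∈ Set.Icc (0 : ℝ) 1) :
    IntegrableOn (fun u => martKernel H u * fbmCovDeriv H u y) (Set.Ioo 0 1) ∧
      ∫ u in Set.Ioo (0 : ℝ) 1, martKernel H u * fbmCovDeriv H u y
        = 2 * H * beta (3 / 2 - H) (1 / 2 + H) * y := by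
  obtain ⟨i1, e1⟩ := martKernel_mul_oddPow h0 h1 (y := 0) ⟨le_rfl, zero_le_one⟩
  obtain ⟨i2, e2⟩ := martKernel_mul_oddPow h0 h1 hy
  simp only [sub_zero] at i1 e1
  have hfun : (fun u => martKernel H u * fbmCovDeriv H u y)
      = fun u => H * (martKernel H u * oddPow (2 * H - 1) u
        - martKernel H u * oddPow (2 * H - 1) (u - y)) := by
    funext u
    rw [fbmCovDeriv]
    ring
  rw [hfun]
  refine ⟨(i1.sub i2).const_mul H, ?_⟩
  have hb1 : -(1 / 2) < 1 / 2 - H := by linarith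
  have hb2 : 1 / 2 - H < 1 / 2 := by linarith
  have hL := abelInt_sub_abelInt_one_sub hb1 hb2 hy
  rw [integral_const_mul, integral_sub i1 i2, e1, e2, abelInt_zero hb2, abelInt_one hb1 hb2]
  rw [show 1 + (1 / 2 - H) = 3 / 2 - H by ring, show 1 - (1 / 2 - H) = 1 / 2 + H by ring] at hL ⊢
  linear_combination H * hL

-- Total mass of the kernel; it enters as the numerator of c_M.
theorem martKernel_integral {H : ℝ} (h1 : H < 1) :
    IntegrableOn (martKernel H) (Set.Ioo 0 1) ∧
      ∫ u in Set.Ioo (0 : ℝ) 1, martKernel H u = beta (3 / 2 - H) (3 / 2 - H) := by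
  have := setIntegral_rpow_mul_one_sub_rpow (a := 1 / 2 - H) (b := 1 / 2 - H) (by linarith)
    (by linarith)
  rw [show 1 / 2 - H + 1 = 3 / 2 - H by ring] at this
  exact ⟨integrableOn_rpow_mul_one_sub_rpow (by linarith) (by linarith), this⟩

end DobricOjeda

namespace DobricOjeda

/-! ### Step functions -/

theorem TimePartition.step_apply {t : ℝ≥0} (P : TimePartition t) (c : ℕ → ℝ) {i : ℕ} (hi : i < P.n)
    {s : ℝ} (hs : s ∈ Set.Ioc (P.node i : ℝ) (P.node (i + 1))) : P.step c s = c i := by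
  rw [TimePartition.step, Finset.sum_eq_single i, Set.indicator_of_mem hs]
  · intro j _ hj
    refine Set.indicator_of_notMem (fun h => ?_) _
    rcases lt_or_gt_of_ne hj with h' | h'
    · have : (P.node (j + 1) : ℝ) ≤ P.node i := NNReal.coe_le_coe.2 (P.mono h')
      linarith [h.2, hs.1]
    · have : (P.node (i + 1) : ℝ) ≤ P.node j := NNReal.coe_le_coe.2 (P.mono h')
      linarith [h.1, hs.2]
  · exact fun h => absurd (Finset.mem_range.2 hi) h

theorem TimePartition.exists_cell {t : ℝ≥0} (P : TimePartition t) {s : ℝ}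
    (hs : s ∈ Set.Ioc (0 : ℝ) t) :
    ∃ i < P.n, s ∈ Set.Ioc (P.node i : ℝ) (P.node (i + 1)) := by
  classical
  have hex : ∃ k, s ≤ P.node k := ⟨P.n, by rw [P.node_last]; exact hs.2⟩
  have h0 : Nat.find hex ≠ 0 := fun h => by
    have := Nat.find_spec hex
    rw [h, P.node_zero, NNReal.coe_zero] at this
    linarith [hs.1]
  obtain ⟨i, hi⟩ := Nat.exists_eq_succ_of_ne_zero h0
  refine ⟨i, ?_, not_le.1 (Nat.find_min hex (by omega)), ?_⟩
  · have : Nat.find hex ≤ P.n := Nat.find_le (by rw [P.node_last]; exact hs.2)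
    omega
  · have := Nat.find_spec hex
    rwa [hi] at this

theorem TimePartition.node_le {t : ℝ≥0} (P : TimePartition t) {i : ℕ} (hi : i ≤ P.n) :
    P.node i ≤ t := (P.mono hi).trans P.node_last.le

theorem TimePartition.measurable_step {t : ℝ≥0} (P : TimePartition t) (c : ℕ → ℝ) :
    Measurable (P.step c) := by
  unfold TimePartition.step
  exact Finset.measurable_fun_sum _ fun i _ => measurable_const.indicator measurableSet_Ioc

theorem TimePartition.integral_step_mul {t : ℝ≥0} (P : TimePartition t) (c : ℕ → ℝ) {g : ℝ → ℝ}
    (hg : IntegrableOn g (Set.Ioc 0 (t : ℝ))) :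
    ∫ s in Set.Ioc (0 : ℝ) t, P.step c s * g s
      = ∑ i ∈ Finset.range P.n, c i * ∫ s in (P.node i : ℝ)..P.node (i + 1), g s := by
  have hsub : ∀ i ∈ Finset.range P.n,
      Set.Ioc (P.node i : ℝ) (P.node (i + 1)) ⊆ Set.Ioc (0 : ℝ) t := fun i hi =>
    Set.Ioc_subset_Ioc (P.node i).2 (NNReal.coe_le_coe.2 (P.node_le (Finset.mem_range.1 hi)))
  have hterm : ∀ i, ∀ s, (Set.Ioc (P.node i : ℝ) (P.node (i + 1))).indicator (fun _ => c i) s * g s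
      = (Set.Ioc (P.node i : ℝ) (P.node (i + 1))).indicator (fun s => c i * g s) s := fun i s => by
    by_cases h : s ∈ Set.Ioc (P.node i : ℝ) (P.node (i + 1)) <;> simp [h]
  simp only [TimePartition.step, Finset.sum_mul, hterm]
  rw [integral_finsetSum _ fun i _ => (hg.const_mul (c i)).indicator measurableSet_Ioc]
  refine Finset.sum_congr rfl fun i hi => ?_
  rw [setIntegral_indicator measurableSet_Ioc, Set.inter_eq_right.2 (hsub i hi),
    integral_const_mul, intervalIntegral.integral_of_le (NNReal.coe_le_coe.2 (P.mono i.le_succ))]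

/-- The partition of `[0, t]` into `n + 1` intervals of the same length. -/
noncomputable def uniformPartition (t : ℝ≥0) (n : ℕ) : TimePartition t where
  n := n + 1
  node i := t * (i / (n + 1))
  mono i j hij := by
    change t * ((i : ℝ≥0) / (n + 1)) ≤ t * ((j : ℝ≥0) / (n + 1))
    gcongr
  node_zero := by simp
  node_last := by
    push_cast
    rw [div_self (by positivity), mul_one]

theorem coe_uniformPartition_node (t : ℝ≥0) (n i : ℕ) :
    ((uniformPartition t n).node i : ℝ) = t * (i / (n + 1)) := by
  simp [uniformPartition]

/-- Both endpoints of the cell containing s tend to s. The coefficient may depend on both of them,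
so the hypothesis is a joint limit at (s, s). -/
theorem uniformPartition_step_tendsto {t : ℝ≥0} {φ : ℝ → ℝ → ℝ} {y s : ℝ}
    (hs : s ∈ Set.Ioc (0 : ℝ) t) (hφ : Tendsto (Function.uncurry φ) (𝓝 (s, s)) (𝓝 y)) :
    Tendsto (fun n => (uniformPartition t n).step (fun i => φ ((uniformPartition t n).node i)
      ((uniformPartition t n).node (i + 1))) s) atTop (𝓝 y) := by
  choose i hi his using fun n => (uniformPartition t n).exists_cell hs
  have hgap : ∀ n, ((uniformPartition t n).node (i n + 1) : ℝ)
      = (uniformPartition t n).node (i n) + t * (1 / ((n : ℝ) + 1)) := fun n => by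
    rw [coe_uniformPartition_node, coe_uniformPartition_node]
    push_cast
    ring
  have h0 : Tendsto (fun n : ℕ => (t : ℝ) * (1 / ((n : ℝ) + 1))) atTop (𝓝 0) := by
    simpa using tendsto_one_div_add_atTop_nhds_zero_nat.const_mul (t : ℝ)
  have h1 : Tendsto (fun n => ((uniformPartition t n).node (i n) : ℝ)) atTop (𝓝 s) := by
    refine tendsto_of_tendsto_of_tendsto_of_le_of_le (g := fun n : ℕ => s - t * (1 / ((n : ℝ) + 1)))
      (by simpa using h0.const_sub s) tendsto_const_nhds (fun n => ?_) fun n => (his n).1.le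
    have := (his n).2
    rw [hgap] at this
    simp only
    linarith
  have h2 : Tendsto (fun n => ((uniformPartition t n).node (i n + 1) : ℝ)) atTop (𝓝 s) := by
    simp only [hgap]
    simpa using h1.add h0
  refine (hφ.comp (h1.prodMk_nhds h2)).congr fun n => ?_
  rw [TimePartition.step_apply _ _ (hi n) (his n)]
  rfl

/-! ### Lower step approximations of the martingale kernel -/

/-- The smallest value on `[u, v]` of a monotone or antitone power function. -/
noncomputable def minPow (p u v : ℝ) : ℝ := min (u ^ p) (v ^ p)

theorem minPow_nonneg {p u v : ℝ} (hu : 0 ≤ u) (hv : 0 ≤ v) : 0 ≤ minPow p u v :=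
  le_min (Real.rpow_nonneg hu p) (Real.rpow_nonneg hv p)

/-- At u = 0 with p < 0 the convention 0^p = 0 makes `minPow` vanish. The bound survives, and for H
> 1/2 the approximations of the kernel are simply 0 on the two end cells, where the kernel is
unbounded. -/
theorem minPow_le {p u s v : ℝ} (hu : 0 ≤ u) (hs : 0 < s) (hus : u ≤ s) (hsv : s ≤ v) :
    minPow p u v ≤ s ^ p := by
  rcases le_total 0 p with hp | hp
  · exact (min_le_left _ _).trans (Real.rpow_le_rpow hu hus hp)
  · exact (min_le_right _ _).trans (Real.rpow_le_rpow_of_nonpos hs hsv hp)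

theorem tendsto_minPow {p s : ℝ} (hs : 0 < s) :
    Tendsto (Function.uncurry (minPow p)) (𝓝 (s, s)) (𝓝 (s ^ p)) := by
  have h1 : Tendsto (fun q : ℝ × ℝ => q.1 ^ p) (𝓝 (s, s)) (𝓝 (s ^ p)) :=
    (continuousAt_fst (p := (s, s))).rpow_const (Or.inl hs.ne')
  have h2 : Tendsto (fun q : ℝ × ℝ => q.2 ^ p) (𝓝 (s, s)) (𝓝 (s ^ p)) :=
    (continuousAt_snd (p := (s, s))).rpow_const (Or.inl hs.ne')
  have h := h1.min h2
  rw [min_self] at h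
  exact h

theorem minPow_comm (p u v : ℝ) : minPow p u v = minPow p v u := min_comm _ _

theorem minPow_eq_left {p u v : ℝ} (hp : 0 ≤ p) (hu : 0 ≤ u) (huv : u ≤ v) :
    minPow p u v = u ^ p := min_eq_left (Real.rpow_le_rpow hu huv hp)

/-- A lower bound of `martKernel H` on `[u, v]`. -/
noncomputable def martCoeff (H u v : ℝ) : ℝ :=
  minPow (1 / 2 - H) u v * minPow (1 / 2 - H) (1 - u) (1 - v)

theorem martCoeff_nonneg {H u v : ℝ} (hu : u ∈ Set.Icc (0 : ℝ) 1) (hv : v ∈ Set.Icc (0 : ℝ) 1) :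
    0 ≤ martCoeff H u v :=
  mul_nonneg (minPow_nonneg hu.1 hv.1) (minPow_nonneg (by linarith [hu.2]) (by linarith [hv.2]))

theorem martCoeff_le {H u s v : ℝ} (hu : 0 ≤ u) (hs : s ∈ Set.Ioo (0 : ℝ) 1) (hus : u ≤ s)
    (hsv : s ≤ v) (hv : v ≤ 1) : martCoeff H u v ≤ martKernel H s := by
  refine mul_le_mul (minPow_le hu hs.1 hus hsv) ?_
    (minPow_nonneg (by linarith [hs.2]) (by linarith)) (Real.rpow_nonneg hs.1.le _)
  rw [minPow_comm]
  exact minPow_le (by linarith) (by linarith [hs.2]) (by linarith) (by linarith)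

theorem tendsto_martCoeff {H s : ℝ} (hs : s ∈ Set.Ioo (0 : ℝ) 1) :
    Tendsto (Function.uncurry (martCoeff H)) (𝓝 (s, s)) (𝓝 (martKernel H s)) := by
  have h : Tendsto (fun q : ℝ × ℝ => (1 - q.1, 1 - q.2)) (𝓝 (s, s)) (𝓝 (1 - s, 1 - s)) :=
    Continuous.tendsto' (by fun_prop) _ _ rfl
  exact (tendsto_minPow hs.1).mul ((tendsto_minPow (by linarith [hs.2])).comp h)

/-- The coefficients of the `n`-th lower step approximation of `martKernel H`. -/
noncomputable def martStep (H : ℝ) (n i : ℕ) : ℝ :=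
  martCoeff H ((uniformPartition 1 n).node i) ((uniformPartition 1 n).node (i + 1))

theorem coe_node_mem_Icc (n : ℕ) {i : ℕ} (hi : i ≤ n + 1) :
    ((uniformPartition 1 n).node i : ℝ) ∈ Set.Icc (0 : ℝ) 1 :=
  ⟨NNReal.coe_nonneg _, by exact_mod_cast (uniformPartition 1 n).node_le hi⟩

theorem martStep_nonneg {H : ℝ} {n i : ℕ} (hi : i < n + 1) : 0 ≤ martStep H n i :=
  martCoeff_nonneg (coe_node_mem_Icc n hi.le) (coe_node_mem_Icc n hi)

theorem step_martStep_mem {H s : ℝ} (hs : s ∈ Set.Ioo (0 : ℝ) 1) (n : ℕ) :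
    (uniformPartition 1 n).step (martStep H n) s ∈ Set.Icc 0 (martKernel H s) := by
  obtain ⟨i, hi, his⟩ := (uniformPartition 1 n).exists_cell (s := s) ⟨hs.1, by simpa using hs.2.le⟩
  rw [TimePartition.step_apply _ _ hi his]
  exact ⟨martStep_nonneg hi, martCoeff_le (NNReal.coe_nonneg _) hs his.1.le his.2
    (coe_node_mem_Icc n hi).2⟩

/-- The steps lie between 0 and the kernel, so integrability of kernel times g supplies the
dominating function even where the kernel is singular. -/
theorem tendsto_integral_step_mul {H : ℝ} {g : ℝ → ℝ}
    (hg : AEStronglyMeasurable g (volume.restrict (Set.Ioo 0 1)))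
    (hwg : IntegrableOn (fun s => martKernel H s * g s) (Set.Ioo 0 1)) :
    Tendsto (fun n => ∫ s in Set.Ioc (0 : ℝ) ((1 : ℝ≥0) : ℝ),
      (uniformPartition 1 n).step (martStep H n) s * g s) atTop
      (𝓝 (∫ s in Set.Ioo (0 : ℝ) 1, martKernel H s * g s)) := by
  simp only [NNReal.coe_one, integral_Ioc_eq_integral_Ioo]
  refine tendsto_integral_of_dominated_convergence (fun s => |martKernel H s * g s|)
    (fun n => (TimePartition.measurable_step _ _).aestronglyMeasurable.mul hg) hwg.abs
    (fun n => ?_) ?_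
  · filter_upwards [ae_restrict_mem measurableSet_Ioo] with s hs
    have := step_martStep_mem (H := H) hs n
    rw [norm_mul, abs_mul, Real.norm_eq_abs, Real.norm_eq_abs, abs_of_nonneg this.1,
      abs_of_nonneg (this.1.trans this.2)]
    exact mul_le_mul_of_nonneg_right this.2 (abs_nonneg _)
  · filter_upwards [ae_restrict_mem measurableSet_Ioo] with s hs
    exact (uniformPartition_step_tendsto (t := 1) ⟨hs.1, by simpa using hs.2.le⟩
      (tendsto_martCoeff hs)).mul_const _

theorem fbmCovDeriv_aestronglyMeasurable (H y : ℝ) (ν : Measure ℝ) :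
    AEStronglyMeasurable (fun u => fbmCovDeriv H u y) ν := by
  have := measurable_oddPow (2 * H - 1)
  unfold fbmCovDeriv
  fun_prop

theorem integrableOn_fbmCovDeriv {H : ℝ} (hH : 0 < H) (y : ℝ) :
    IntegrableOn (fun u => fbmCovDeriv H u y) (Set.Ioc 0 ((1 : ℝ≥0) : ℝ)) :=
  (intervalIntegrable_iff_integrableOn_Ioc_of_le (by simp)).1
    (intervalIntegrable_fbmCovDeriv hH y _ _)

theorem integral_step_mul_fbmCovDeriv {H : ℝ} (hH : 0 < H) (y : ℝ) (n : ℕ) (c : ℕ → ℝ) :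
    ∫ u in Set.Ioc (0 : ℝ) ((1 : ℝ≥0) : ℝ), (uniformPartition 1 n).step c u * fbmCovDeriv H u y
      = ∑ i ∈ Finset.range (n + 1), c i * (fbmCov H ((uniformPartition 1 n).node (i + 1)) y
        - fbmCov H ((uniformPartition 1 n).node i) y) := by
  rw [TimePartition.integral_step_mul _ _ (integrableOn_fbmCovDeriv hH y)]
  refine Finset.sum_congr rfl fun i _ => ?_
  rw [integral_fbmCovDeriv hH (NNReal.coe_nonneg _) (NNReal.coe_nonneg _)]

theorem tendsto_sum_martStep_fbmCov {H y : ℝ} (h0 : 0 < H) (h1 : H < 1)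
    (hy : y ∈ Set.Icc (0 : ℝ) 1) :
    Tendsto (fun n => ∑ i ∈ Finset.range (n + 1), martStep H n i
        * (fbmCov H ((uniformPartition 1 n).node (i + 1)) y
          - fbmCov H ((uniformPartition 1 n).node i) y)) atTop
      (𝓝 (2 * H * beta (3 / 2 - H) (1 / 2 + H) * y)) := by
  obtain ⟨hi, he⟩ := martKernel_mul_fbmCovDeriv h0 h1 hy
  simp only [← integral_step_mul_fbmCovDeriv h0, ← he]
  exact tendsto_integral_step_mul (fbmCovDeriv_aestronglyMeasurable H y _) hi

theorem integral_step_martStep (H : ℝ) (n : ℕ) :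
    ∫ s in Set.Ioc (0 : ℝ) ((1 : ℝ≥0) : ℝ), (uniformPartition 1 n).step (martStep H n) s * 1
      = ∑ i ∈ Finset.range (n + 1), martStep H n i
        * ((uniformPartition 1 n).node (i + 1) - (uniformPartition 1 n).node i : ℝ) := by
  rw [TimePartition.integral_step_mul _ _ (by simp)]
  refine Finset.sum_congr rfl fun i _ => ?_
  rw [intervalIntegral.integral_const, smul_eq_mul, mul_one]

theorem tendsto_sum_martStep {H : ℝ} (h1 : H < 1) :
    Tendsto (fun n => ∑ i ∈ Finset.range (n + 1), martStep H n i
        * ((uniformPartition 1 n).node (i + 1) - (uniformPartition 1 n).node i : ℝ)) atTop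
      (𝓝 (beta (3 / 2 - H) (3 / 2 - H))) := by
  obtain ⟨hi, he⟩ := martKernel_integral h1
  simp only [← integral_step_martStep, ← he]
  simpa using tendsto_integral_step_mul (H := H) (g := fun _ => 1) (by fun_prop) (by simpa using hi)

theorem sum_martStep_le {H : ℝ} (h1 : H < 1) (n : ℕ) :
    ∑ i ∈ Finset.range (n + 1), martStep H n i
        * ((uniformPartition 1 n).node (i + 1) - (uniformPartition 1 n).node i : ℝ)
      ≤ beta (3 / 2 - H) (3 / 2 - H) := by
  obtain ⟨hi, he⟩ := martKernel_integral h1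
  rw [← integral_step_martStep, ← he]
  simp only [NNReal.coe_one, integral_Ioc_eq_integral_Ioo, mul_one]
  refine integral_mono_of_nonneg ?_ hi ?_
  · filter_upwards [ae_restrict_mem measurableSet_Ioo] with s hs using (step_martStep_mem hs n).1
  · filter_upwards [ae_restrict_mem measurableSet_Ioo] with s hs using (step_martStep_mem hs n).2

/-- For `H ≥ 1/2` the quadratic form of the step approximations stays bounded. -/
theorem sum_sum_martStep_le {H : ℝ} (h0 : 1 / 2 ≤ H) (h1 : H < 1) (n : ℕ) :
    ∑ j ∈ Finset.range (n + 1), martStep H n j * ∑ i ∈ Finset.range (n + 1), martStep H n i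
        * ((fbmCov H ((uniformPartition 1 n).node (i + 1)) ((uniformPartition 1 n).node (j + 1))
          - fbmCov H ((uniformPartition 1 n).node i) ((uniformPartition 1 n).node (j + 1)))
          - (fbmCov H ((uniformPartition 1 n).node (i + 1)) ((uniformPartition 1 n).node j)
          - fbmCov H ((uniformPartition 1 n).node i) ((uniformPartition 1 n).node j)))
      ≤ 2 * H * beta (3 / 2 - H) (1 / 2 + H) * beta (3 / 2 - H) (3 / 2 - H) := by
  have hH : 0 < H := by linarith
  have hκ : 0 ≤ 2 * H * beta (3 / 2 - H) (1 / 2 + H) :=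
    mul_nonneg (by linarith) (beta_pos (by linarith) (by linarith)).le
  refine le_trans ?_ (mul_le_mul_of_nonneg_left (sum_martStep_le h1 n) hκ)
  rw [Finset.mul_sum]
  refine Finset.sum_le_sum fun j hj => ?_
  have hj' := Finset.mem_range.1 hj
  rw [mul_left_comm]
  refine mul_le_mul_of_nonneg_left ?_ (martStep_nonneg hj')
  have hm : ((uniformPartition 1 n).node j : ℝ) ≤ (uniformPartition 1 n).node (j + 1) :=
    NNReal.coe_le_coe.2 ((uniformPartition 1 n).mono j.le_succ)
  have m1 := coe_node_mem_Icc n hj'.le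
  have m2 := coe_node_mem_Icc n hj'
  revert hm m1 m2
  generalize ((uniformPartition 1 n).node j : ℝ) = y
  generalize ((uniformPartition 1 n).node (j + 1) : ℝ) = z
  intro hyz hy hz
  obtain ⟨iy, ey⟩ := martKernel_mul_fbmCovDeriv hH h1 hy
  obtain ⟨iz, ez⟩ := martKernel_mul_fbmCovDeriv hH h1 hz
  have hstep : ∀ y ∈ Set.Icc (0 : ℝ) 1,
      IntegrableOn (fun u => martKernel H u * fbmCovDeriv H u y) (Set.Ioo 0 1) →
      IntegrableOn (fun u => (uniformPartition 1 n).step (martStep H n) u * fbmCovDeriv H u y)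
        (Set.Ioo 0 1) := fun y hy hi => by
    refine hi.abs.mono' ((TimePartition.measurable_step _ _).aestronglyMeasurable.mul
      (fbmCovDeriv_aestronglyMeasurable H y _)) ?_
    filter_upwards [ae_restrict_mem measurableSet_Ioo] with s hs
    have := step_martStep_mem (H := H) hs n
    rw [norm_mul, abs_mul, Real.norm_eq_abs, Real.norm_eq_abs, abs_of_nonneg this.1,
      abs_of_nonneg (this.1.trans this.2)]
    exact mul_le_mul_of_nonneg_right this.2 (abs_nonneg _)
  simp only [mul_sub (martStep H n _), Finset.sum_sub_distrib]
  simp only [← mul_sub (martStep H n _), ← Finset.sum_sub_distrib]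
  rw [mul_sub, ← ey, ← ez, ← integral_sub iz iy]
  have e1 := integral_step_mul_fbmCovDeriv hH y n (martStep H n)
  have e2 := integral_step_mul_fbmCovDeriv hH z n (martStep H n)
  simp only [NNReal.coe_one, integral_Ioc_eq_integral_Ioo] at e1 e2
  simp only [mul_sub (martStep H n _), Finset.sum_sub_distrib] at e1 e2 ⊢
  rw [← e1, ← e2, ← integral_sub (hstep z hz iz) (hstep y hy iy)]
  refine setIntegral_mono_on ((hstep z hz iz).sub (hstep y hy iy)) (iz.sub iy)
    measurableSet_Ioo fun u hu => ?_
  rw [← mul_sub, ← mul_sub]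
  -- Steps may be replaced by the larger kernel because the other factor is nonnegative: for 2H - 1
  -- ≥ 0 the odd power is increasing, which expresses the positive correlation of increments.
  refine mul_le_mul_of_nonneg_right (step_martStep_mem hu n).2 ?_
  unfold fbmCovDeriv
  rw [← mul_sub]
  have := oddPow_mono (r := 2 * H - 1) (by linarith) (show u - z ≤ u - y by linarith)
  exact mul_nonneg hH.le (by linarith)

theorem martStep_eq {H : ℝ} (hH : H ≤ 1 / 2) {n i : ℕ} (hi : i < n + 1) :
    martStep H n i = ((uniformPartition 1 n).node i : ℝ) ^ (1 / 2 - H)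
      * (1 - (uniformPartition 1 n).node (i + 1) : ℝ) ^ (1 / 2 - H) := by
  have hm : ((uniformPartition 1 n).node i : ℝ) ≤ (uniformPartition 1 n).node (i + 1) :=
    NNReal.coe_le_coe.2 ((uniformPartition 1 n).mono i.le_succ)
  have m1 := coe_node_mem_Icc n hi.le
  have m2 := coe_node_mem_Icc n hi
  rw [martStep, martCoeff, minPow_eq_left (by linarith) m1.1 hm, minPow_comm,
    minPow_eq_left (by linarith) (by linarith [m2.2]) (by linarith)]

/-- For `H ≤ 1/2` the step approximations have bounded variation. -/
theorem sum_abs_martStep_sub_le {H : ℝ} (hH : H ≤ 1 / 2) (n : ℕ) :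
    ∑ i ∈ Finset.range n, |martStep H n (i + 1) - martStep H n i| ≤ 2 := by
  set x : ℕ → ℝ := fun i => (uniformPartition 1 n).node i with hx
  have hmono : ∀ i, x i ≤ x (i + 1) := fun i =>
    NNReal.coe_le_coe.2 ((uniformPartition 1 n).mono i.le_succ)
  have hmem : ∀ i, i ≤ n + 1 → x i ∈ Set.Icc (0 : ℝ) 1 := fun i hi => coe_node_mem_Icc n hi
  have hp : 0 ≤ 1 / 2 - H := by linarith
  -- The coefficient is an increasing factor times a decreasing one, both in [0,1]. Its jump is at
  -- most the sum of the two jumps, and each of these telescopes to at most 1.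
  have hle : ∀ i ∈ Finset.range n, |martStep H n (i + 1) - martStep H n i|
      ≤ (x (i + 1) ^ (1 / 2 - H) - x i ^ (1 / 2 - H))
        + ((1 - x (i + 1)) ^ (1 / 2 - H) - (1 - x (i + 2)) ^ (1 / 2 - H)) := by
    intro i hi
    have hi' := Finset.mem_range.1 hi
    rw [martStep_eq hH (by omega), martStep_eq hH (by omega)]
    change |x (i + 1) ^ (1 / 2 - H) * (1 - x (i + 2)) ^ (1 / 2 - H)
      - x i ^ (1 / 2 - H) * (1 - x (i + 1)) ^ (1 / 2 - H)| ≤ _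
    have a1 := hmem i (by omega)
    have a2 := hmem (i + 1) (by omega)
    have a3 := hmem (i + 2) (by omega)
    have f1 := Real.rpow_le_rpow a1.1 (hmono i) hp
    have f2 := Real.rpow_le_one a2.1 a2.2 hp
    have f0 := Real.rpow_nonneg a1.1 (1 / 2 - H)
    have g1 := Real.rpow_le_rpow (by linarith [a3.2] : 0 ≤ 1 - x (i + 2))
      (by linarith [hmono (i + 1)] : 1 - x (i + 2) ≤ 1 - x (i + 1)) hp
    have g2 := Real.rpow_le_one (by linarith [a2.2] : 0 ≤ 1 - x (i + 1)) (by linarith [a2.1]) hp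
    have g0 := Real.rpow_nonneg (by linarith [a3.2] : 0 ≤ 1 - x (i + 2)) (1 / 2 - H)
    rw [abs_le]
    constructor <;> nlinarith
  refine (Finset.sum_le_sum hle).trans ?_
  rw [Finset.sum_add_distrib, Finset.sum_range_sub (fun i => x i ^ (1 / 2 - H)),
    Finset.sum_range_sub' (fun i => (1 - x (i + 1)) ^ (1 / 2 - H))]
  have b1 := hmem 0 (by omega)
  have b2 := hmem n (by omega)
  have b3 := hmem (n + 1) le_rfl
  have b4 := hmem 1 (by omega)
  have := Real.rpow_nonneg b1.1 (1 / 2 - H)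
  have := Real.rpow_le_one b2.1 b2.2 hp
  have := Real.rpow_nonneg (by linarith [b3.2] : 0 ≤ 1 - x (n + 1)) (1 / 2 - H)
  have := Real.rpow_le_one (by linarith [b4.2] : 0 ≤ 1 - x (0 + 1)) (by simpa using b4.1) hp
  linarith

theorem martStep_last_le_one {H : ℝ} (hH : H ≤ 1 / 2) {n i : ℕ} (hi : i < n + 1) :
    martStep H n i ≤ 1 := by
  have m1 := coe_node_mem_Icc n hi.le
  have m2 := coe_node_mem_Icc n hi
  rw [martStep_eq hH hi]
  exact mul_le_one₀ (Real.rpow_le_one m1.1 m1.2 (by linarith))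
    (Real.rpow_nonneg (by linarith [m2.2]) _)
    (Real.rpow_le_one (by linarith [m2.2]) (by linarith [m2.1]) (by linarith))

end DobricOjeda

namespace DobricOjeda

/-! ### The variance of the fundamental martingale -/

section Hilbert

variable {E : Type*} [NormedAddCommGroup E] [InnerProductSpace ℝ E]

/-- For a bounded sequence, weak convergence tested on a set extends to the closed span: by
linearity to the span, then by approximation. Strong convergence of the step sums is never needed.
-/
theorem tendsto_inner_of_mem_closure_span {U : ℕ → E} {C : ℝ} (hU : ∀ n, ‖U n‖ ≤ C) {v : E}
    {S : Set E} (hS : ∀ x ∈ S, Tendsto (fun n => inner ℝ (U n) x) atTop (𝓝 (inner ℝ v x)))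
    {x : E} (hx : x ∈ (Submodule.span ℝ S).topologicalClosure) :
    Tendsto (fun n => inner ℝ (U n) x) atTop (𝓝 (inner ℝ v x)) := by
  have hspan : ∀ x ∈ Submodule.span ℝ S,
      Tendsto (fun n => inner ℝ (U n) x) atTop (𝓝 (inner ℝ v x)) := by
    intro x hx
    induction hx using Submodule.span_induction with
    | mem x hx => exact hS x hx
    | zero => simp
    | add x y _ _ hx hy => simpa only [inner_add_right] using hx.add hy
    | smul c x _ hx => simpa only [inner_smul_right] using hx.const_mul c
  have hC : 0 ≤ C := (norm_nonneg _).trans (hU 0)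
  rw [Metric.tendsto_atTop]
  intro ε hε
  have hK : 0 < C + ‖v‖ + 1 := by positivity
  obtain ⟨y, hy, hxy⟩ := Metric.mem_closure_iff.1 hx (ε / 2 / (C + ‖v‖ + 1)) (by positivity)
  obtain ⟨N, hN⟩ := Metric.tendsto_atTop.1 (hspan y hy) (ε / 2) (half_pos hε)
  refine ⟨N, fun n hn => ?_⟩
  have h1 := hN n hn
  rw [Real.dist_eq] at h1 ⊢
  rw [dist_eq_norm, lt_div_iff₀ hK] at hxy
  have h2 : |inner ℝ (U n) (x - y)| ≤ C * ‖x - y‖ := (abs_real_inner_le_norm _ _).trans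
    (mul_le_mul_of_nonneg_right (hU n) (norm_nonneg _))
  have h3 : |inner ℝ v (x - y)| ≤ ‖v‖ * ‖x - y‖ := abs_real_inner_le_norm _ _
  have h4 : inner ℝ (U n) x - inner ℝ v x
      = inner ℝ (U n) (x - y) - inner ℝ v (x - y) + (inner ℝ (U n) y - inner ℝ v y) := by
    rw [inner_sub_right, inner_sub_right]
    ring
  rw [h4]
  rw [abs_le] at h2 h3
  rw [abs_lt] at h1 ⊢
  have := norm_nonneg (x - y)
  constructor <;> nlinarith

/-- Summation by parts moves the differences from the vectors to the coefficients. -/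
theorem norm_sum_smul_sub_le {c : ℕ → ℝ} {b : ℕ → E} {n : ℕ} {M : ℝ}
    (hb : ∀ i ≤ n + 1, ‖b i‖ ≤ M) :
    ‖∑ i ∈ Finset.range (n + 1), c i • (b (i + 1) - b i)‖
      ≤ (|c n| + |c 0| + ∑ i ∈ Finset.range n, |c (i + 1) - c i|) * M := by
  have hsum : ∀ n, ∑ i ∈ Finset.range (n + 1), c i • (b (i + 1) - b i)
      = c n • b (n + 1) - c 0 • b 0 - ∑ i ∈ Finset.range n, (c (i + 1) - c i) • b (i + 1) := by
    intro n
    induction n with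
    | zero => simp [smul_sub]
    | succ n ih =>
      rw [Finset.sum_range_succ, ih, Finset.sum_range_succ]
      module
  rw [hsum]
  have h1 : ‖∑ i ∈ Finset.range n, (c (i + 1) - c i) • b (i + 1)‖
      ≤ (∑ i ∈ Finset.range n, |c (i + 1) - c i|) * M := by
    rw [Finset.sum_mul]
    refine (norm_sum_le _ _).trans (Finset.sum_le_sum fun i hi => ?_)
    rw [norm_smul, Real.norm_eq_abs]
    exact mul_le_mul_of_nonneg_left (hb _ (by have := Finset.mem_range.1 hi; omega)) (abs_nonneg _)
  have h2 : ‖c n • b (n + 1)‖ ≤ |c n| * M := by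
    rw [norm_smul, Real.norm_eq_abs]
    exact mul_le_mul_of_nonneg_left (hb _ le_rfl) (abs_nonneg _)
  have h3 : ‖c 0 • b 0‖ ≤ |c 0| * M := by
    rw [norm_smul, Real.norm_eq_abs]
    exact mul_le_mul_of_nonneg_left (hb _ (by omega)) (abs_nonneg _)
  calc _ ≤ ‖c n • b (n + 1)‖ + ‖c 0 • b 0‖
          + ‖∑ i ∈ Finset.range n, (c (i + 1) - c i) • b (i + 1)‖ :=
        (norm_sub_le _ _).trans (add_le_add_left (norm_sub_le _ _) _)
    _ ≤ _ := by linarith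

theorem fbmCov_mul {H t u s : ℝ} (ht : 0 ≤ t) (hu : 0 ≤ u) (hs : 0 ≤ s) :
    fbmCov H (t * u) (t * s) = t ^ (2 * H) * fbmCov H u s := by
  unfold fbmCov
  rw [← mul_sub, abs_mul, abs_of_nonneg ht, Real.mul_rpow ht hu, Real.mul_rpow ht hs,
    Real.mul_rpow ht (abs_nonneg _)]
  ring

theorem fbmCov_self {H u : ℝ} (hH : 0 < H) : fbmCov H u u = u ^ (2 * H) := by
  rw [fbmCov, sub_self, abs_zero, Real.zero_rpow (by linarith)]
  ring

/-- The step approximations of the fundamental martingale of `b` at time `t`. -/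
noncomputable def martApprox (H : ℝ) (b : ℝ≥0 → E) (t : ℝ≥0) (n : ℕ) : E :=
  ∑ i ∈ Finset.range (n + 1), martStep H n i
    • (b (t * (uniformPartition 1 n).node (i + 1)) - b (t * (uniformPartition 1 n).node i))

variable {H : ℝ} {b : ℝ≥0 → E}

theorem inner_martApprox (hb : ∀ u s : ℝ≥0, inner ℝ (b u) (b s) = fbmCov H u s) (t s : ℝ≥0)
    (n : ℕ) :
    inner ℝ (martApprox H b t n) (b (t * s)) = (t : ℝ) ^ (2 * H)
      * ∑ i ∈ Finset.range (n + 1), martStep H n i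
        * (fbmCov H ((uniformPartition 1 n).node (i + 1)) s
          - fbmCov H ((uniformPartition 1 n).node i) s) := by
  rw [martApprox, sum_inner, Finset.mul_sum]
  refine Finset.sum_congr rfl fun i _ => ?_
  rw [real_inner_smul_left, inner_sub_left, hb, hb]
  push_cast
  rw [fbmCov_mul t.coe_nonneg (NNReal.coe_nonneg _) s.coe_nonneg,
    fbmCov_mul t.coe_nonneg (NNReal.coe_nonneg _) s.coe_nonneg]
  ring

/-- Two regimes: for H ≤ 1/2 the coefficients have bounded variation and summation by parts applies;
for H ≥ 1/2 increments are positively correlated and the quadratic form is compared with the exact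
kernel. -/
theorem norm_martApprox_bounded (h0 : 0 < H) (h1 : H < 1)
    (hb : ∀ u s : ℝ≥0, inner ℝ (b u) (b s) = fbmCov H u s) (t : ℝ≥0) :
    ∃ C, ∀ n, ‖martApprox H b t n‖ ≤ C := by
  rcases le_total H (1 / 2) with hH | hH
  · have hnorm : ∀ s : ℝ≥0, ‖b s‖ = (s : ℝ) ^ H := fun s => by
      rw [norm_eq_sqrt_real_inner, hb, fbmCov_self h0, Real.sqrt_eq_rpow,
        ← Real.rpow_mul s.coe_nonneg]
      congr 1
      ring
    refine ⟨4 * (t : ℝ) ^ H, fun n => ?_⟩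
    refine (norm_sum_smul_sub_le (c := martStep H n)
      (b := fun i => b (t * (uniformPartition 1 n).node i)) (M := (t : ℝ) ^ H)
      fun i hi => ?_).trans (mul_le_mul_of_nonneg_right ?_ (Real.rpow_nonneg t.coe_nonneg _))
    · rw [hnorm]
      have := coe_node_mem_Icc n hi
      push_cast
      exact Real.rpow_le_rpow (mul_nonneg t.coe_nonneg this.1)
        (mul_le_of_le_one_right t.coe_nonneg this.2) h0.le
    · rw [abs_of_nonneg (martStep_nonneg (by omega)), abs_of_nonneg (martStep_nonneg (by omega))]
      have := martStep_last_le_one hH (n := n) (i := n) (by omega)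
      have := martStep_last_le_one hH (n := n) (i := 0) (by omega)
      have := sum_abs_martStep_sub_le hH n
      linarith
  · refine ⟨√((t : ℝ) ^ (2 * H) * (2 * H * beta (3 / 2 - H) (1 / 2 + H)
      * beta (3 / 2 - H) (3 / 2 - H))), fun n => ?_⟩
    rw [norm_eq_sqrt_real_inner]
    refine Real.sqrt_le_sqrt (le_trans (le_of_eq ?_) (mul_le_mul_of_nonneg_left
      (sum_sum_martStep_le hH h1 n) (Real.rpow_nonneg t.coe_nonneg (2 * H))))
    nth_rw 2 [martApprox]
    rw [inner_sum, Finset.mul_sum]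
    refine Finset.sum_congr rfl fun j _ => ?_
    rw [real_inner_smul_right, inner_sub_right, inner_martApprox hb, inner_martApprox hb]
    simp only [mul_sub, Finset.sum_sub_distrib]
    ring

/-- ⟨U_n, m⟩ is computed twice for the step sums U_n. On the span, U_n tends weakly to (κ
t^{2H-1}/a) m, because both have linear inner products with b; directly, ⟨m, b s⟩ = a s turns ⟨U_n,
m⟩ into a Riemann-type sum of the kernel. Equating the limits determines ‖m‖². -/
theorem norm_sq_of_fbm_projection (h0 : 0 < H) (h1 : H < 1)
    (hb : ∀ u s : ℝ≥0, inner ℝ (b u) (b s) = fbmCov H u s) {t : ℝ≥0} {a : ℝ} (ha : 0 < a) {z m : E}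
    (hz : ∀ s ≤ t, inner ℝ z (b s) = a * s)
    (hm : m ∈ (Submodule.span ℝ (b '' Set.Iic t)).topologicalClosure)
    (hzm : ∀ s ≤ t, inner ℝ (z - m) (b s) = 0) :
    ‖m‖ ^ 2 = a ^ 2 * beta (3 / 2 - H) (3 / 2 - H) / (2 * H * beta (3 / 2 - H) (1 / 2 + H))
      * (t : ℝ) ^ (2 - 2 * H) := by
  obtain ⟨C, hC⟩ := norm_martApprox_bounded h0 h1 hb t
  set κ := 2 * H * beta (3 / 2 - H) (1 / 2 + H) with hκ
  have hκ0 : 0 < κ := mul_pos (by linarith) (beta_pos (by linarith) (by linarith))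
  -- At t = 0 the closed span is trivial, so m = 0; this case is separate because the main argument
  -- divides by t.
  rcases eq_or_ne t 0 with rfl | ht
  · have hb0 : b 0 = 0 := by
      rw [← norm_eq_zero, ← sq_eq_zero_iff, ← real_inner_self_eq_norm_sq, hb, fbmCov_self h0,
        NNReal.coe_zero, Real.zero_rpow (by linarith)]
    have : b '' Set.Iic 0 ⊆ {0} := by
      rintro _ ⟨s, hs, rfl⟩
      rw [nonpos_iff_eq_zero.1 (Set.mem_Iic.1 hs), hb0]
      rfl
    have hm' := Submodule.topologicalClosure_mono (Submodule.span_mono this) hm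
    rw [Submodule.span_zero_singleton] at hm'
    have : m = 0 := by
      have h := Submodule.topologicalClosure_minimal (⊥ : Submodule ℝ E) le_rfl
        (by simp) hm'
      simpa using h
    rw [this, NNReal.coe_zero, Real.zero_rpow (by linarith)]
    simp
  have ht0 : (0 : ℝ) < t := NNReal.coe_pos.2 (pos_iff_ne_zero.2 ht)
  have hmb : ∀ s ≤ t, inner ℝ m (b s) = a * s := fun s hs => by
    rw [← hz s hs, ← sub_eq_zero, ← neg_eq_zero, neg_sub, ← inner_sub_left, hzm s hs]
  have hlim : Tendsto (fun n => inner ℝ (martApprox H b t n) m) atTop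
      (𝓝 (inner ℝ ((κ * (t : ℝ) ^ (2 * H - 1) / a) • m) m)) := by
    refine tendsto_inner_of_mem_closure_span hC ?_ hm
    rintro _ ⟨s, hs, rfl⟩
    rw [real_inner_smul_left, hmb s hs]
    have hs' : (s : ℝ) / t ∈ Set.Icc (0 : ℝ) 1 :=
      ⟨by positivity, (div_le_one ht0).2 (NNReal.coe_le_coe.2 hs)⟩
    have e : s = t * (s / t) := by rw [mul_div_cancel₀ _ ht]
    rw [e]
    simp only [inner_martApprox hb]
    rw [← e]
    have := (tendsto_sum_martStep_fbmCov h0 h1 hs').const_mul ((t : ℝ) ^ (2 * H))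
    push_cast
    convert this using 2
    rw [Real.rpow_sub ht0, Real.rpow_one, ← hκ]
    field_simp
  have hlim2 : Tendsto (fun n => inner ℝ (martApprox H b t n) m) atTop
      (𝓝 (a * t * beta (3 / 2 - H) (3 / 2 - H))) := by
    refine ((tendsto_sum_martStep h1).const_mul (a * t)).congr fun n => ?_
    rw [martApprox, sum_inner, Finset.mul_sum]
    refine Finset.sum_congr rfl fun i hi => ?_
    have hle : ∀ j ≤ n + 1, t * (uniformPartition 1 n).node j ≤ t := fun j hj =>
      mul_le_of_le_one_right zero_le (NNReal.coe_le_coe.1 (coe_node_mem_Icc n hj).2)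
    have hi' := Finset.mem_range.1 hi
    rw [real_inner_smul_left, inner_sub_left, real_inner_comm, real_inner_comm _ (b (t * _)),
      hmb _ (hle _ hi'), hmb _ (hle _ hi'.le)]
    push_cast
    ring
  have heq := tendsto_nhds_unique hlim hlim2
  rw [real_inner_smul_left, real_inner_self_eq_norm_sq] at heq
  have hp : (t : ℝ) ^ (2 - 2 * H) * (t : ℝ) ^ (2 * H - 1) = t := by
    rw [← Real.rpow_add ht0]
    ring_nf
    rw [Real.rpow_one]
  have hq := Real.rpow_pos_of_pos ht0 (2 * H - 1)
  clear_value κ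
  generalize beta (3 / 2 - H) (3 / 2 - H) = B at heq ⊢
  generalize (t : ℝ) ^ (2 - 2 * H) = T at hp ⊢
  generalize (t : ℝ) ^ (2 * H - 1) = S at heq hp hq
  rw [← hp] at heq
  have hκ1 := hκ0.ne'
  have hS := hq.ne'
  field_simp at heq ⊢
  linarith

end Hilbert

/-! ### Constants of the fractional Gaussian field -/

theorem aConst_pos (H : Hurst) : 0 < aConst H := by
  have h0 := H.2.1
  have h1 := H.2.2
  refine mul_pos (Real.sqrt_pos.2 (mul_pos (Real.Gamma_pos_of_pos (by linarith))
    (Real.Gamma_pos_of_pos (by linarith)))) (pow_pos (Real.sin_pos_of_pos_of_lt_pi ?_ ?_) 2)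
  · exact mul_pos Real.pi_pos h0
  · nlinarith [Real.pi_pos]

theorem cM_eq (H : Hurst) : cM H = aConst H ^ 2 * beta (3 / 2 - H) (3 / 2 - H)
    / (2 * H * beta (3 / 2 - H) (1 / 2 + H)) := by
  have h0 : (0 : ℝ) < H := H.2.1
  have h1 : (H : ℝ) < 1 := H.2.2
  have g1 := (Real.Gamma_pos_of_pos (show (0 : ℝ) < 3 / 2 - H by linarith)).ne'
  have g2 := (Real.Gamma_pos_of_pos (show (0 : ℝ) < H + 1 / 2 by linarith)).ne'
  have g3 := (Real.Gamma_pos_of_pos (show (0 : ℝ) < 3 - 2 * H by linarith)).ne'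
  rw [cM, beta, beta, show (3 / 2 - H + (3 / 2 - H) : ℝ) = 3 - 2 * H by ring,
    show (3 / 2 - H + (1 / 2 + H) : ℝ) = 2 by ring, Real.Gamma_two, add_comm (1 / 2 : ℝ)]
  field_simp

theorem cM_pos (H : Hurst) : 0 < cM H := by
  have h0 : (0 : ℝ) < H := H.2.1
  have h1 : (H : ℝ) < 1 := H.2.2
  rw [cM_eq]
  exact div_pos (mul_pos (pow_pos (aConst_pos H) 2) (beta_pos (by linarith) (by linarith)))
    (mul_pos (by linarith) (beta_pos (by linarith) (by linarith)))

theorem aConst_compl (H : Hurst) : aConst H.compl = aConst H := by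
  have : (H.compl : ℝ) = 1 - H := rfl
  rw [aConst, aConst, this, show Real.pi * (1 - (H : ℝ)) = Real.pi - Real.pi * H by ring,
    Real.sin_pi_sub, mul_comm (Real.Gamma _)]
  ring_nf

theorem aCross_compl (H : Hurst) : aCross H.compl H = aConst H := by
  have : (H.compl : ℝ) + H = 1 := by
    change 1 - (H : ℝ) + H = 1
    ring
  rw [aCross, if_pos this, aConst_compl]

/-- The reflection formula for Γ(-2H)Γ(1+2H) cancels the trigonometric factors, so each Z_H is a
standard fractional Brownian motion. -/
theorem aCross_self (H : Hurst) : aCross H H = 1 := by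
  have h0 : (0 : ℝ) < H := H.2.1
  have h1 : (H : ℝ) < 1 := H.2.2
  rw [aCross]
  split_ifs with h
  · have hH : (H : ℝ) = 1 / 2 := by linarith
    rw [aConst, hH, show Real.pi * (1 / 2) = Real.pi / 2 by ring, Real.sin_pi_div_two]
    norm_num
  · have hsin : 0 < Real.sin (Real.pi * H) :=
      Real.sin_pos_of_pos_of_lt_pi (mul_pos Real.pi_pos h0) (by nlinarith [Real.pi_pos])
    have hG := Real.Gamma_pos_of_pos (show (0 : ℝ) < 2 * H + 1 by linarith)
    -- The cosine has its only zero in the range at H = 1/2, which is the other branch of the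
    -- definition.
    have hcos : Real.cos (Real.pi * H) ≠ 0 := by
      intro hc
      rw [Real.cos_eq_zero_iff] at hc
      obtain ⟨k, hk⟩ := hc
      have hk' : (H : ℝ) = (2 * k + 1) / 2 := by
        have := Real.pi_pos.ne'
        field_simp at hk
        linarith
      have k0 : (0 : ℝ) < 2 * k + 1 := by linarith
      have k1 : (2 * k + 1 : ℝ) < 2 := by linarith
      have k0' : 0 < 2 * k + 1 := by exact_mod_cast k0
      have k1' : 2 * k + 1 < 2 := by exact_mod_cast k1
      have : k = 0 := by omega
      rw [this] at hk'
      norm_num at hk'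
      exact h (by rw [hk']; norm_num)
    have hrefl := Real.Gamma_mul_Gamma_one_sub (-((H : ℝ) + H))
    rw [show 1 - -((H : ℝ) + H) = 2 * H + 1 by ring,
      show Real.pi * -((H : ℝ) + H) = -(2 * (Real.pi * H)) by ring, Real.sin_neg, Real.sin_two_mul]
      at hrefl
    have hs := Real.mul_self_sqrt (mul_pos hG hsin).le
    rw [sub_self, zero_mul, Real.cos_zero, mul_one,
      show ((H : ℝ) + H) * (Real.pi / 2) = Real.pi * H by ring]
    calc _ = -(2 / Real.pi) * (√(Real.Gamma (2 * H + 1) * Real.sin (Real.pi * H))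
          * √(Real.Gamma (2 * H + 1) * Real.sin (Real.pi * H)))
          * Real.Gamma (-((H : ℝ) + H)) * Real.cos (Real.pi * H) := by ring
      _ = -(2 / Real.pi) * (Real.Gamma (-((H : ℝ) + H)) * Real.Gamma (2 * H + 1))
          * (Real.sin (Real.pi * H) * Real.cos (Real.pi * H)) := by rw [hs]; ring
      _ = 1 := by
        rw [hrefl]
        have := Real.pi_pos.ne'
        have := hsin.ne'
        field_simp

end DobricOjeda

namespace DobricOjeda

/-! ### Gaussian Hilbert spaces -/

section

variable {Ω : Type*} {mΩ : MeasurableSpace Ω} {μ : Measure Ω}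

theorem inner_L2_eq {f g : Lp ℝ 2 μ} {X Y : Ω → ℝ} (hX : X =ᵐ[μ] f) (hY : Y =ᵐ[μ] g) :
    inner ℝ f g = ∫ ω, X ω * Y ω ∂μ := by
  rw [MeasureTheory.L2.inner_def]
  refine integral_congr_ae ?_
  filter_upwards [hX, hY] with ω h1 h2
  rw [h1, h2, real_inner_eq_re_inner, RCLike.inner_apply]
  simp [mul_comm]

theorem norm_sq_L2_eq {f : Lp ℝ 2 μ} {X : Ω → ℝ} (hX : X =ᵐ[μ] f) :
    ‖f‖ ^ 2 = ∫ ω, X ω ^ 2 ∂μ := by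
  rw [← real_inner_self_eq_norm_sq, inner_L2_eq hX hX]
  simp only [pow_two]

/-- A space of centred, jointly Gaussian square integrable random variables. -/
def IsGaussianSpace (μ : Measure Ω) (Γ : Submodule ℝ (Lp ℝ 2 μ)) : Prop :=
  ∀ f ∈ Γ, μ.map f = gaussianReal 0 (‖f‖₊ ^ 2)

/-- The fourth moment of the standard Gaussian law. -/
noncomputable def gaussFour : ℝ := ∫ x, x ^ 4 ∂gaussianReal 0 1

theorem gaussFour_nonneg : 0 ≤ gaussFour := integral_nonneg fun x => by positivity

namespace IsGaussianSpace

variable {Γ : Submodule ℝ (Lp ℝ 2 μ)}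

theorem charFun_eq {f : Lp ℝ 2 μ} (hf : μ.map f = gaussianReal 0 (‖f‖₊ ^ 2)) (u : ℝ) :
    ∫ ω, Complex.exp (u * f ω * Complex.I) ∂μ = Complex.exp (-((‖f‖ : ℂ) ^ 2 * u ^ 2 / 2)) := by
  have h := charFun_gaussianReal (μ := 0) (v := ‖f‖₊ ^ 2) u
  rw [← hf, charFun_apply_real, integral_map (Lp.aestronglyMeasurable f).aemeasurable
    (by fun_prop)] at h
  rw [h]
  congr 1
  push_cast
  ring

theorem hasLaw (hΓ : IsGaussianSpace μ Γ) {f : Lp ℝ 2 μ} (hf : f ∈ Γ) :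
    HasLaw f (gaussianReal 0 (‖f‖₊ ^ 2)) μ :=
  ⟨(Lp.aestronglyMeasurable f).aemeasurable, hΓ f hf⟩

/-- Cramér–Wold: every linear functional of finitely many coordinates is again an element of the
linear space Γ, hence Gaussian. -/
theorem isGaussianProcess (hΓ : IsGaussianSpace μ Γ) {T : Type*} {Y : T → Ω → ℝ}
    {y : T → Lp ℝ 2 μ} (hy : ∀ t, y t ∈ Γ) (hY : ∀ t, Y t =ᵐ[μ] y t) :
    IsGaussianProcess Y μ where
  hasGaussianLaw I := by
    classical
    have hm : ∀ t, AEMeasurable (Y t) μ := fun t =>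
      (Lp.aestronglyMeasurable (y t)).aemeasurable.congr (hY t).symm
    refine ⟨isGaussian_of_map_eq_gaussianReal fun L => ?_⟩
    set e : I → I → ℝ := fun i j => if i = j then 1 else 0
    set f : Lp ℝ 2 μ := ∑ i : I, L (e i) • y i with hf
    refine ⟨0, ‖f‖₊ ^ 2, ?_⟩
    rw [← hΓ f (Submodule.sum_mem _ fun i _ => Submodule.smul_mem _ _ (hy i)),
      AEMeasurable.map_map_of_aemeasurable (f := fun ω => I.restrict (Y · ω)) (by fun_prop) 
        (aemeasurable_pi_lambda (fun ω (i : I) => Y i ω) fun i => hm i :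
          AEMeasurable (fun ω => I.restrict (Y · ω)) μ)]
    refine Measure.map_congr ?_
    have h1 : ∀ᵐ ω ∂μ, ∀ i : I, Y i ω = y i ω := ae_all_iff.2 fun i => hY i
    have h2 : ∀ᵐ ω ∂μ, ∀ i : I, (L (e i) • y i : Lp ℝ 2 μ) ω
        = L (e i) • y i ω := ae_all_iff.2 fun i => Lp.coeFn_smul _ _
    have h3 := Lp.coeFn_finsetSum (Finset.univ : Finset I)
      (fun i => L (e i) • y i)
    filter_upwards [h1, h2, h3] with ω e1 e2 e3
    rw [hf, e3, Finset.sum_apply, Function.comp_apply]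
    refine (LinearMap.pi_apply_eq_sum_univ (L : (I → ℝ) →ₗ[ℝ] ℝ) _).trans
      (Finset.sum_congr rfl fun i _ => ?_)
    rw [e2, smul_eq_mul, smul_eq_mul, mul_comm, ← e1]
    rfl

theorem integral_eq_zero (hΓ : IsGaussianSpace μ Γ) {f : Lp ℝ 2 μ} (hf : f ∈ Γ) :
    ∫ ω, f ω ∂μ = 0 := by
  rw [(hΓ.hasLaw hf).integral_eq, integral_id_gaussianReal]

theorem memLp (hΓ : IsGaussianSpace μ Γ) {f : Lp ℝ 2 μ} (hf : f ∈ Γ) {p : ℝ≥0∞} (hp : p ≠ ∞) :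
    MemLp f p μ := by
  have := memLp_id_gaussianReal' (μ := 0) (v := ‖f‖₊ ^ 2) p hp
  rw [← hΓ f hf, memLp_map_measure_iff (by fun_prop) (Lp.aestronglyMeasurable f).aemeasurable]
    at this
  exact this

/-- The law is the standard one scaled by ‖f‖. The numerical value of `gaussFour` is never needed,
only that it is a constant. -/
theorem integral_pow_four (hΓ : IsGaussianSpace μ Γ) {f : Lp ℝ 2 μ} (hf : f ∈ Γ) :
    ∫ ω, f ω ^ 4 ∂μ = gaussFour * ‖f‖ ^ 4 := by
  have h1 : ∫ ω, f ω ^ 4 ∂μ = ∫ x, x ^ 4 ∂gaussianReal 0 (‖f‖₊ ^ 2) := by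
    rw [← hΓ f hf, integral_map (Lp.aestronglyMeasurable f).aemeasurable (by fun_prop)]
  have h2 := gaussianReal_map_const_mul (μ := 0) (v := 1) ‖f‖
  rw [mul_zero, mul_one] at h2
  have h3 : (NNReal.mk (‖f‖ ^ 2) (sq_nonneg _)) = ‖f‖₊ ^ 2 := by
    ext
    simp
  rw [h3] at h2
  rw [h1, ← h2, integral_map (by fun_prop) (by fun_prop)]
  simp only [mul_pow]
  rw [integral_const_mul, gaussFour, mul_comm]

end IsGaussianSpace

theorem map_eq_gaussianReal_of_hasGaussianLaw [IsProbabilityMeasure μ] {f : Lp ℝ 2 μ} {X : Ω → ℝ}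
    (hX : HasGaussianLaw X μ) (h0 : ∫ ω, X ω ∂μ = 0) (hXf : X =ᵐ[μ] f) :
    μ.map f = gaussianReal 0 (‖f‖₊ ^ 2) := by
  rw [← Measure.map_congr hXf, hX.map_eq_gaussianReal, h0]
  congr 1
  rw [variance_of_integral_eq_zero hX.aemeasurable h0]
  have := norm_sq_L2_eq hXf
  rw [← this]
  ext
  simp

variable [IsProbabilityMeasure μ]

theorem isGaussianSpace_span {T : Type*} {X : T → Ω → ℝ} (hX : IsGaussianProcess X μ)
    (h0 : ∀ t, ∫ ω, X t ω ∂μ = 0) {x : T → Lp ℝ 2 μ} (hx : ∀ t, X t =ᵐ[μ] x t) :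
    IsGaussianSpace μ (Submodule.span ℝ (Set.range x)) := by
  intro f hf
  obtain ⟨c, rfl⟩ := Finsupp.mem_span_range_iff_exists_finsupp.1 hf
  refine map_eq_gaussianReal_of_hasGaussianLaw
    (X := fun ω => ∑ i ∈ c.support, c i • X i ω) (hX.smul c).hasGaussianLaw_fun_sum ?_ ?_
  · rw [integral_finsetSum (f := fun i ω => c i • X i ω) c.support fun i _ =>
      ((hX.hasGaussianLaw_eval i).integrable.smul (c i) : Integrable (fun ω => c i • X i ω) μ)]
    refine Finset.sum_eq_zero fun i _ => ?_
    rw [integral_smul, h0, smul_zero]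
  · rw [Finsupp.sum]
    have h1 : ∀ᵐ ω ∂μ, ∀ i ∈ c.support, X i ω = x i ω :=
      (Finset.eventually_all c.support).2 fun i _ => hx i
    have h2 : ∀ᵐ ω ∂μ, ∀ i ∈ c.support, (c i • x i : Lp ℝ 2 μ) ω = c i • x i ω :=
      (Finset.eventually_all c.support).2 fun i _ => Lp.coeFn_smul _ _
    have h3 := Lp.coeFn_finsetSum c.support (fun i => c i • x i)
    filter_upwards [h1, h2, h3] with ω e1 e2 e3
    rw [e3, Finset.sum_apply]
    exact Finset.sum_congr rfl fun i hi => by rw [e1 i hi, e2 i hi]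

namespace IsGaussianSpace

variable {Γ : Submodule ℝ (Lp ℝ 2 μ)}

/-- An L² limit is an almost sure limit along a subsequence, so characteristic functions converge by
dominated convergence, while the norms converge too. -/
theorem topologicalClosure (hΓ : IsGaussianSpace μ Γ) :
    IsGaussianSpace μ Γ.topologicalClosure := by
  intro f hf
  obtain ⟨g, hg, hgf⟩ := mem_closure_iff_seq_limit.1 hf
  obtain ⟨ns, hns, hae⟩ := (tendstoInMeasure_of_tendsto_Lp hgf).exists_seq_tendsto_ae
  have : IsProbabilityMeasure (μ.map f) :=
    Measure.isProbabilityMeasure_map (Lp.aestronglyMeasurable f).aemeasurable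
  refine Measure.ext_of_charFun (funext fun u => ?_)
  rw [charFun_gaussianReal, charFun_apply_real,
    integral_map (Lp.aestronglyMeasurable f).aemeasurable (by fun_prop)]
  have h1 : Tendsto (fun k => ∫ ω, Complex.exp (u * g (ns k) ω * Complex.I) ∂μ) atTop
      (𝓝 (∫ ω, Complex.exp (u * f ω * Complex.I) ∂μ)) := by
    refine tendsto_integral_of_dominated_convergence (fun _ => 1) (fun k => ?_)
      (integrable_const 1) (fun k => ?_) ?_
    · have := (Lp.aestronglyMeasurable (g (ns k))).aemeasurable
      exact AEMeasurable.aestronglyMeasurable (by fun_prop)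
    · refine Eventually.of_forall fun ω => ?_
      rw [← Complex.ofReal_mul, Complex.norm_exp_ofReal_mul_I]
    · filter_upwards [hae] with ω hω
      have hc : Continuous fun x : ℝ => Complex.exp (u * x * Complex.I) := by fun_prop
      exact (hc.tendsto _).comp hω
  have h2 : Tendsto (fun k => Complex.exp (-((‖g (ns k)‖ : ℂ) ^ 2 * u ^ 2 / 2))) atTop
      (𝓝 (Complex.exp (-((‖f‖ : ℂ) ^ 2 * u ^ 2 / 2)))) := by
    have hc : Continuous fun x : ℝ => Complex.exp (-((x : ℂ) ^ 2 * u ^ 2 / 2)) := by fun_prop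
    exact (hc.tendsto _).comp (hgf.norm.comp hns.tendsto_atTop)
  have h3 := tendsto_nhds_unique h1 (h2.congr fun k => (charFun_eq (hΓ _ (hg (ns k))) u).symm)
  rw [h3]
  congr 1
  push_cast
  ring

theorem indepFun (hΓ : IsGaussianSpace μ Γ) {f g : Lp ℝ 2 μ} (hf : f ∈ Γ) (hg : g ∈ Γ)
    (h : inner ℝ f g = 0) : IndepFun f g μ := by
  have hp := hΓ.isGaussianProcess (T := Bool) (Y := fun b => if b then f else g)
    (y := fun b => if b then f else g) (fun b => by cases b <;> assumption)
    (fun b => by cases b <;> rfl)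
  have h2 := hp.hasGaussianLaw_prodMk (s := true) (t := false)
  refine HasGaussianLaw.indepFun_of_covariance_eq_zero (by simpa using h2) ?_
  rw [covariance_eq_sub (Lp.memLp f) (Lp.memLp g), hΓ.integral_eq_zero hf, zero_mul, sub_zero,
    ← h, inner_L2_eq (EventuallyEq.refl _ _) (EventuallyEq.refl _ _)]
  rfl

end IsGaussianSpace

end

/-! ### Conditional expectations of Gaussian variables -/

variable {Ω : Type*} {m mΩ : MeasurableSpace Ω} {μ : Measure Ω}

/-- The L² functions that are m-measurable up to null sets form a closed subspace, so it is enough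
to check the generators. -/
theorem aestronglyMeasurable_of_mem_closure_span {T : Type*} {b : T → Ω → ℝ} {β : T → Lp ℝ 2 μ}
    (hb : ∀ t, b t =ᵐ[μ] β t) (hm : m ≤ mΩ)
    (hbm : ∀ t, Measurable[m] (b t)) {f : Lp ℝ 2 μ}
    (hf : f ∈ (Submodule.span ℝ (Set.range β)).topologicalClosure) :
    AEStronglyMeasurable[m] f μ := by
  have hle : Submodule.span ℝ (Set.range β) ≤ lpMeas ℝ ℝ m 2 μ := by
    rw [Submodule.span_le]
    rintro _ ⟨t, rfl⟩
    refine mem_lpMeas_iff_aestronglyMeasurable.2 ?_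
    exact (hbm t).stronglyMeasurable.aestronglyMeasurable.congr (hb t)
  have hcl : IsClosed ((lpMeas ℝ ℝ m 2 μ : Submodule ℝ (Lp ℝ 2 μ)) : Set (Lp ℝ 2 μ)) :=
    isClosed_aestronglyMeasurable hm
  exact mem_lpMeas_iff_aestronglyMeasurable.1
    (Submodule.topologicalClosure_minimal _ hle hcl hf)

/-- The residual ζ - f is orthogonal to every β t. Joint Gaussianity upgrades this to independence
from the whole family, so its conditional expectation is its mean 0, while f is already measurable
for the conditioning σ-algebra. -/
theorem condExp_gaussian [IsProbabilityMeasure μ]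
    {Γ : Submodule ℝ (Lp ℝ 2 μ)} (hΓ : IsGaussianSpace μ Γ) {T : Type*}
    {b : T → Ω → ℝ} {β : T → Lp ℝ 2 μ} (hb : ∀ t, b t =ᵐ[μ] β t) (hbm : ∀ t, Measurable (b t))
    (hβ : ∀ t, β t ∈ Γ) {z : Ω → ℝ} {ζ f : Lp ℝ 2 μ} (hz : z =ᵐ[μ] ζ) (hζ : ζ ∈ Γ) (hfΓ : f ∈ Γ)
    (hf : f ∈ (Submodule.span ℝ (Set.range β)).topologicalClosure)
    (horth : ∀ t, inner ℝ (ζ - f) (β t) = 0)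
    (hmdef : m = ⨆ t, MeasurableSpace.comap (b t) inferInstance) : μ[z | m] =ᵐ[μ] f := by
  have hm : m ≤ mΩ := hmdef.le.trans <| iSup_le fun t => (hbm t).comap_le
  have hmf := aestronglyMeasurable_of_mem_closure_span hb hm
    (fun t => (comap_measurable (b t)).mono
      (hmdef ▸ le_iSup (fun t => MeasurableSpace.comap (b t) inferInstance) t) le_rfl) hf
  set d : Lp ℝ 2 μ := ζ - f with hd
  have hdΓ : d ∈ Γ := Submodule.sub_mem _ hζ hfΓ
  have hdm : Measurable d := (Lp.stronglyMeasurable d).measurable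
  have hproc : IsGaussianProcess (Sum.elim (fun _ : Unit => (d : Ω → ℝ)) b) μ :=
    hΓ.isGaussianProcess (y := Sum.elim (fun _ => d) β)
      (by rintro (_ | t); exacts [hdΓ, hβ t]) (by rintro (_ | t); exacts [EventuallyEq.rfl, hb t])
  have hind := hproc.indepFun_of_covariance_eq_zero (fun _ => hdm.aemeasurable)
    (fun t => (hbm t).aemeasurable) fun _ t => by
      rw [covariance_eq_sub (Lp.memLp d) ((Lp.memLp (β t)).ae_eq (hb t).symm),
        hΓ.integral_eq_zero hdΓ, zero_mul, sub_zero, ← horth t, inner_L2_eq EventuallyEq.rfl (hb t)]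
      rfl
  rw [IndepFun_iff_Indep] at hind
  have hcomap : MeasurableSpace.comap (fun ω t => b t ω) MeasurableSpace.pi = m := by
    simp only [MeasurableSpace.pi, MeasurableSpace.comap_iSup, MeasurableSpace.comap_comp]
    exact hmdef.symm
  rw [hcomap] at hind
  have hcd : μ[d | m] =ᵐ[μ] fun _ => μ[d] := by
    refine condExp_indep_eq (m₁ := MeasurableSpace.comap (fun ω (_ : Unit) => d ω)
      MeasurableSpace.pi) ?_ hm ?_ hind
    · exact (measurable_pi_lambda _ fun _ => hdm).comap_le
    · refine Measurable.stronglyMeasurable ?_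
      exact (measurable_pi_apply ()).comp (comap_measurable (fun ω (_ : Unit) => d ω))
  have hfi : Integrable f μ := (Lp.memLp f).integrable one_le_two
  have hdi : Integrable d μ := (Lp.memLp d).integrable one_le_two
  have hsum : z =ᵐ[μ] d + f := by
    filter_upwards [hz, Lp.coeFn_sub ζ f] with ω h1 h2
    rw [h1, Pi.add_apply, hd, h2, Pi.sub_apply, sub_add_cancel]
  filter_upwards [condExp_congr_ae (m := m) hsum, condExp_add hdi hfi m, hcd,
    condExp_of_aestronglyMeasurable' hm hmf hfi] with ω h1 h2 h3 h4
  rw [h1, h2, Pi.add_apply, h3, h4, hΓ.integral_eq_zero hdΓ, zero_add]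

end DobricOjeda

namespace DobricOjeda

/-! ### The martingale of the field in the Gaussian Hilbert space -/

/-- A Gaussian martingale with covariance `K min(s,t)^q`, as a curve in the Gaussian Hilbert space
generated by the closed subspaces `A t`. -/
structure IsGaussianMartingale {Ω : Type*} [MeasurableSpace Ω] (μ : Measure Ω)
    (A : ℝ≥0 → Submodule ℝ (Lp ℝ 2 μ)) (m : ℝ≥0 → Lp ℝ 2 μ) (K q : ℝ) : Prop where
  K_pos : 0 < K
  q_pos : 0 < q
  gaussian : IsGaussianSpace μ (⨆ t, A t)
  mono : Monotone A
  isClosed : ∀ t, IsClosed (A t : Set (Lp ℝ 2 μ))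
  mem : ∀ t, m t ∈ A t
  inner_eq : ∀ s t, s ≤ t → inner ℝ (m s) (m t) = K * (s : ℝ) ^ q

theorem IsFractionalGaussianField.memLp {Ω : Type*} [MeasurableSpace Ω] {μ : Measure Ω}
    {Z : Hurst → ℝ≥0 → Ω → ℝ} (hZ : IsFractionalGaussianField μ Z) (H : Hurst) (t : ℝ≥0) :
    MemLp (Z H t) 2 μ :=
  (hZ.gaussian.hasGaussianLaw_eval (H, t)).memLp_two

theorem IsFractionalGaussianField.exists_isGaussianMartingale {Ω : Type*} [MeasurableSpace Ω]
    {μ : Measure Ω} [IsProbabilityMeasure μ] {Z : Hurst → ℝ≥0 → Ω → ℝ}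
    (hZ : IsFractionalGaussianField μ Z) (H : Hurst) :
    ∃ (A : ℝ≥0 → Submodule ℝ (Lp ℝ 2 μ)) (m : ℝ≥0 → Lp ℝ 2 μ),
      IsGaussianMartingale μ A m (cM H) (2 - 2 * H) ∧ (∀ t, martM μ Z H t =ᵐ[μ] m t) ∧
        ∀ t, ∀ f ∈ A t, AEStronglyMeasurable[pastSigma Z H t] f μ := by
  have h0 : (0 : ℝ) < H := H.2.1
  have h1 : (H : ℝ) < 1 := H.2.2
  set z : Hurst × ℝ≥0 → Lp ℝ 2 μ := fun p => (hZ.memLp p.1 p.2).toLp with hzdef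
  have hz : ∀ p, Z p.1 p.2 =ᵐ[μ] z p := fun p => (hZ.memLp p.1 p.2).coeFn_toLp.symm
  set Γ := (Submodule.span ℝ (Set.range z)).topologicalClosure with hΓdef
  have hΓ : IsGaussianSpace μ Γ :=
    (isGaussianSpace_span hZ.gaussian (fun p => hZ.centered p.1 p.2) hz).topologicalClosure
  have hzΓ : ∀ p, z p ∈ Γ := fun p =>
    Submodule.le_topologicalClosure _ (Submodule.subset_span ⟨p, rfl⟩)
  set b : ℝ≥0 → Lp ℝ 2 μ := fun t => z (H, t) with hbdef
  set A : ℝ≥0 → Submodule ℝ (Lp ℝ 2 μ) := fun t =>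
    (Submodule.span ℝ (b '' Set.Iic t)).topologicalClosure with hAdef
  have hAr : ∀ t, A t
      = (Submodule.span ℝ (Set.range fun r : Set.Iic t => b r)).topologicalClosure := fun t => by
    rw [← Set.image_eq_range]
  have hbA : ∀ {s t : ℝ≥0}, s ≤ t → b s ∈ A t := fun h =>
    Submodule.le_topologicalClosure _ (Submodule.subset_span ⟨_, h, rfl⟩)
  have hAmono : Monotone A := fun s t hst =>
    Submodule.topologicalClosure_mono
      (Submodule.span_mono (Set.image_mono (Set.Iic_subset_Iic.2 hst)))
  have hAΓ : ∀ t, A t ≤ Γ := fun t => Submodule.topologicalClosure_mono <|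
    Submodule.span_mono <| by
      rintro _ ⟨s, -, rfl⟩
      exact ⟨(H, s), rfl⟩
  set m : ℝ≥0 → Lp ℝ 2 μ := fun t => (A t).starProjection (z (H.compl, t)) with hmdef
  have hmem : ∀ t, m t ∈ A t := fun t => Submodule.starProjection_apply_mem _ _
  have horth : ∀ t, ∀ y ∈ A t, inner ℝ (z (H.compl, t) - m t) y = 0 := fun t y hy =>
    Submodule.starProjection_inner_eq_zero _ _ hy
  have hbb : ∀ u s : ℝ≥0, inner ℝ (b u) (b s) = fbmCov H u s := fun u s => by
    rw [inner_L2_eq (hz _) (hz _), hZ.covariance, aCross_self, fbmCov, ← two_mul]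
    ring
  -- With exponent H + H' = 1 the covariance is (a/2)(t + s - (t - s)) = a s, independent of t. This
  -- is the source of the martingale structure.
  have hzb : ∀ s t : ℝ≥0, s ≤ t → inner ℝ (z (H.compl, t)) (b s) = aConst H * s := fun s t hst => by
    have hst' : (s : ℝ) ≤ t := hst
    have hc : ((H.compl : Hurst) : ℝ) + H = 1 := by
      change 1 - (H : ℝ) + H = 1
      ring
    rw [inner_L2_eq (hz _) (hz _), hZ.covariance, aCross_compl, hc, Real.rpow_one, Real.rpow_one,
      Real.rpow_one, abs_of_nonneg (by linarith)]
    ring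
  have hnorm : ∀ t : ℝ≥0, ‖m t‖ ^ 2 = cM H * (t : ℝ) ^ (2 - 2 * (H : ℝ)) := fun t => by
    rw [cM_eq]
    exact norm_sq_of_fbm_projection h0 h1 hbb (aConst_pos H) (fun s hs => hzb s t hs) (hmem t)
      fun s hs => horth t _ (hbA hs)
  have hdiff : ∀ s t : ℝ≥0, s ≤ t → ∀ y ∈ A s, inner ℝ (z (H.compl, t) - z (H.compl, s)) y = 0 := by
    intro s t hst y hy
    have hle : A s ≤ (Submodule.span ℝ {z (H.compl, t) - z (H.compl, s)})ᗮ := by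
      refine Submodule.topologicalClosure_minimal _ ?_ (Submodule.isClosed_orthogonal _)
      rw [Submodule.span_le]
      rintro _ ⟨r, hr, rfl⟩
      rw [SetLike.mem_coe, Submodule.mem_orthogonal_singleton_iff_inner_right, inner_sub_left,
        hzb r t (le_trans hr hst), hzb r s hr, sub_self]
    exact Submodule.mem_orthogonal_singleton_iff_inner_right.1 (hle hy)
  refine ⟨A, m, ⟨cM_pos H, by linarith, ?_, hAmono,
    fun t => Submodule.isClosed_topologicalClosure _, hmem, ?_⟩, ?_, ?_⟩
  · exact fun f hf => hΓ f (iSup_le hAΓ hf)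
  · intro s t hst
    -- The chain is ⟨m s, m t⟩ = ⟨m s, z t⟩ = ⟨m s, z s⟩ = ‖m s‖², where z is the curve of Z_{1-H}.
    have e1 := horth t (m s) (hAmono hst (hmem s))
    have e2 := horth s (m s) (hmem s)
    have e3 := hdiff s t hst (m s) (hmem s)
    rw [inner_sub_left] at e1 e2 e3
    rw [real_inner_comm, ← hnorm s, ← real_inner_self_eq_norm_sq]
    linarith
  · intro t
    exact condExp_gaussian hΓ (b := fun r : Set.Iic t => Z H r) (β := fun r : Set.Iic t => b r)
      (fun r => hz (H, (r : ℝ≥0))) (fun r => hZ.measurable H r) (fun r => hzΓ _)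
      (hz (H.compl, t)) (hzΓ _) (hAΓ t (hmem t)) (hAr t ▸ hmem t)
      (fun r => horth t _ (hbA r.2)) rfl
  · intro t f hf
    refine aestronglyMeasurable_of_mem_closure_span (m := pastSigma Z H t) 
      (b := fun r : Set.Iic t => Z H r) (β := fun r : Set.Iic t => b r) (fun r => hz (H, (r : ℝ≥0)))
      (iSup_le fun r => (hZ.measurable H r).comap_le) (fun r => ?_) (hAr t ▸ hf)
    exact (comap_measurable (Z H r)).mono
      (le_iSup (fun r : Set.Iic t => MeasurableSpace.comap (Z H r) inferInstance) r) le_rfl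

end DobricOjeda

namespace DobricOjeda

/-! ### Measurable modifications -/

theorem lintegral_enorm_sq_L2 {Ω : Type*} [MeasurableSpace Ω] {μ : Measure Ω} (f : Lp ℝ 2 μ) :
    ∫⁻ ω, ‖f ω‖ₑ ^ 2 ∂μ = ENNReal.ofReal (‖f‖ ^ 2) := by
  rw [norm_sq_L2_eq EventuallyEq.rfl, ofReal_integral_eq_lintegral_ofReal
    (Lp.memLp f).integrable_sq (Eventually.of_forall fun ω => sq_nonneg _)]
  refine lintegral_congr fun ω => ?_
  rw [← ofReal_norm, ← ENNReal.ofReal_pow (norm_nonneg _), Real.norm_eq_abs, sq_abs]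

/-- The sum of the squared differences has finite expectation, so it is finite almost surely and its
terms tend to 0. -/
theorem ae_tendsto_of_summable_norm_sub_sq {Ω : Type*} [MeasurableSpace Ω] {μ : Measure Ω}
    {f : ℕ → Lp ℝ 2 μ} {g : Lp ℝ 2 μ} (h : Summable fun n => ‖f n - g‖ ^ 2) :
    ∀ᵐ ω ∂μ, Tendsto (fun n => f n ω) atTop (𝓝 (g ω)) := by
  have hm : ∀ n, AEMeasurable (fun ω => ‖(f n - g : Lp ℝ 2 μ) ω‖ₑ ^ 2) μ := fun n =>
    (Lp.aestronglyMeasurable (f n - g)).enorm.pow_const 2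
  have hne : ∫⁻ ω, ∑' n, ‖(f n - g : Lp ℝ 2 μ) ω‖ₑ ^ 2 ∂μ ≠ ∞ := by
    rw [lintegral_tsum hm]
    simp only [lintegral_enorm_sq_L2]
    exact h.tsum_ofReal_ne_top
  filter_upwards [ae_lt_top' (AEMeasurable.tsum hm) hne,
    ae_all_iff.2 fun n => Lp.coeFn_sub (f n) g] with ω h1 h2
  have h3 := ENNReal.tendsto_atTop_zero_of_tsum_ne_top h1.ne
  have h4 : Tendsto (fun n => (f n ω - g ω) ^ 2) atTop (𝓝 0) := by
    have := (ENNReal.tendsto_toReal ENNReal.zero_ne_top).comp h3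
    refine this.congr fun n => ?_
    rw [Function.comp_apply, h2 n, Pi.sub_apply, ENNReal.toReal_pow, toReal_enorm,
      Real.norm_eq_abs, sq_abs]
  have h5 := h4.sqrt
  simp only [Real.sqrt_sq_eq_abs, Real.sqrt_zero] at h5
  have h6 := (tendsto_zero_iff_abs_tendsto_zero _).2 h5
  simpa using h6.add_const (g ω)

namespace IsGaussianMartingale

variable {Ω : Type*} [MeasurableSpace Ω] {μ : Measure Ω} {A : ℝ≥0 → Submodule ℝ (Lp ℝ 2 μ)}
  {m : ℝ≥0 → Lp ℝ 2 μ} {K q : ℝ}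

theorem norm_sq (h : IsGaussianMartingale μ A m K q) (t : ℝ≥0) :
    ‖m t‖ ^ 2 = K * (t : ℝ) ^ q := by
  rw [← real_inner_self_eq_norm_sq, h.inner_eq t t le_rfl]

theorem norm_sub_sq (h : IsGaussianMartingale μ A m K q) {s t : ℝ≥0} (hst : s ≤ t) :
    ‖m s - m t‖ ^ 2 = K * ((t : ℝ) ^ q - (s : ℝ) ^ q) := by
  rw [norm_sub_sq_real, h.norm_sq, h.norm_sq, h.inner_eq s t hst]
  ring

/-- Time is discretised on a grid of mesh 4^{-n} in the variable t^q, in which ‖m s - m t‖² is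
linear. The squared errors are then summable for each t, and every approximation takes countably
many values in t, hence is jointly measurable. -/
theorem exists_measurable_modification (h : IsGaussianMartingale μ A m K q) :
    ∃ M : ℝ≥0 → Ω → ℝ, Measurable (Function.uncurry M) ∧ ∀ t, M t =ᵐ[μ] m t := by
  have hq := h.q_pos
  obtain ⟨k, hkdef⟩ : ∃ k : ℕ → ℝ≥0 → ℕ, ∀ n t, k n t = ⌊(4 : ℝ≥0) ^ n * t ^ q⌋₊ :=
    ⟨_, fun _ _ => rfl⟩
  obtain ⟨g, hgdef⟩ : ∃ g : ℕ → ℕ → ℝ≥0, ∀ n j, g n j = ((j : ℝ≥0) / 4 ^ n) ^ q⁻¹ :=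
    ⟨_, fun _ _ => rfl⟩
  have hk : ∀ n, Measurable (k n) := fun n => by
    simp only [funext (hkdef n)]
    exact Nat.measurable_floor.comp (by fun_prop)
  -- A limsup is jointly measurable everywhere; it matters only that, for each t, it is almost
  -- surely the limit.
  refine ⟨fun t ω => limsup (fun n => m (g n (k n t)) ω) atTop, ?_, fun t => ?_⟩
  · refine Measurable.limsup fun n => ?_
    have h1 : Measurable fun p : ℕ × Ω => m (g n p.1) p.2 :=
      measurable_from_prod_countable_right fun j => (Lp.stronglyMeasurable (m (g n j))).measurable
    exact h1.comp (((hk n).comp measurable_fst).prodMk measurable_snd)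
  · have hpow : ∀ n, (g n (k n t)) ^ q = (k n t : ℝ≥0) / 4 ^ n := fun n => by
      rw [hgdef, ← NNReal.rpow_mul, inv_mul_cancel₀ hq.ne', NNReal.rpow_one]
    have h4 : ∀ n, (0 : ℝ≥0) < 4 ^ n := fun n => by positivity
    have hle : ∀ n, g n (k n t) ≤ t := fun n => by
      rw [← NNReal.rpow_le_rpow_iff hq, hpow, hkdef, div_le_iff₀ (h4 n), mul_comm]
      exact Nat.floor_le (by positivity)
    have hge : ∀ n, t ^ q ≤ (g n (k n t)) ^ q + (1 / 4) ^ n := fun n => by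
      rw [hpow, hkdef, one_div, inv_pow, ← one_div, ← add_div, le_div_iff₀ (h4 n), mul_comm]
      exact (Nat.lt_floor_add_one _).le
    have hsum : Summable fun n => ‖m (g n (k n t)) - m t‖ ^ 2 := by
      refine Summable.of_nonneg_of_le (fun n => sq_nonneg _) (fun n => ?_)
        ((summable_geometric_of_lt_one (r := (1 / 4 : ℝ)) (by norm_num) (by norm_num)).mul_left K)
      rw [h.norm_sub_sq (hle n)]
      refine mul_le_mul_of_nonneg_left ?_ h.K_pos.le
      have : ((t ^ q : ℝ≥0) : ℝ) ≤ (((g n (k n t)) ^ q + (1 / 4) ^ n : ℝ≥0) : ℝ) := hge n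
      push_cast at this
      linarith
    filter_upwards [ae_tendsto_of_summable_norm_sub_sq hsum] with ω hω
    exact hω.limsup_eq

end IsGaussianMartingale

end DobricOjeda

namespace DobricOjeda

/-! ### Weighted integrals of a Gaussian martingale -/

/-- The integral `∫_0^t s^{p-1} m_s ds` in `L²`. -/
noncomputable def weightedIntegral {E : Type*} [NormedAddCommGroup E] [NormedSpace ℝ E]
    (m : ℝ≥0 → E) (p : ℝ) (t : ℝ≥0) : E :=
  ∫ s in (0 : ℝ)..t, s ^ (p - 1) • m s.toNNReal

/-- The martingale `t^p m_t - p ∫_0^t s^{p-1} m_s ds`, that is `∫_0^t s^p dm_s`. -/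
noncomputable def weightedMart {E : Type*} [NormedAddCommGroup E] [NormedSpace ℝ E]
    (m : ℝ≥0 → E) (p : ℝ) (t : ℝ≥0) : E :=
  (t : ℝ) ^ p • m t - p • weightedIntegral m p t

namespace IsGaussianMartingale

variable {Ω : Type*} [MeasurableSpace Ω] {μ : Measure Ω} {A : ℝ≥0 → Submodule ℝ (Lp ℝ 2 μ)}
  {m : ℝ≥0 → Lp ℝ 2 μ} {K q : ℝ}

theorem norm_eq (h : IsGaussianMartingale μ A m K q) (t : ℝ≥0) :
    ‖m t‖ = √K * (t : ℝ) ^ (q / 2) := by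
  rw [← Real.sqrt_sq (norm_nonneg (m t)), h.norm_sq, Real.sqrt_mul h.K_pos.le,
    Real.sqrt_eq_rpow ((t : ℝ) ^ q), ← Real.rpow_mul t.coe_nonneg]
  ring_nf

theorem continuous (h : IsGaussianMartingale μ A m K q) : Continuous m := by
  have key : ∀ s t : ℝ≥0, ‖m s - m t‖ = √(K * |(t : ℝ) ^ q - (s : ℝ) ^ q|) := by
    intro s t
    rw [← Real.sqrt_sq (norm_nonneg (m s - m t))]
    rcases le_total s t with hst | hst
    · rw [h.norm_sub_sq hst, abs_of_nonneg]
      exact sub_nonneg.2 (Real.rpow_le_rpow s.coe_nonneg hst h.q_pos.le)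
    · rw [norm_sub_rev, h.norm_sub_sq hst, abs_sub_comm, abs_of_nonneg]
      exact sub_nonneg.2 (Real.rpow_le_rpow t.coe_nonneg hst h.q_pos.le)
  refine continuous_iff_continuousAt.2 fun t => tendsto_iff_norm_sub_tendsto_zero.2 ?_
  simp only [key]
  have hc : Continuous fun s : ℝ≥0 => √(K * |(t : ℝ) ^ q - (s : ℝ) ^ q|) := by
    have : Continuous fun s : ℝ≥0 => (s : ℝ) ^ q :=
      (Real.continuous_rpow_const h.q_pos.le).comp NNReal.continuous_coe
    fun_prop
  simpa using hc.tendsto t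

theorem norm_weighted (h : IsGaussianMartingale μ A m K q) {p s : ℝ} (hs : 0 < s) :
    ‖s ^ (p - 1) • m s.toNNReal‖ = √K * s ^ (p + q / 2 - 1) := by
  rw [norm_smul, h.norm_eq, Real.coe_toNNReal _ hs.le, Real.norm_of_nonneg (by positivity),
    mul_left_comm, ← Real.rpow_add hs]
  ring_nf

/-- The integrand has norm √K s^{p+q/2-1}, so p + q/2 > 0 is what integrability at 0 requires. -/
theorem intervalIntegrable_weighted (h : IsGaussianMartingale μ A m K q) {p : ℝ}
    (hp : 0 < p + q / 2) {a b : ℝ} (ha : 0 ≤ a) (hb : 0 ≤ b) :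
    IntervalIntegrable (fun s : ℝ => s ^ (p - 1) • m s.toNNReal) volume a b := by
  have hi : IntervalIntegrable (fun s : ℝ => √K * s ^ (p + q / 2 - 1)) volume a b :=
    (intervalIntegral.intervalIntegrable_rpow' (by linarith)).const_mul _
  refine hi.mono_fun ?_ ?_
  · have h1 : Continuous fun s : ℝ => m s.toNNReal := h.continuous.comp continuous_real_toNNReal
    have h2 : Measurable fun s : ℝ => s ^ (p - 1) := by fun_prop
    exact (h2.aestronglyMeasurable.smul h1.aestronglyMeasurable)
  · refine (ae_restrict_mem measurableSet_uIoc).mono fun s hs => ?_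
    have hs0 : 0 < s := lt_of_le_of_lt (le_min ha hb) hs.1
    exact (h.norm_weighted hs0).trans_le (le_abs_self _)

theorem norm_weightedIntegral_sub_le (h : IsGaussianMartingale μ A m K q) {p : ℝ}
    (hp : 0 < p + q / 2) {s t : ℝ≥0} (hst : s ≤ t) :
    ‖weightedIntegral m p t - weightedIntegral m p s‖
      ≤ √K / (p + q / 2) * ((t : ℝ) ^ (p + q / 2) - (s : ℝ) ^ (p + q / 2)) := by
  have hst' : (s : ℝ) ≤ t := hst
  rw [weightedIntegral, weightedIntegral, intervalIntegral.integral_interval_sub_left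
    (h.intervalIntegrable_weighted hp le_rfl t.coe_nonneg)
    (h.intervalIntegrable_weighted hp le_rfl s.coe_nonneg)]
  have hi : IntervalIntegrable (fun s : ℝ => √K * s ^ (p + q / 2 - 1)) volume s t :=
    (intervalIntegral.intervalIntegrable_rpow' (by linarith)).const_mul _
  refine (intervalIntegral.norm_integral_le_of_norm_le hst' (Eventually.of_forall fun u hu => ?_)
    hi).trans_eq ?_
  · exact (h.norm_weighted (lt_of_le_of_lt s.coe_nonneg hu.1)).le
  · rw [intervalIntegral.integral_const_mul, integral_rpow (Or.inl (by linarith)), sub_add_cancel]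
    ring

theorem inner_weightedIntegral (h : IsGaussianMartingale μ A m K q) {p : ℝ}
    (hp : 0 < p + q / 2) (t : ℝ≥0) (y : Lp ℝ 2 μ) :
    inner ℝ y (weightedIntegral m p t)
      = ∫ s in (0 : ℝ)..t, s ^ (p - 1) * inner ℝ y (m s.toNNReal) := by
  have := (innerSL ℝ y).intervalIntegral_comp_comm
    (h.intervalIntegrable_weighted hp le_rfl t.coe_nonneg)
  rw [innerSL_apply_apply] at this
  rw [weightedIntegral, ← this]
  simp only [innerSL_apply_apply, inner_smul_right]

/-- A closed subspace is its own double orthogonal complement, and each integrand value up to time t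
is orthogonal to any y ⊥ `A t`. -/
theorem weightedIntegral_mem (h : IsGaussianMartingale μ A m K q) {p : ℝ}
    (hp : 0 < p + q / 2) (t : ℝ≥0) : weightedIntegral m p t ∈ A t := by
  have := (h.isClosed t).completeSpace_coe
  rw [← Submodule.orthogonal_orthogonal (A t), Submodule.mem_orthogonal]
  intro y hy
  rw [h.inner_weightedIntegral hp, intervalIntegral.integral_of_le t.coe_nonneg]
  refine (setIntegral_congr_fun measurableSet_Ioc fun s hs => ?_).trans (integral_zero ℝ ℝ)
  have hs' : m s.toNNReal ∈ A t := h.mono (Real.toNNReal_le_iff_le_coe.2 hs.2) (h.mem _)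
  rw [Submodule.inner_left_of_mem_orthogonal hs' hy, mul_zero]

theorem weightedMart_mem (h : IsGaussianMartingale μ A m K q) {p : ℝ}
    (hp : 0 < p + q / 2) (t : ℝ≥0) : weightedMart m p t ∈ A t :=
  (A t).sub_mem ((A t).smul_mem _ (h.mem t)) ((A t).smul_mem _ (h.weightedIntegral_mem hp t))

/-- Formally ∫_0^u s^p d(K s^q): what `m` does after time u is orthogonal to m u. In the integral,
⟨m u, m s⟩ is K s^q before u and constant after it, and the part after u cancels the boundary term
at t. -/
theorem inner_weightedMart_left (h : IsGaussianMartingale μ A m K q) {p : ℝ}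
    (hp : 0 < p + q / 2) {u t : ℝ≥0} (hut : u ≤ t) :
    inner ℝ (m u) (weightedMart m p t) = K * q / (p + q) * (u : ℝ) ^ (p + q) := by
  have hq := h.q_pos
  rcases eq_or_ne u 0 with rfl | hu
  · have : m 0 = 0 := by
      rw [← norm_eq_zero, h.norm_eq, NNReal.coe_zero, Real.zero_rpow (by linarith), mul_zero]
    rw [this, inner_zero_left, NNReal.coe_zero, Real.zero_rpow (by linarith), mul_zero]
  have hu0 : 0 < (u : ℝ) := NNReal.coe_pos.2 (pos_iff_ne_zero.2 hu)
  have hut' : (u : ℝ) ≤ t := hut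
  have hint : ∀ a b : ℝ≥0, IntervalIntegrable
      (fun s : ℝ => s ^ (p - 1) * inner ℝ (m u) (m s.toNNReal)) volume a b := fun a b => by
    have hi := h.intervalIntegrable_weighted hp a.coe_nonneg b.coe_nonneg
    have : IntervalIntegrable
        (fun s : ℝ => innerSL ℝ (m u) (s ^ (p - 1) • m s.toNNReal)) volume a b :=
      ⟨(innerSL ℝ (m u)).integrable_comp hi.1, (innerSL ℝ (m u)).integrable_comp hi.2⟩
    simpa only [innerSL_apply_apply, inner_smul_right] using this
  rw [weightedMart, inner_sub_right, inner_smul_right, inner_smul_right,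
    h.inner_weightedIntegral hp, h.inner_eq u t hut]
  have h0 := hint 0 u
  rw [NNReal.coe_zero] at h0
  rw [← intervalIntegral.integral_add_adjacent_intervals h0 (hint u t)]
  have e1 : ∫ s in (0 : ℝ)..u, s ^ (p - 1) * inner ℝ (m u) (m s.toNNReal)
      = K * (u : ℝ) ^ (p + q) / (p + q) := by
    have : ∫ s in (0 : ℝ)..u, s ^ (p - 1) * inner ℝ (m u) (m s.toNNReal)
        = ∫ s in (0 : ℝ)..u, K * s ^ (p + q - 1) := by
      rw [intervalIntegral.integral_of_le u.coe_nonneg,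
        intervalIntegral.integral_of_le u.coe_nonneg]
      refine setIntegral_congr_fun measurableSet_Ioc fun s hs => ?_
      rw [real_inner_comm, h.inner_eq _ _ (Real.toNNReal_le_iff_le_coe.2 hs.2),
        Real.coe_toNNReal _ hs.1.le, mul_left_comm, ← Real.rpow_add hs.1]
      ring_nf
    rw [this, intervalIntegral.integral_const_mul, integral_rpow (Or.inl (by linarith)),
      sub_add_cancel, Real.zero_rpow (by linarith)]
    ring
  have e2 : p * ∫ s in (u : ℝ)..t, s ^ (p - 1) * inner ℝ (m u) (m s.toNNReal)
      = K * (u : ℝ) ^ q * ((t : ℝ) ^ p - (u : ℝ) ^ p) := by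
    have : ∫ s in (u : ℝ)..t, s ^ (p - 1) * inner ℝ (m u) (m s.toNNReal)
        = ∫ s in (u : ℝ)..t, K * (u : ℝ) ^ q * s ^ (p - 1) := by
      rw [intervalIntegral.integral_of_le hut', intervalIntegral.integral_of_le hut']
      refine setIntegral_congr_fun measurableSet_Ioc fun s hs => ?_
      rw [h.inner_eq _ _ (NNReal.le_toNNReal_of_coe_le hs.1.le), mul_comm]
    rw [this, intervalIntegral.integral_const_mul]
    -- For p = 0 the antiderivative of s^{p-1} is not a power, but the prefactor p kills the term.
    rcases eq_or_ne p 0 with rfl | hp0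
    · simp
    · rw [integral_rpow (Or.inr ⟨by simpa using hp0, ?_⟩), sub_add_cancel]
      · field_simp
      · rw [Set.uIcc_of_le hut']
        exact fun h0 => absurd h0.1 (not_le.2 hu0)
  rw [mul_add, e1, e2, Real.rpow_add hu0]
  field_simp [(by linarith : p + q ≠ 0)]
  ring

theorem inner_weightedMart (h : IsGaussianMartingale μ A m K q) {p p' : ℝ}
    (hp : 0 < p + q / 2) (hp' : 0 < p' + q / 2) {s t : ℝ≥0} (hst : s ≤ t) :
    inner ℝ (weightedMart m p s) (weightedMart m p' t)
      = K * q / (p + p' + q) * (s : ℝ) ^ (p + p' + q) := by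
  have hq := h.q_pos
  have hpp : 0 < p + p' + q := by linarith
  have hpq : 0 < p' + q := by linarith
  rw [real_inner_comm]
  nth_rw 2 [weightedMart]
  rw [inner_sub_right, inner_smul_right, inner_smul_right, h.inner_weightedIntegral hp,
    real_inner_comm, h.inner_weightedMart_left hp' hst]
  have : ∫ u in (0 : ℝ)..s, u ^ (p - 1) * inner ℝ (weightedMart m p' t) (m u.toNNReal)
      = ∫ u in (0 : ℝ)..s, K * q / (p' + q) * u ^ (p + p' + q - 1) := by
    rw [intervalIntegral.integral_of_le s.coe_nonneg, intervalIntegral.integral_of_le s.coe_nonneg]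
    refine setIntegral_congr_fun measurableSet_Ioc fun u hu => ?_
    rw [real_inner_comm, h.inner_weightedMart_left hp'
      ((Real.toNNReal_le_iff_le_coe.2 hu.2).trans hst), Real.coe_toNNReal _ hu.1.le,
      mul_left_comm, ← Real.rpow_add hu.1]
    ring_nf
  rw [this, intervalIntegral.integral_const_mul, integral_rpow (Or.inl (by linarith)),
    sub_add_cancel, Real.zero_rpow hpp.ne', mul_left_comm,
    ← Real.rpow_add' s.coe_nonneg (by linarith), ← add_assoc]
  field_simp
  ring

/-! ### Pathwise integrals -/

variable {M : ℝ≥0 → Ω → ℝ}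

theorem integrable_weighted_prod [IsProbabilityMeasure μ] (h : IsGaussianMartingale μ A m K q)
    (hM : Measurable (Function.uncurry M)) (hMm : ∀ t, M t =ᵐ[μ] m t) {p : ℝ}
    (hp : 0 < p + q / 2) (t : ℝ≥0) :
    Integrable (fun x : ℝ × Ω => x.1 ^ (p - 1) * M x.1.toNNReal x.2)
      ((volume.restrict (Set.Ioc (0 : ℝ) t)).prod μ) := by
  have hmeas : Measurable fun x : ℝ × Ω => x.1 ^ (p - 1) * M x.1.toNNReal x.2 := by
    have h1 : Measurable fun x : ℝ × Ω => M x.1.toNNReal x.2 :=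
      hM.comp ((measurable_real_toNNReal.comp measurable_fst).prodMk measurable_snd)
    have h2 : Measurable fun x : ℝ × Ω => x.1 ^ (p - 1) := by fun_prop
    exact h2.mul h1
  have hMi : ∀ s, Integrable (M s) μ := fun s =>
    ((Lp.memLp (m s)).integrable one_le_two).congr (hMm s).symm
  refine (integrable_prod_iff hmeas.aestronglyMeasurable).2
    ⟨Eventually.of_forall fun s => (hMi s.toNNReal).const_mul (s ^ (p - 1)), ?_⟩
  have hi : Integrable (fun s : ℝ => √K * s ^ (p + q / 2 - 1))
      (volume.restrict (Set.Ioc (0 : ℝ) t)) := by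
    have := (intervalIntegral.intervalIntegrable_rpow' (a := 0) (b := t)
      (r := p + q / 2 - 1) (by linarith)).const_mul (√K)
    rwa [intervalIntegrable_iff_integrableOn_Ioc_of_le t.coe_nonneg] at this
  refine hi.mono' (hmeas.norm.aestronglyMeasurable.integral_prod_right') ?_
  refine (ae_restrict_mem measurableSet_Ioc).mono fun s hs => ?_
  rw [Real.norm_of_nonneg (integral_nonneg fun _ => norm_nonneg _)]
  simp only [norm_mul]
  rw [integral_const_mul]
  have hL1 : ∫ ω, ‖M s.toNNReal ω‖ ∂μ ≤ ‖m s.toNNReal‖ := by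
    rw [integral_congr_ae (g := fun ω => ‖m s.toNNReal ω‖)
      ((hMm s.toNNReal).mono fun ω hω => by rw [hω]), Lp.norm_def,
      integral_norm_eq_lintegral_enorm (Lp.aestronglyMeasurable _),
      ← eLpNorm_one_eq_lintegral_enorm]
    exact ENNReal.toReal_mono (Lp.eLpNorm_ne_top _)
      (eLpNorm_le_eLpNorm_of_exponent_le one_le_two (Lp.aestronglyMeasurable _))
  refine (mul_le_mul_of_nonneg_left hL1 (norm_nonneg _)).trans ?_
  rw [← norm_smul, h.norm_weighted hs.1]

theorem ae_intervalIntegrable_weighted [IsProbabilityMeasure μ]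
    (h : IsGaussianMartingale μ A m K q)
    (hM : Measurable (Function.uncurry M)) (hMm : ∀ t, M t =ᵐ[μ] m t) {p : ℝ}
    (hp : 0 < p + q / 2) (t : ℝ≥0) :
    ∀ᵐ ω ∂μ, IntervalIntegrable (fun s : ℝ => s ^ (p - 1) * M s.toNNReal ω) volume 0 t := by
  filter_upwards [(h.integrable_weighted_prod hM hMm hp t).prod_left_ae] with ω hω
  rwa [intervalIntegrable_iff_integrableOn_Ioc_of_le t.coe_nonneg]

/-- Pathwise and Hilbert-space integrals are compared by testing on measurable sets S: Fubini on one
side, the inner product with the indicator of S on the other. -/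
theorem integral_weighted_ae_eq [IsProbabilityMeasure μ] (h : IsGaussianMartingale μ A m K q)
    (hM : Measurable (Function.uncurry M)) (hMm : ∀ t, M t =ᵐ[μ] m t) {p : ℝ}
    (hp : 0 < p + q / 2) (t : ℝ≥0) :
    (fun ω => ∫ s in (0 : ℝ)..t, s ^ (p - 1) * M s.toNNReal ω) =ᵐ[μ]
      (weightedIntegral m p t : Lp ℝ 2 μ) := by
  have hF := h.integrable_weighted_prod hM hMm hp t
  simp only [intervalIntegral.integral_of_le t.coe_nonneg]
  refine Integrable.ae_eq_of_forall_setIntegral_eq _ _ hF.integral_prod_right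
    ((Lp.memLp _).integrable one_le_two) fun S hS _ => ?_
  have hF' : Integrable (fun x : Ω × ℝ => x.2 ^ (p - 1) * M x.2.toNNReal x.1)
      ((μ.restrict S).prod (volume.restrict (Set.Ioc (0 : ℝ) t))) := by
    have h1 : Integrable (fun x : Ω × ℝ => x.2 ^ (p - 1) * M x.2.toNNReal x.1)
      (μ.prod (volume.restrict (Set.Ioc (0 : ℝ) t))) := hF.swap
    refine h1.mono_measure ?_
    exact Measure.prod_mono Measure.restrict_le_self le_rfl
  rw [integral_integral_swap hF']
  have hμS : μ S ≠ ∞ := measure_ne_top μ S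
  have hY : S.indicator (fun _ => (1 : ℝ)) =ᵐ[μ] indicatorConstLp 2 hS hμS (1 : ℝ) :=
    indicatorConstLp_coeFn.symm
  have key : ∀ f : Lp ℝ 2 μ, ∀ X : Ω → ℝ, X =ᵐ[μ] f →
      inner ℝ (indicatorConstLp 2 hS hμS (1 : ℝ)) f = ∫ ω in S, X ω ∂μ := fun f X hX => by
    rw [inner_L2_eq hY hX, ← integral_indicator hS]
    refine integral_congr_ae (Eventually.of_forall fun ω => ?_)
    by_cases hω : ω ∈ S <;> simp [hω]
  rw [← key _ _ EventuallyEq.rfl, h.inner_weightedIntegral hp,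
    intervalIntegral.integral_of_le t.coe_nonneg]
  refine integral_congr_ae (Eventually.of_forall fun s => ?_)
  dsimp only
  rw [integral_const_mul, key _ _ (hMm _)]

end IsGaussianMartingale

end DobricOjeda

namespace DobricOjeda

/-! ### Wiener integrals -/

theorem eLpNorm_two_eq {α : Type*} [MeasurableSpace α] {ν : Measure α} {g : α → ℝ}
    (hg : MemLp g 2 ν) : eLpNorm g 2 ν = ENNReal.ofReal √(∫ x, g x ^ 2 ∂ν) := by
  have h1 := norm_sq_L2_eq (hg.coeFn_toLp).symm
  rw [← h1, Real.sqrt_sq (norm_nonneg _), Lp.norm_toLp, ENNReal.ofReal_toReal hg.eLpNorm_ne_top]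

theorem eLpNorm_two_eq_norm {α : Type*} [MeasurableSpace α] {ν : Measure α} {g : α → ℝ}
    {f : Lp ℝ 2 ν} (hg : g =ᵐ[ν] f) : eLpNorm g 2 ν = ENNReal.ofReal ‖f‖ := by
  rw [eLpNorm_congr_ae hg, Lp.norm_def, ENNReal.ofReal_toReal (Lp.eLpNorm_ne_top f)]

theorem TimePartition.memLp_step {t : ℝ≥0} (P : TimePartition t) (c : ℕ → ℝ) :
    MemLp (P.step c) 2 (volume.restrict (Set.Ioc (0 : ℝ) t)) := by
  unfold TimePartition.step
  exact memLp_finsetSum _ fun i _ => (memLp_const (c i)).indicator measurableSet_Ioc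

/-! ### Orthogonal increments and the Itô isometry -/

theorem inner_sub_sub_eq_zero {E : Type*} [NormedAddCommGroup E] [InnerProductSpace ℝ E]
    {w : ℝ≥0 → E} {v : ℝ≥0 → ℝ} (hw : ∀ s t, s ≤ t → inner ℝ (w s) (w t) = v s)
    {a b c d : ℝ≥0} (hab : a ≤ b) (hbc : b ≤ c) (hcd : c ≤ d) :
    inner ℝ (w b - w a) (w d - w c) = 0 := by
  rw [inner_sub_left, inner_sub_right, inner_sub_right, hw b d (hbc.trans hcd), hw b c hbc,
    hw a d (hab.trans (hbc.trans hcd)), hw a c (hab.trans hbc)]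
  ring

theorem norm_sub_sq_eq {E : Type*} [NormedAddCommGroup E] [InnerProductSpace ℝ E]
    {w : ℝ≥0 → E} {v : ℝ≥0 → ℝ} (hw : ∀ s t, s ≤ t → inner ℝ (w s) (w t) = v s)
    {a b : ℝ≥0} (hab : a ≤ b) : ‖w b - w a‖ ^ 2 = v b - v a := by
  rw [norm_sub_rev, norm_sub_sq_real, ← real_inner_self_eq_norm_sq, ← real_inner_self_eq_norm_sq,
    hw a a le_rfl, hw b b le_rfl, hw a b hab]
  ring

/-- An isometry for a prescribed candidate J: expanding the square uses only ⟨J, w s⟩ = ∫_0^s f,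
‖J‖² = ∫ f² and the orthogonality of the increments of w. -/
theorem norm_sq_sub_stepSum {E : Type*} [NormedAddCommGroup E] [InnerProductSpace ℝ E]
    {w : ℝ≥0 → E} (hw : ∀ s t, s ≤ t → inner ℝ (w s) (w t) = (s : ℝ)) {J : E} {f : ℝ → ℝ}
    {t : ℝ≥0} (hf : MemLp f 2 (volume.restrict (Set.Ioc (0 : ℝ) t)))
    (hJw : ∀ s ≤ t, inner ℝ J (w s) = ∫ u in (0 : ℝ)..s, f u)
    (hJJ : ‖J‖ ^ 2 = ∫ u in Set.Ioc (0 : ℝ) t, f u ^ 2) (P : TimePartition t) (c : ℕ → ℝ) :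
    ‖J - ∑ i ∈ Finset.range P.n, c i • (w (P.node (i + 1)) - w (P.node i))‖ ^ 2
      = ∫ s in Set.Ioc (0 : ℝ) t, (f s - P.step c s) ^ 2 := by
  have hstep := P.memLp_step c
  have hfi : IntegrableOn f (Set.Ioc (0 : ℝ) t) := hf.integrable one_le_two
  have hii : ∀ s ≤ t, IntervalIntegrable f volume 0 s := fun s hs =>
    (intervalIntegrable_iff_integrableOn_Ioc_of_le s.coe_nonneg).2
      (hfi.mono_set (Set.Ioc_subset_Ioc_right (NNReal.coe_le_coe.2 hs)))
  have e1 : inner ℝ J (∑ i ∈ Finset.range P.n, c i • (w (P.node (i + 1)) - w (P.node i)))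
      = ∫ s in Set.Ioc (0 : ℝ) t, P.step c s * f s := by
    rw [P.integral_step_mul c hfi, inner_sum]
    refine Finset.sum_congr rfl fun i hi => ?_
    have h1 := P.node_le (Finset.mem_range.1 hi).le
    have h2 := P.node_le (Nat.succ_le_of_lt (Finset.mem_range.1 hi))
    rw [inner_smul_right, inner_sub_right, hJw _ h2, hJw _ h1,
      intervalIntegral.integral_interval_sub_left (hii _ h2) (hii _ h1)]
  have e2 : ‖∑ i ∈ Finset.range P.n, c i • (w (P.node (i + 1)) - w (P.node i))‖ ^ 2
      = ∫ s in Set.Ioc (0 : ℝ) t, P.step c s * P.step c s := by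
    rw [P.integral_step_mul c (hstep.integrable one_le_two), ← real_inner_self_eq_norm_sq,
      sum_inner]
    refine Finset.sum_congr rfl fun i hi => ?_
    rw [inner_sum, Finset.sum_eq_single i]
    · rw [inner_smul_right, inner_smul_left, real_inner_self_eq_norm_sq,
        norm_sub_sq_eq hw (P.mono i.le_succ), RCLike.conj_to_real,
        intervalIntegral.integral_of_le (NNReal.coe_le_coe.2 (P.mono i.le_succ)),
        setIntegral_congr_fun measurableSet_Ioc
          fun s hs => P.step_apply c (Finset.mem_range.1 hi) hs,
        ← intervalIntegral.integral_of_le (NNReal.coe_le_coe.2 (P.mono i.le_succ)),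
        intervalIntegral.integral_const, smul_eq_mul]
      ring
    · intro j _ hj
      rw [inner_smul_right, inner_smul_left]
      rcases lt_or_gt_of_ne hj with h | h
      · rw [real_inner_comm, inner_sub_sub_eq_zero hw (P.mono j.le_succ) (P.mono h)
          (P.mono i.le_succ), mul_zero, mul_zero]
      · rw [inner_sub_sub_eq_zero hw (P.mono i.le_succ) (P.mono h) (P.mono j.le_succ), mul_zero,
          mul_zero]
    · exact fun h => absurd hi h
  have i1 : Integrable (fun s => f s ^ 2) (volume.restrict (Set.Ioc (0 : ℝ) t)) := hf.integrable_sq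
  have i2 : Integrable (fun s => P.step c s * f s) (volume.restrict (Set.Ioc (0 : ℝ) t)) :=
    hstep.integrable_mul hf
  have i3 : Integrable (fun s => P.step c s * P.step c s)
    (volume.restrict (Set.Ioc (0 : ℝ) t)) := hstep.integrable_mul hstep
  have e3 : ∀ s, (f s - P.step c s) ^ 2
      = f s ^ 2 - 2 * (P.step c s * f s) + P.step c s * P.step c s := fun s => by ring
  have i4 : Integrable (fun s => f s ^ 2 - 2 * (P.step c s * f s))
    (volume.restrict (Set.Ioc (0 : ℝ) t)) := i1.sub (i2.const_mul 2)
  simp only [e3]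
  rw [integral_add i4 i3, integral_sub i1 (i2.const_mul 2),
    integral_const_mul, norm_sub_sq_real, e1, e2, hJJ]

theorem stepIntegral_ae_eq {Ω : Type*} [MeasurableSpace Ω] {μ : Measure Ω} {W : ℝ≥0 → Ω → ℝ}
    {w : ℝ≥0 → Lp ℝ 2 μ} (hW : ∀ s, W s =ᵐ[μ] w s) {t : ℝ≥0} (P : TimePartition t)
    (c : ℕ → ℝ) : P.stepIntegral c W =ᵐ[μ]
      (∑ i ∈ Finset.range P.n, c i • (w (P.node (i + 1)) - w (P.node i)) : Lp ℝ 2 μ) := by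
  have h1 : ∀ᵐ ω ∂μ, ∀ i, W (P.node i) ω = w (P.node i) ω := ae_all_iff.2 fun i => hW _
  have h2 : ∀ᵐ ω ∂μ, ∀ i, (c i • (w (P.node (i + 1)) - w (P.node i)) : Lp ℝ 2 μ) ω
      = c i • (w (P.node (i + 1)) - w (P.node i) : Lp ℝ 2 μ) ω :=
    ae_all_iff.2 fun i => Lp.coeFn_smul _ _
  have h3 : ∀ᵐ ω ∂μ, ∀ i, (w (P.node (i + 1)) - w (P.node i) : Lp ℝ 2 μ) ω
      = w (P.node (i + 1)) ω - w (P.node i) ω := ae_all_iff.2 fun i => Lp.coeFn_sub _ _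
  have h4 := Lp.coeFn_finsetSum (Finset.range P.n)
    fun i => c i • (w (P.node (i + 1)) - w (P.node i))
  filter_upwards [h1, h2, h3, h4] with ω e1 e2 e3 e4
  rw [e4, Finset.sum_apply, TimePartition.stepIntegral]
  exact Finset.sum_congr rfl fun i _ => by rw [e2, e3, e1, e1, smul_eq_mul]

/-- By the isometry J is approximated by the step integrals of any sequence of steps tending to f.
This makes J an admissible value, and it forces the chosen value, along its own sequence, to agree
with J almost surely. -/
theorem wienerIntegral_ae_eq {Ω : Type*} [MeasurableSpace Ω] {μ : Measure Ω} {W : ℝ≥0 → Ω → ℝ}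
    {w : ℝ≥0 → Lp ℝ 2 μ} (hW : ∀ s, W s =ᵐ[μ] w s)
    (hw : ∀ s t, s ≤ t → inner ℝ (w s) (w t) = (s : ℝ)) {J : Lp ℝ 2 μ} {f : ℝ → ℝ}
    {t : ℝ≥0} (hf : MemLp f 2 (volume.restrict (Set.Ioc (0 : ℝ) t)))
    (hJw : ∀ s ≤ t, inner ℝ J (w s) = ∫ u in (0 : ℝ)..s, f u)
    (hJJ : ‖J‖ ^ 2 = ∫ u in Set.Ioc (0 : ℝ) t, f u ^ 2)
    (hex : ∃ (P : ℕ → TimePartition t) (c : ℕ → ℕ → ℝ),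
      Tendsto (fun k => eLpNorm (fun s => f s - (P k).step (c k) s) 2
        (volume.restrict (Set.Ioc (0 : ℝ) t))) atTop (𝓝 0)) :
    wienerIntegral μ W f t =ᵐ[μ] J := by
  have key : ∀ (P : TimePartition t) (c : ℕ → ℝ),
      eLpNorm (fun ω => J ω - P.stepIntegral c W ω) 2 μ
        = eLpNorm (fun s => f s - P.step c s) 2 (volume.restrict (Set.Ioc (0 : ℝ) t)) := by
    intro P c
    have hae : (fun ω => J ω - P.stepIntegral c W ω) =ᵐ[μ]
        (J - ∑ i ∈ Finset.range P.n, c i • (w (P.node (i + 1)) - w (P.node i)) : Lp ℝ 2 μ) := by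
      filter_upwards [stepIntegral_ae_eq hW P c, Lp.coeFn_sub J
        (∑ i ∈ Finset.range P.n, c i • (w (P.node (i + 1)) - w (P.node i)))] with ω h1 h2
      rw [h1, h2, Pi.sub_apply]
    change _ = eLpNorm (f - P.step c) 2 _
    rw [eLpNorm_two_eq_norm hae, eLpNorm_two_eq (hf.sub (P.memLp_step c)),
      ← Real.sqrt_sq (norm_nonneg _), norm_sq_sub_stepSum hw hf hJw hJJ]
    rfl
  have hexI : ∃ I, IsWienerIntegral μ W f t I := by
    obtain ⟨P, c, h⟩ := hex
    exact ⟨J, Lp.aestronglyMeasurable J, P, c, h, by simpa only [key] using h⟩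
  rw [wienerIntegral, dif_pos hexI]
  obtain ⟨hm, P, c, h1, h2⟩ := hexI.choose_spec
  set I := hexI.choose
  have h3 : Tendsto (fun k => eLpNorm (fun ω => J ω - (P k).stepIntegral (c k) W ω) 2 μ)
      atTop (𝓝 0) := by simpa only [key] using h1
  have hS : ∀ k, AEStronglyMeasurable ((P k).stepIntegral (c k) W) μ := fun k =>
    (Lp.aestronglyMeasurable _).congr (stepIntegral_ae_eq hW (P k) (c k)).symm
  have hle : ∀ k, eLpNorm (fun ω => I ω - J ω) 2 μ
      ≤ eLpNorm (fun ω => I ω - (P k).stepIntegral (c k) W ω) 2 μ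
        + eLpNorm (fun ω => J ω - (P k).stepIntegral (c k) W ω) 2 μ := fun k => by
    have := eLpNorm_sub_le (hm.sub (hS k)) ((Lp.aestronglyMeasurable J).sub (hS k)) one_le_two
    refine (eLpNorm_congr_ae (Eventually.of_forall fun ω => ?_)).trans_le this
    simp
  have h0 : eLpNorm (fun ω => I ω - J ω) 2 μ = 0 := by
    refine le_antisymm (ge_of_tendsto' (by simpa using h2.add h3) hle) (by positivity)
  have h5 := (eLpNorm_eq_zero_iff (hm.sub (Lp.aestronglyMeasurable J)) two_ne_zero).1 h0
  filter_upwards [h5] with ω hω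
  exact sub_eq_zero.1 hω

theorem memLp_rpow {p : ℝ} (hp : -1 < 2 * p) (t : ℝ≥0) :
    MemLp (fun s : ℝ => s ^ p) 2 (volume.restrict (Set.Ioc (0 : ℝ) t)) := by
  have hm : Measurable fun s : ℝ => s ^ p := by fun_prop
  refine (memLp_two_iff_integrable_sq hm.aestronglyMeasurable).2 ?_
  have hi : IntegrableOn (fun s : ℝ => s ^ (2 * p)) (Set.Ioc (0 : ℝ) t) :=
    (intervalIntegrable_iff_integrableOn_Ioc_of_le t.coe_nonneg).1
      (intervalIntegral.intervalIntegrable_rpow' hp)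
  refine hi.congr ((ae_restrict_mem measurableSet_Ioc).mono fun s hs => ?_)
  simp only
  rw [mul_comm, Real.rpow_mul hs.1.le, Real.rpow_two]

theorem exists_step_tendsto_rpow {p : ℝ} (hp : -1 < 2 * p) (t : ℝ≥0) :
    ∃ (P : ℕ → TimePartition t) (c : ℕ → ℕ → ℝ),
      Tendsto (fun k => eLpNorm (fun s : ℝ => s ^ p - (P k).step (c k) s) 2
        (volume.restrict (Set.Ioc (0 : ℝ) t))) atTop (𝓝 0) := by
  refine ⟨uniformPartition t, fun n i => minPow p ((uniformPartition t n).node i)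
      ((uniformPartition t n).node (i + 1)), ?_⟩
  have hf := memLp_rpow hp t
  have h1 : Tendsto (fun n => ∫ s in Set.Ioc (0 : ℝ) t, (s ^ p - (uniformPartition t n).step
      (fun i => minPow p ((uniformPartition t n).node i)
        ((uniformPartition t n).node (i + 1))) s) ^ 2) atTop (𝓝 (∫ s in Set.Ioc (0 : ℝ) t, 0)) := by
    refine tendsto_integral_of_dominated_convergence (fun s => (s ^ p) ^ 2) (fun n => ?_)
      hf.integrable_sq (fun n => ?_) ?_
    · exact ((hf.sub ((uniformPartition t n).memLp_step _)).aestronglyMeasurable.pow 2)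
    · refine (ae_restrict_mem measurableSet_Ioc).mono fun s hs => ?_
      obtain ⟨i, hi, his⟩ := (uniformPartition t n).exists_cell hs
      rw [TimePartition.step_apply _ _ hi his, Real.norm_of_nonneg (sq_nonneg _)]
      have h2 := minPow_nonneg (p := p) ((uniformPartition t n).node i).coe_nonneg
        ((uniformPartition t n).node (i + 1)).coe_nonneg
      have h3 := minPow_le (p := p) ((uniformPartition t n).node i).coe_nonneg hs.1 his.1.le his.2
      exact pow_le_pow_left₀ (by linarith) (by linarith) 2
    · refine (ae_restrict_mem measurableSet_Ioc).mono fun s hs => ?_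
      have := (uniformPartition_step_tendsto hs (tendsto_minPow (p := p) hs.1)).const_sub (s ^ p)
      simpa using this.pow 2
  rw [integral_zero] at h1
  have h2 := ENNReal.tendsto_ofReal h1.sqrt
  rw [Real.sqrt_zero, ENNReal.ofReal_zero] at h2
  refine h2.congr fun n => (eLpNorm_two_eq (hf.sub ((uniformPartition t n).memLp_step _))).symm

end DobricOjeda

namespace DobricOjeda

/-! ### Quadratic variation of Gaussian processes -/

namespace IsGaussianSpace

variable {Ω : Type*} [MeasurableSpace Ω] {μ : Measure Ω} {Γ : Submodule ℝ (Lp ℝ 2 μ)}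

theorem memLp_sq (hΓ : IsGaussianSpace μ Γ) {y : Lp ℝ 2 μ} (hy : y ∈ Γ) :
    MemLp (fun ω => y ω ^ 2) 2 μ := by
  refine (memLp_two_iff_integrable_sq ((Lp.aestronglyMeasurable y).pow 2)).2 ?_
  have h4 : MemLp y ((4 : ℕ) : ℝ≥0∞) μ := hΓ.memLp hy (by simp)
  refine (h4.integrable_norm_pow (by norm_num)).congr (Eventually.of_forall fun ω => ?_)
  simp only [Real.norm_eq_abs, Pi.pow_apply]
  rw [← pow_mul, Even.pow_abs (by decide)]

/-- Cauchy–Schwarz for y² and z² bounds E[y²z²] by fourth moments, which are multiples of fourth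
powers of norms in a Gaussian space. -/
theorem eLpNorm_mul_le (hΓ : IsGaussianSpace μ Γ) {y z : Lp ℝ 2 μ} (hy : y ∈ Γ) (hz : z ∈ Γ) :
    eLpNorm (fun ω => y ω * z ω) 2 μ ≤ ENNReal.ofReal (√gaussFour * (‖y‖ * ‖z‖)) := by
  have hsq : ∀ x ∈ Γ, ∀ hx : MemLp (fun ω => (x : Lp ℝ 2 μ) ω ^ 2) 2 μ,
      ‖hx.toLp‖ ^ 2 = gaussFour * ‖x‖ ^ 4 := fun x hxΓ hx => by
    rw [norm_sq_L2_eq hx.coeFn_toLp.symm, ← hΓ.integral_pow_four hxΓ]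
    refine integral_congr_ae (Eventually.of_forall fun ω => ?_)
    simp only
    ring
  have hy2 := hΓ.memLp_sq hy
  have hz2 := hΓ.memLp_sq hz
  have hint : ∫ ω, (y ω * z ω) ^ 2 ∂μ ≤ (√gaussFour * (‖y‖ * ‖z‖)) ^ 2 := by
    have h1 := inner_L2_eq hy2.coeFn_toLp.symm hz2.coeFn_toLp.symm
    have h2 := real_inner_le_norm hy2.toLp hz2.toLp
    have h3 : ‖hy2.toLp‖ * ‖hz2.toLp‖ = (√gaussFour * (‖y‖ * ‖z‖)) ^ 2 := by
      rw [← pow_left_inj₀ (by positivity) (by positivity) two_ne_zero, mul_pow, hsq y hy, hsq z hz,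
        mul_pow √gaussFour, Real.sq_sqrt gaussFour_nonneg]
      ring
    rw [h1, h3] at h2
    simpa only [mul_pow] using h2
  have hm : MemLp (fun ω => y ω * z ω) 2 μ := by
    refine (memLp_two_iff_integrable_sq
      ((Lp.aestronglyMeasurable y).mul (Lp.aestronglyMeasurable z))).2 ?_
    simp only [Pi.mul_apply, mul_pow]
    exact hy2.integrable_mul hz2
  rw [eLpNorm_two_eq hm]
  exact ENNReal.ofReal_le_ofReal (Real.sqrt_le_left (by positivity) |>.2 hint)

/-- Orthogonal Gaussian increments are independent, so variances of squares add; each is at most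
`gaussFour`·‖y_i‖⁴ ≤ `gaussFour`·ρ²‖y_i‖². -/
theorem eLpNorm_sum_sq_sub_le [IsProbabilityMeasure μ] (hΓ : IsGaussianSpace μ Γ)
    {y : ℕ → Lp ℝ 2 μ} (hy : ∀ i, y i ∈ Γ) {n : ℕ}
    (horth : ∀ i j, i < j → inner ℝ (y i) (y j) = 0) {ρ V : ℝ} (hρ : ∀ i < n, ‖y i‖ ≤ ρ)
    (hV : ∑ i ∈ Finset.range n, ‖y i‖ ^ 2 = V) :
    eLpNorm (fun ω => ∑ i ∈ Finset.range n, y i ω ^ 2 - V) 2 μ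
      ≤ ENNReal.ofReal (√gaussFour * (|ρ| * √V)) := by
  have hm : MemLp (∑ i ∈ Finset.range n, fun ω => y i ω ^ 2) 2 μ :=
    memLp_finsetSum' _ fun i _ => hΓ.memLp_sq (hy i)
  have hmean : ∫ ω, (∑ i ∈ Finset.range n, fun ω => y i ω ^ 2) ω ∂μ = V := by
    simp only [Finset.sum_apply]
    rw [integral_finsetSum _ fun i _ => (Lp.memLp (y i)).integrable_sq, ← hV]
    exact Finset.sum_congr rfl fun i _ => (norm_sq_L2_eq EventuallyEq.rfl).symm
  have hvar : ∫ ω, (∑ i ∈ Finset.range n, y i ω ^ 2 - V) ^ 2 ∂μ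
      = ∑ i ∈ Finset.range n, Var[fun ω => y i ω ^ 2; μ] := by
    rw [← IndepFun.variance_sum (fun i _ => hΓ.memLp_sq (hy i)) fun i _ j _ hij => ?_,
      variance_eq_integral hm.aestronglyMeasurable.aemeasurable, hmean]
    · simp only [Finset.sum_apply]
    · have : inner ℝ (y i) (y j) = 0 := by
        rcases lt_or_gt_of_ne hij with h | h
        · exact horth i j h
        · rw [real_inner_comm]
          exact horth j i h
      exact (hΓ.indepFun (hy i) (hy j) this).comp (measurable_id.pow_const 2)
        (measurable_id.pow_const 2)
  have hle : ∫ ω, (∑ i ∈ Finset.range n, y i ω ^ 2 - V) ^ 2 ∂μ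
      ≤ (√gaussFour * (|ρ| * √V)) ^ 2 := by
    have hV0 : 0 ≤ V := hV ▸ Finset.sum_nonneg fun i _ => sq_nonneg _
    rw [hvar, mul_pow, mul_pow, Real.sq_sqrt gaussFour_nonneg, Real.sq_sqrt hV0, ← hV,
      Finset.mul_sum, Finset.mul_sum]
    refine Finset.sum_le_sum fun i hi => ?_
    refine (variance_le_expectation_sq (hΓ.memLp_sq (hy i)).aestronglyMeasurable).trans ?_
    have h4 : ∫ ω, ((fun ω => y i ω ^ 2) ^ 2) ω ∂μ = gaussFour * ‖y i‖ ^ 4 := by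
      rw [← hΓ.integral_pow_four (hy i)]
      refine integral_congr_ae (Eventually.of_forall fun ω => ?_)
      simp only [Pi.pow_apply]
      ring
    have hi' := hρ i (Finset.mem_range.1 hi)
    have h5 : ‖y i‖ ^ 2 ≤ |ρ| ^ 2 :=
      pow_le_pow_left₀ (norm_nonneg _) (hi'.trans (le_abs_self ρ)) 2
    rw [h4, show ‖y i‖ ^ 4 = ‖y i‖ ^ 2 * ‖y i‖ ^ 2 by ring]
    exact mul_le_mul_of_nonneg_left (mul_le_mul_of_nonneg_right h5 (sq_nonneg _)) gaussFour_nonneg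
  have hm' : MemLp (fun ω => ∑ i ∈ Finset.range n, y i ω ^ 2 - V) 2 μ :=
    (memLp_finsetSum _ fun i _ => hΓ.memLp_sq (hy i)).sub (memLp_const V)
  rw [eLpNorm_two_eq hm']
  exact ENNReal.ofReal_le_ofReal (Real.sqrt_le_left (by positivity) |>.2 hle)

end IsGaussianSpace

/-- With y and e the increments of x and d, (y+e)² = y² + e(y + (y+e)). The squares y² concentrate
at v t. The correction is bounded by ‖e‖·3ρ, and the norms ‖e‖ are summed through the telescoping
increments of φ. -/
theorem eLpNorm_sumSq_sub_le {Ω : Type*} [MeasurableSpace Ω] {μ : Measure Ω}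
    [IsProbabilityMeasure μ] {Γ : Submodule ℝ (Lp ℝ 2 μ)} (hΓ : IsGaussianSpace μ Γ)
    {x d : ℝ≥0 → Lp ℝ 2 μ} (hx : ∀ t, x t ∈ Γ) (hd : ∀ t, d t ∈ Γ) {v φ : ℝ≥0 → ℝ}
    (hxx : ∀ s t, s ≤ t → inner ℝ (x s) (x t) = v s) (hv0 : v 0 = 0)
    (hdd : ∀ s t, s ≤ t → ‖d t - d s‖ ≤ φ t - φ s) {X : ℝ≥0 → Ω → ℝ}
    (hX : ∀ t, X t =ᵐ[μ] (x t + d t : Lp ℝ 2 μ)) {t : ℝ≥0} (P : TimePartition t) {ρ : ℝ}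
    (hρ0 : 0 ≤ ρ) (hvρ : ∀ i < P.n, v (P.node (i + 1)) - v (P.node i) ≤ ρ ^ 2)
    (hφρ : ∀ i < P.n, φ (P.node (i + 1)) - φ (P.node i) ≤ ρ) :
    eLpNorm (fun ω => P.sumSq X ω - v t) 2 μ
      ≤ ENNReal.ofReal (√gaussFour * (√(v t) + 3 * (φ t - φ 0)) * ρ) := by
  set y : ℕ → Lp ℝ 2 μ := fun i => x (P.node (i + 1)) - x (P.node i) with hy
  set e : ℕ → Lp ℝ 2 μ := fun i => d (P.node (i + 1)) - d (P.node i) with he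
  have hyΓ : ∀ i, y i ∈ Γ := fun i => Γ.sub_mem (hx _) (hx _)
  have heΓ : ∀ i, e i ∈ Γ := fun i => Γ.sub_mem (hd _) (hd _)
  have hφ : ∀ i, ‖e i‖ ≤ φ (P.node (i + 1)) - φ (P.node i) := fun i =>
    hdd _ _ (P.mono i.le_succ)
  have hysq : ∀ i, ‖y i‖ ^ 2 = v (P.node (i + 1)) - v (P.node i) := fun i =>
    norm_sub_sq_eq hxx (P.mono i.le_succ)
  have hyρ : ∀ i < P.n, ‖y i‖ ≤ ρ := fun i hi =>
    (pow_le_pow_iff_left₀ (norm_nonneg _) hρ0 two_ne_zero).1 ((hysq i).trans_le (hvρ i hi))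
  have hsum : ∑ i ∈ Finset.range P.n, ‖y i‖ ^ 2 = v t := by
    simp only [hysq]
    rw [Finset.sum_range_sub (fun i => v (P.node i)), P.node_last, P.node_zero, hv0, sub_zero]
  have h1 := hΓ.eLpNorm_sum_sq_sub_le hyΓ
    (fun i j hij => inner_sub_sub_eq_zero hxx (P.mono i.le_succ) (P.mono hij) (P.mono j.le_succ))
    hyρ hsum
  have hterm : ∀ i ∈ Finset.range P.n,
      eLpNorm (fun ω => e i ω * (y i + (y i + e i) : Lp ℝ 2 μ) ω) 2 μ
        ≤ ENNReal.ofReal (√gaussFour * (3 * ρ) * (φ (P.node (i + 1)) - φ (P.node i))) := by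
    intro i hi
    refine (hΓ.eLpNorm_mul_le (heΓ i) (Γ.add_mem (hyΓ i) (Γ.add_mem (hyΓ i) (heΓ i)))).trans
      (ENNReal.ofReal_le_ofReal ?_)
    have hi' := Finset.mem_range.1 hi
    have hn : ‖y i + (y i + e i)‖ ≤ 3 * ρ := by
      have := norm_add_le (y i) (y i + e i)
      have := norm_add_le (y i) (e i)
      linarith [hyρ i hi', hφ i, hφρ i hi']
    have := mul_le_mul (hφ i) hn (norm_nonneg _) ((norm_nonneg _).trans (hφ i))
    calc √gaussFour * (‖e i‖ * ‖y i + (y i + e i)‖)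
        ≤ √gaussFour * ((φ (P.node (i + 1)) - φ (P.node i)) * (3 * ρ)) :=
          mul_le_mul_of_nonneg_left this (Real.sqrt_nonneg _)
      _ = _ := by ring
  have hmeas : ∀ i, AEStronglyMeasurable
      (fun ω => e i ω * (y i + (y i + e i) : Lp ℝ 2 μ) ω) μ := fun i =>
    (Lp.aestronglyMeasurable _).mul (Lp.aestronglyMeasurable _)
  have h2 : eLpNorm (∑ i ∈ Finset.range P.n,
      fun ω => e i ω * (y i + (y i + e i) : Lp ℝ 2 μ) ω) 2 μ
        ≤ ENNReal.ofReal (√gaussFour * (3 * ρ) * (φ t - φ 0)) := by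
    refine (eLpNorm_sum_le (fun i _ => hmeas i) one_le_two).trans
      ((Finset.sum_le_sum hterm).trans_eq ?_)
    rw [← ENNReal.ofReal_sum_of_nonneg, ← Finset.mul_sum,
      Finset.sum_range_sub (fun i => φ (P.node i)), P.node_last, P.node_zero]
    exact fun i _ => mul_nonneg (by positivity) ((norm_nonneg _).trans (hφ i))
  have hae : (fun ω => P.sumSq X ω - v t) =ᵐ[μ]
      (fun ω => ∑ i ∈ Finset.range P.n, y i ω ^ 2 - v t) + ∑ i ∈ Finset.range P.n,
        fun ω => e i ω * (y i + (y i + e i) : Lp ℝ 2 μ) ω := by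
    have a1 : ∀ᵐ ω ∂μ, ∀ i, X (P.node i) ω = x (P.node i) ω + d (P.node i) ω :=
      ae_all_iff.2 fun i => by
        filter_upwards [hX (P.node i), Lp.coeFn_add (x (P.node i)) (d (P.node i))] with ω u1 u2
        rw [u1, u2, Pi.add_apply]
    have a2 : ∀ᵐ ω ∂μ, ∀ i, y i ω = x (P.node (i + 1)) ω - x (P.node i) ω :=
      ae_all_iff.2 fun i => Lp.coeFn_sub _ _
    have a3 : ∀ᵐ ω ∂μ, ∀ i, e i ω = d (P.node (i + 1)) ω - d (P.node i) ω :=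
      ae_all_iff.2 fun i => Lp.coeFn_sub _ _
    have a4 : ∀ᵐ ω ∂μ, ∀ i, (y i + (y i + e i) : Lp ℝ 2 μ) ω = y i ω + (y i ω + e i ω) :=
      ae_all_iff.2 fun i => by
        filter_upwards [Lp.coeFn_add (y i) (y i + e i), Lp.coeFn_add (y i) (e i)] with ω u1 u2
        rw [u1, Pi.add_apply, u2, Pi.add_apply]
    filter_upwards [a1, a2, a3, a4] with ω b1 b2 b3 b4
    rw [Pi.add_apply, Finset.sum_apply, TimePartition.sumSq, sub_add_eq_add_sub,
      ← Finset.sum_add_distrib]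
    congr 1
    refine Finset.sum_congr rfl fun i _ => ?_
    rw [b4, b2, b3, b1, b1]
    ring
  have hm1 : AEStronglyMeasurable (fun ω => ∑ i ∈ Finset.range P.n, y i ω ^ 2 - v t) μ :=
    (Finset.aestronglyMeasurable_fun_sum _ fun i _ => (Lp.aestronglyMeasurable (y i)).pow 2).sub
      aestronglyMeasurable_const
  rw [eLpNorm_congr_ae hae]
  refine (eLpNorm_add_le hm1 (Finset.aestronglyMeasurable_sum _ fun i _ => hmeas i)
    one_le_two).trans ((add_le_add h1 h2).trans_eq ?_)
  have hφt : 0 ≤ φ t - φ 0 := (norm_nonneg _).trans (hdd 0 t (zero_le))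
  rw [← ENNReal.ofReal_add (by positivity) (by positivity), abs_of_nonneg hρ0]
  congr 1
  ring

theorem isQuadraticVariation_of_gaussian {Ω : Type*} [MeasurableSpace Ω] {μ : Measure Ω}
    [IsProbabilityMeasure μ] {Γ : Submodule ℝ (Lp ℝ 2 μ)} (hΓ : IsGaussianSpace μ Γ)
    {x d : ℝ≥0 → Lp ℝ 2 μ} (hx : ∀ t, x t ∈ Γ) (hd : ∀ t, d t ∈ Γ) {v φ : ℝ≥0 → ℝ}
    (hv : Continuous v) (hφ : Continuous φ)
    (hxx : ∀ s t, s ≤ t → inner ℝ (x s) (x t) = v s) (hv0 : v 0 = 0)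
    (hdd : ∀ s t, s ≤ t → ‖d t - d s‖ ≤ φ t - φ s) {X : ℝ≥0 → Ω → ℝ}
    (hX : ∀ t, X t =ᵐ[μ] (x t + d t : Lp ℝ 2 μ)) :
    IsQuadraticVariation μ X fun t _ => v t := by
  intro t P hP
  have key : Tendsto (fun k => eLpNorm (fun ω => (P k).sumSq X ω - v t) 2 μ) atTop (𝓝 0) := by
    rw [ENNReal.tendsto_nhds_zero]
    intro ε hε
    have hlim : Tendsto (fun ρ : ℝ => ENNReal.ofReal
        (√gaussFour * (√(v t) + 3 * (φ t - φ 0)) * ρ)) (𝓝[>] 0) (𝓝 0) := by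
      have : Continuous fun ρ : ℝ => ENNReal.ofReal
        (√gaussFour * (√(v t) + 3 * (φ t - φ 0)) * ρ) :=
        ENNReal.continuous_ofReal.comp (continuous_const.mul continuous_id)
      have h0 := this.tendsto 0
      rw [mul_zero, ENNReal.ofReal_zero] at h0
      exact h0.mono_left nhdsWithin_le_nhds
    -- The error bound is linear in ρ. Uniform continuity of v and φ on [0, t] then turns a small
    -- mesh into increments below ρ² and ρ.
    obtain ⟨ρ, hρε, hρ0⟩ :=
      ((ENNReal.tendsto_nhds_zero.1 hlim ε hε).and self_mem_nhdsWithin).exists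
    have hρ0' : 0 < ρ := hρ0
    have huc : ∀ f : ℝ≥0 → ℝ, Continuous f → UniformContinuousOn f (Set.Icc 0 t) := fun f hf =>
      isCompact_Icc.uniformContinuousOn_of_continuous hf.continuousOn
    obtain ⟨δ₁, hδ₁, h₁⟩ := Metric.uniformContinuousOn_iff.1 (huc v hv) (ρ ^ 2) (by positivity)
    obtain ⟨δ₂, hδ₂, h₂⟩ := Metric.uniformContinuousOn_iff.1 (huc φ hφ) ρ hρ0'
    have hmesh : ∀ᶠ k in atTop, ((P k).mesh : ℝ) < min δ₁ δ₂ := by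
      have := (NNReal.tendsto_coe.2 hP)
      exact this.eventually_lt_const (lt_min hδ₁ hδ₂)
    filter_upwards [hmesh] with k hk
    have hdist : ∀ i < (P k).n, dist ((P k).node (i + 1)) ((P k).node i) < min δ₁ δ₂ := by
      intro i hi
      have hle := (P k).mono i.le_succ
      rw [NNReal.dist_eq, abs_of_nonneg (sub_nonneg.2 (NNReal.coe_le_coe.2 hle)),
        ← NNReal.coe_sub hle]
      refine lt_of_le_of_lt (NNReal.coe_le_coe.2 ?_) hk
      exact Finset.le_sup (f := fun i => (P k).node (i + 1) - (P k).node i) (Finset.mem_range.2 hi)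
    have hmem : ∀ i ≤ (P k).n, (P k).node i ∈ Set.Icc 0 t := fun i hi =>
      ⟨zero_le, (P k).node_le hi⟩
    refine (eLpNorm_sumSq_sub_le hΓ hx hd hxx hv0 hdd hX (P k) hρ0'.le (fun i hi => ?_)
      fun i hi => ?_).trans hρε
    · exact (le_abs_self _).trans (h₁ _ (hmem _ hi) _ (hmem _ hi.le)
        ((hdist i hi).trans_le (min_le_left _ _))).le
    · exact (le_abs_self _).trans (h₂ _ (hmem _ hi) _ (hmem _ hi.le)
        ((hdist i hi).trans_le (min_le_right _ _))).le
  refine ⟨tendstoInMeasure_of_tendsto_eLpNorm two_ne_zero (fun k => ?_)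
    aestronglyMeasurable_const key, key⟩
  have hm : ∀ s, AEStronglyMeasurable (X s) μ := fun s =>
    (Lp.aestronglyMeasurable _).congr (hX s).symm
  exact Finset.aestronglyMeasurable_fun_sum _ fun i _ => ((hm _).sub (hm _)).pow 2

end DobricOjeda

namespace DobricOjeda

/-! ### The Dobrić–Ojeda process in the Gaussian Hilbert space -/

variable {Ω : Type*} [MeasurableSpace Ω] {μ : Measure Ω}
  {Z : Hurst → ℝ≥0 → Ω → ℝ} {H : Hurst} {A : ℝ≥0 → Submodule ℝ (Lp ℝ 2 μ)}
  {m : ℝ≥0 → Lp ℝ 2 μ}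

theorem cDO_sq (H : Hurst) : cDO H ^ 2 = cPsi H * cPsi H * (cM H * (2 - 2 * H)) := by
  have h1 : (H : ℝ) < 1 := H.2.2
  have := cM_pos H
  rw [cDO, mul_pow, Real.sq_sqrt (mul_nonneg this.le (by linarith))]
  ring

/-- Integration by parts for p = 2H - 1: the integral subtracted inside `weightedMart` is added back
as the drift. -/
theorem procV_ae_eq (hmart : ∀ t, martM μ Z H t =ᵐ[μ] m t) (t : ℝ≥0) :
    procV μ Z H t =ᵐ[μ] (cPsi H • weightedMart m (2 * H - 1) t
      + (cPsi H * (2 * H - 1)) • weightedIntegral m (2 * H - 1) t : Lp ℝ 2 μ) := by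
  have h1 : cPsi H • weightedMart m (2 * H - 1) t
      + (cPsi H * (2 * H - 1)) • weightedIntegral m (2 * H - 1) t
      = (cPsi H * (t : ℝ) ^ (2 * (H : ℝ) - 1)) • m t := by
    rw [weightedMart, smul_sub, smul_smul, smul_smul, sub_add_cancel]
  rw [h1]
  filter_upwards [hmart t, Lp.coeFn_smul (cPsi H * (t : ℝ) ^ (2 * (H : ℝ) - 1)) (m t)]
    with ω e1 e2
  rw [procV, e1, e2, Pi.smul_apply, smul_eq_mul]

theorem IsGaussianMartingale.inner_cPsi_smul (h : IsGaussianMartingale μ A m (cM H) (2 - 2 * H))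
    {s t : ℝ≥0} (hst : s ≤ t) :
    inner ℝ (cPsi H • weightedMart m (2 * H - 1) s) (cPsi H • weightedMart m (2 * H - 1) t)
      = cDO H ^ 2 / (2 * (H : ℝ)) * (s : ℝ) ^ (2 * (H : ℝ)) := by
  have h0 : (0 : ℝ) < H := H.2.1
  rw [inner_smul_left, inner_smul_right, RCLike.conj_to_real, h.inner_weightedMart (by linarith)
    (by linarith) hst, show (2 * H - 1 + (2 * H - 1) + (2 - 2 * H) : ℝ) = 2 * H by ring, cDO_sq]
  ring

theorem IsGaussianMartingale.norm_drift_sub_le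
    (h : IsGaussianMartingale μ A m (cM H) (2 - 2 * H)) {s t : ℝ≥0} (hst : s ≤ t) :
    ‖weightedIntegral m (2 * H - 1) t - weightedIntegral m (2 * H - 1) s‖
      ≤ √(cM H) / H * ((t : ℝ) ^ (H : ℝ) - (s : ℝ) ^ (H : ℝ)) := by
  have h0 : (0 : ℝ) < H := H.2.1
  have := h.norm_weightedIntegral_sub_le (p := 2 * H - 1) (by linarith) hst
  rwa [show (2 * H - 1 + (2 - 2 * H) / 2 : ℝ) = H by ring] at this

variable [IsProbabilityMeasure μ]

theorem isQuadraticVariation_of_smul_weightedMart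
    (h : IsGaussianMartingale μ A m (cM H) (2 - 2 * H)) {d : ℝ≥0 → Lp ℝ 2 μ}
    (hd : ∀ t, d t ∈ ⨆ t, A t) {φ : ℝ≥0 → ℝ} (hφ : Continuous φ)
    (hdd : ∀ s t, s ≤ t → ‖d t - d s‖ ≤ φ t - φ s) {X : ℝ≥0 → Ω → ℝ}
    (hX : ∀ t, X t =ᵐ[μ] (cPsi H • weightedMart m (2 * H - 1) t + d t : Lp ℝ 2 μ)) :
    IsQuadraticVariation μ X fun t _ => cDO H ^ 2 / (2 * (H : ℝ)) * (t : ℝ) ^ (2 * (H : ℝ)) := by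
  have h0 : (0 : ℝ) < H := H.2.1
  refine isQuadraticVariation_of_gaussian h.gaussian
    (fun t => Submodule.smul_mem _ _ (le_iSup A t (h.weightedMart_mem (by linarith) t))) hd
    (v := fun t => cDO H ^ 2 / (2 * (H : ℝ)) * (t : ℝ) ^ (2 * (H : ℝ))) ?_ hφ
    (fun s t hst => h.inner_cPsi_smul hst) ?_ hdd hX
  · exact continuous_const.mul
      ((Real.continuous_rpow_const (by linarith)).comp NNReal.continuous_coe)
  · rw [NNReal.coe_zero, Real.zero_rpow (by linarith), mul_zero]

theorem continuous_coe_rpow (H : Hurst) : Continuous fun t : ℝ≥0 => (t : ℝ) ^ (H : ℝ) :=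
  (Real.continuous_rpow_const H.2.1.le).comp NNReal.continuous_coe

theorem isQuadraticVariation_procV (h : IsGaussianMartingale μ A m (cM H) (2 - 2 * H))
    (hmart : ∀ t, martM μ Z H t =ᵐ[μ] m t) {X : ℝ≥0 → Ω → ℝ}
    (hX : ∀ t, X t =ᵐ[μ] procV μ Z H t) :
    IsQuadraticVariation μ X fun t _ => cDO H ^ 2 / (2 * (H : ℝ)) * (t : ℝ) ^ (2 * (H : ℝ)) := by
  have h0 : (0 : ℝ) < H := H.2.1
  refine isQuadraticVariation_of_smul_weightedMart h
    (d := fun t => (cPsi H * (2 * H - 1)) • weightedIntegral m (2 * H - 1) t)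
    (φ := fun t => |cPsi H * (2 * H - 1)| * (√(cM H) / H * (t : ℝ) ^ (H : ℝ)))
    (fun t => Submodule.smul_mem _ _ (le_iSup A t (h.weightedIntegral_mem (by linarith) t)))
    (continuous_const.mul (continuous_const.mul (continuous_coe_rpow H))) (fun s t hst => ?_)
    fun t => (hX t).trans (procV_ae_eq hmart t)
  rw [← smul_sub, norm_smul, Real.norm_eq_abs, ← mul_sub, ← mul_sub]
  exact mul_le_mul_of_nonneg_left (h.norm_drift_sub_le hst) (abs_nonneg _)

/-! ### The drift, its truncation and the driving Brownian motion -/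

theorem drift_integrand_eq {a b s y : ℝ} (hs : 0 < s) :
    s⁻¹ * (a * s ^ b * y) = a * (s ^ (b - 1) * y) := by
  rw [Real.rpow_sub_one hs.ne']
  field_simp

theorem integral_drift (H : Hurst) {t : ℝ≥0} {g : ℝ → ℝ} :
    ∫ s in (0 : ℝ)..t, s⁻¹ * (cPsi H * s ^ (2 * (H : ℝ) - 1) * g s)
      = cPsi H * ∫ s in (0 : ℝ)..t, s ^ (2 * (H : ℝ) - 1 - 1) * g s := by
  rw [intervalIntegral.integral_of_le t.coe_nonneg, intervalIntegral.integral_of_le t.coe_nonneg,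
    ← integral_const_mul]
  exact setIntegral_congr_fun measurableSet_Ioc fun s hs => drift_integrand_eq hs.1

theorem integral_indicator_Ici {t ε : ℝ≥0} {g : ℝ → ℝ} (hg : IntervalIntegrable g volume 0 t) :
    ∫ s in (0 : ℝ)..t, (Set.Ici (ε : ℝ)).indicator g s
      = (∫ s in (0 : ℝ)..t, g s) - ∫ s in (0 : ℝ)..(min t ε : ℝ≥0), g s := by
  have hmt : ((min t ε : ℝ≥0) : ℝ) ≤ t := NNReal.coe_le_coe.2 (min_le_left _ _)
  have hmε : ((min t ε : ℝ≥0) : ℝ) ≤ ε := NNReal.coe_le_coe.2 (min_le_right _ _)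
  have hm0 : (0 : ℝ) ≤ (min t ε : ℝ≥0) := NNReal.coe_nonneg _
  have h1 : IntervalIntegrable g volume 0 (min t ε : ℝ≥0) := hg.mono_set (by
    rw [Set.uIcc_of_le hm0, Set.uIcc_of_le t.coe_nonneg]
    exact Set.Icc_subset_Icc_right hmt)
  have h2 : IntervalIntegrable g volume (min t ε : ℝ≥0) t := h1.symm.trans hg
  have hind : ∀ {a b : ℝ}, IntervalIntegrable g volume a b →
      IntervalIntegrable ((Set.Ici (ε : ℝ)).indicator g) volume a b := fun hi =>
    ⟨hi.1.indicator measurableSet_Ici, hi.2.indicator measurableSet_Ici⟩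
  rw [← intervalIntegral.integral_add_adjacent_intervals (hind h1) (hind h2),
    ← intervalIntegral.integral_add_adjacent_intervals h1 h2, add_sub_cancel_left]
  have e1 : ∫ s in (0 : ℝ)..(min t ε : ℝ≥0), (Set.Ici (ε : ℝ)).indicator g s = 0 := by
    rw [intervalIntegral.integral_of_le hm0]
    refine (integral_congr_ae ?_).trans (integral_zero ℝ ℝ)
    filter_upwards [ae_restrict_mem measurableSet_Ioc,
      ae_restrict_of_ae (Measure.ae_ne volume (ε : ℝ))] with s hs hne
    exact Set.indicator_of_notMem (fun hε => hne (le_antisymm (hs.2.trans hmε) hε)) g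
  rw [e1, zero_add, intervalIntegral.integral_of_le hmt, intervalIntegral.integral_of_le hmt]
  refine setIntegral_congr_fun measurableSet_Ioc fun s hs => ?_
  refine Set.indicator_of_mem ?_ g
  rcases le_total t ε with hte | hte
  · rw [min_eq_left hte] at hs
    exact absurd hs.2 (not_le.2 hs.1)
  · rw [min_eq_right hte] at hs
    exact hs.1.le

/-- Nothing about the stochastic integral is computed: the integral equation gives C∫ s^{H-1/2} dW =
V - drift, which is c_Ψ times `weightedMart`. -/
theorem isQuadraticVariation_modV (h : IsGaussianMartingale μ A m (cM H) (2 - 2 * H))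
    (hmart : ∀ t, martM μ Z H t =ᵐ[μ] m t) {M W : ℝ≥0 → Ω → ℝ} (hMW : IsDriving μ Z H M W)
    (ε : ℝ≥0) {X : ℝ≥0 → Ω → ℝ} (hX : ∀ t, X t =ᵐ[μ] modV μ H M W ε t) :
    IsQuadraticVariation μ X fun t _ => cDO H ^ 2 / (2 * (H : ℝ)) * (t : ℝ) ^ (2 * (H : ℝ)) := by
  have h0 : (0 : ℝ) < H := H.2.1
  have hp : (0 : ℝ) < 2 * H - 1 + (2 - 2 * H) / 2 := by linarith
  have hMm : ∀ t, M t =ᵐ[μ] m t := fun t => (hMW.version t).trans (hmart t)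
  set D := weightedIntegral m (2 * H - 1) with hD
  have hmem : ∀ t, D t ∈ ⨆ t, A t := fun t => le_iSup A t (h.weightedIntegral_mem hp t)
  refine isQuadraticVariation_of_smul_weightedMart h
    (d := fun t => (cPsi H * (2 * H - 1)) • (D t - D (min t ε)))
    -- Both D t and D (min t ε) contribute to the increment, so the two bounding functions are
    -- added.
    (φ := fun t => |cPsi H * (2 * H - 1)| * (√(cM H) / H * (t : ℝ) ^ (H : ℝ)
      + √(cM H) / H * ((min t ε : ℝ≥0) : ℝ) ^ (H : ℝ)))
    (fun t => Submodule.smul_mem _ _ (Submodule.sub_mem _ (hmem _) (hmem _)))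
    (continuous_const.mul ((continuous_const.mul (continuous_coe_rpow H)).add
      (continuous_const.mul ((continuous_coe_rpow H).comp (continuous_id.min continuous_const)))))
    (fun s t hst => ?_) fun t => (hX t).trans ?_
  · rw [← smul_sub, norm_smul, Real.norm_eq_abs, ← mul_sub]
    refine mul_le_mul_of_nonneg_left ?_ (abs_nonneg _)
    have h1 := h.norm_drift_sub_le hst
    have h2 := h.norm_drift_sub_le (min_le_min_right ε hst)
    have h3 := norm_sub_le (D t - D s) (D (min t ε) - D (min s ε))
    rw [show D t - D (min t ε) - (D s - D (min s ε))
      = D t - D s - (D (min t ε) - D (min s ε)) by abel]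
    linarith
  · filter_upwards [hMW.sde t, procV_ae_eq hmart t,
      h.ae_intervalIntegrable_weighted hMW.measurable hMm hp t,
      h.integral_weighted_ae_eq hMW.measurable hMm hp t,
      h.integral_weighted_ae_eq hMW.measurable hMm hp (min t ε),
      Lp.coeFn_add (cPsi H • weightedMart m (2 * H - 1) t) ((cPsi H * (2 * H - 1)) • D t),
      Lp.coeFn_add (cPsi H • weightedMart m (2 * H - 1) t)
        ((cPsi H * (2 * H - 1)) • (D t - D (min t ε))),
      Lp.coeFn_smul (cPsi H * (2 * H - 1)) (D t),
      Lp.coeFn_smul (cPsi H * (2 * H - 1)) (D t - D (min t ε)),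
      Lp.coeFn_sub (D t) (D (min t ε))] with ω e1 e2 e3 e4 e5 e6 e7 e8 e9 e10
    rw [e2, e6, Pi.add_apply, e8, Pi.smul_apply, smul_eq_mul, integral_drift, e4] at e1
    rw [e7, Pi.add_apply, e9, Pi.smul_apply, smul_eq_mul, e10, Pi.sub_apply, modV]
    have e11 : ∫ s in (0 : ℝ)..t, (Set.Ici (ε : ℝ)).indicator (fun s => cPsi H * (2 * (H : ℝ) - 1)
          * s ^ (2 * (H : ℝ) - 2) * M s.toNNReal ω) s
        = cPsi H * (2 * (H : ℝ) - 1) * (D t ω - D (min t ε) ω) := by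
      rw [← e4, ← e5, ← integral_indicator_Ici e3, ← intervalIntegral.integral_const_mul]
      refine intervalIntegral.integral_congr fun s _ => ?_
      by_cases hs : s ∈ Set.Ici (ε : ℝ)
      · simp only [Set.indicator_of_mem hs]
        rw [show (2 * (H : ℝ) - 1 - 1) = 2 * H - 2 by ring]
        ring
      · simp only [Set.indicator_of_notMem hs, mul_zero]
    rw [e11]
    linarith

/-- W_t = l∫_0^t s^{H-1/2} dm_s, where dm_s has variance density c_M(2-2H) s^{1-2H}. The weight
flattens this density to a constant, and l normalises it to 1. Integrating s^{H-1/2} against W gives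
l∫ s^{2H-1} dm_s. -/
theorem exists_isDriving (h : IsGaussianMartingale μ A m (cM H) (2 - 2 * H))
    (hmart : ∀ t, martM μ Z H t =ᵐ[μ] m t)
    (hadapted : ∀ t, ∀ f ∈ A t, AEStronglyMeasurable[pastSigma Z H t] f μ) :
    ∃ M W : ℝ≥0 → Ω → ℝ, IsDriving μ Z H M W := by
  have h0 : (0 : ℝ) < H := H.2.1
  have h1 : (H : ℝ) < 1 := H.2.2
  obtain ⟨M, hM, hMm⟩ := h.exists_measurable_modification
  have hc : 0 < cM H * (2 - 2 * H) := mul_pos (cM_pos H) (by linarith)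
  set l : ℝ := (√(cM H * (2 - 2 * H)))⁻¹ with hl
  have hll : l * l * (cM H * (2 - 2 * H)) = 1 := by
    rw [hl, ← mul_inv, Real.mul_self_sqrt hc.le, inv_mul_cancel₀ hc.ne']
  have hCl : cDO H * l = cPsi H := by
    rw [cDO, hl, mul_assoc, mul_inv_cancel₀ (Real.sqrt_pos.2 hc).ne', mul_one]
  have hp : (0 : ℝ) < H - 1 / 2 + (2 - 2 * H) / 2 := by linarith
  have hp' : (0 : ℝ) < 2 * H - 1 + (2 - 2 * H) / 2 := by linarith
  set w : ℝ≥0 → Lp ℝ 2 μ := fun t => l • weightedMart m (H - 1 / 2) t with hw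
  set J : ℝ≥0 → Lp ℝ 2 μ := fun t => l • weightedMart m (2 * H - 1) t with hJ
  have hwA : ∀ t, w t ∈ A t := fun t => (A t).smul_mem _ (h.weightedMart_mem hp t)
  have hwΓ : ∀ t, w t ∈ ⨆ t, A t := fun t => le_iSup A t (hwA t)
  have hinner : ∀ {r r' : ℝ}, 0 < r + (2 - 2 * (H : ℝ)) / 2 → 0 < r' + (2 - 2 * (H : ℝ)) / 2 →
      ∀ {s t : ℝ≥0}, s ≤ t → inner ℝ (l • weightedMart m r s) (l • weightedMart m r' t)
        = (s : ℝ) ^ (r + r' + (2 - 2 * H)) / (r + r' + (2 - 2 * H)) := by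
    intro r r' hr hr' s t hst
    rw [inner_smul_left, inner_smul_right, RCLike.conj_to_real, h.inner_weightedMart hr hr' hst]
    linear_combination ((s : ℝ) ^ (r + r' + (2 - 2 * H)) / (r + r' + (2 - 2 * H))) * hll
  have hww : ∀ s t, s ≤ t → inner ℝ (w s) (w t) = (s : ℝ) := fun s t hst => by
    rw [hinner hp hp hst, show (H - 1 / 2 + (H - 1 / 2) + (2 - 2 * H) : ℝ) = 1 by ring,
      Real.rpow_one, div_one]
  have hwiener : ∀ t : ℝ≥0, wienerIntegral μ (fun t => w t) (fun s => s ^ ((H : ℝ) - 1 / 2)) t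
      =ᵐ[μ] J t := fun t => by
    refine wienerIntegral_ae_eq (fun s => EventuallyEq.rfl) hww
      (memLp_rpow (by linarith) t) (fun s hst => ?_) ?_ (exists_step_tendsto_rpow (by linarith) t)
    · rw [real_inner_comm, hinner hp hp' hst, integral_rpow (Or.inl (by linarith)),
        Real.zero_rpow (by linarith), sub_zero]
      ring_nf
    · rw [← real_inner_self_eq_norm_sq, hinner hp' hp' le_rfl]
      have : ∫ u in Set.Ioc (0 : ℝ) t, (u ^ ((H : ℝ) - 1 / 2)) ^ 2
          = ∫ u in (0 : ℝ)..t, u ^ (2 * (H : ℝ) - 1) := by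
        rw [intervalIntegral.integral_of_le t.coe_nonneg]
        refine setIntegral_congr_fun measurableSet_Ioc fun u hu => ?_
        rw [← Real.rpow_two, ← Real.rpow_mul hu.1.le]
        ring_nf
      rw [this, integral_rpow (Or.inl (by linarith)), Real.zero_rpow (by linarith), sub_zero]
      ring_nf
  refine ⟨M, fun t => w t, hM, fun t => (hMm t).trans (hmart t).symm, ?_,
    fun t => hadapted t _ (hwA t), fun t => ?_, fun t => ?_⟩
  · have hΓ := h.gaussian
    -- L² representatives suffice for W, since only the finite-dimensional laws are prescribed.
    refine (hΓ.isGaussianProcess hwΓ fun t => EventuallyEq.rfl).isPreBrownianReal_of_covariance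
      (fun t => h.gaussian.integral_eq_zero (hwΓ t)) fun s t hst => ?_
    rw [covariance_eq_sub (Lp.memLp _) (Lp.memLp _), h.gaussian.integral_eq_zero (hwΓ s), zero_mul,
      sub_zero, ← hww s t hst, inner_L2_eq EventuallyEq.rfl EventuallyEq.rfl]
    rfl
  · filter_upwards [h.ae_intervalIntegrable_weighted hM hMm hp' t] with ω hω
    refine (hω.const_mul (cPsi H)).congr_ae ?_
    refine (ae_restrict_mem measurableSet_uIoc).mono fun s hs => ?_
    rw [Set.uIoc_of_le t.coe_nonneg] at hs
    exact (drift_integrand_eq hs.1).symm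
  · filter_upwards [procV_ae_eq hmart t, hwiener t, h.integral_weighted_ae_eq hM hMm hp' t,
      Lp.coeFn_add (cPsi H • weightedMart m (2 * H - 1) t)
        ((cPsi H * (2 * H - 1)) • weightedIntegral m (2 * H - 1) t),
      Lp.coeFn_smul (cPsi H) (weightedMart m (2 * H - 1) t),
      Lp.coeFn_smul (cPsi H * (2 * H - 1)) (weightedIntegral m (2 * H - 1) t),
      Lp.coeFn_smul l (weightedMart m (2 * H - 1) t)] with ω e1 e2 e3 e4 e5 e6 e7
    rw [e1, e4, Pi.add_apply, e5, e6, e2, hJ, e7, integral_drift, e3, Pi.smul_apply, Pi.smul_apply,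
      Pi.smul_apply, smul_eq_mul, smul_eq_mul, smul_eq_mul, ← hCl]
    ring

end DobricOjeda

/-! ### The main theorem -/

open DobricOjeda in
theorem mainTheorem12 {Ω : Type*} [MeasurableSpace Ω] (μ : MeasureTheory.Measure Ω)
    [MeasureTheory.IsProbabilityMeasure μ] (Z : Hurst → ℝ≥0 → Ω → ℝ)
    (hZ : IsFractionalGaussianField μ Z) (H : Hurst) :
    (∀ X : ℝ≥0 → Ω → ℝ, (∀ t, X t =ᵐ[μ] procV μ Z H t) →
      IsQuadraticVariation μ X
        (fun t _ => cDO H ^ 2 / (2 * (H : ℝ)) * (t : ℝ) ^ (2 * (H : ℝ)))) ∧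
    (∃ M W : ℝ≥0 → Ω → ℝ, IsDriving μ Z H M W) ∧
    (∀ M W : ℝ≥0 → Ω → ℝ, IsDriving μ Z H M W → ∀ ε : ℝ, 0 < ε →
      ∀ X : ℝ≥0 → Ω → ℝ, (∀ t, X t =ᵐ[μ] modV μ H M W ε t) →
        IsQuadraticVariation μ X
          (fun t _ => cDO H ^ 2 / (2 * (H : ℝ)) * (t : ℝ) ^ (2 * (H : ℝ)))) := by
  obtain ⟨A, m, h, hmart, hadapted⟩ := hZ.exists_isGaussianMartingale H
  exact ⟨fun X hX => isQuadraticVariation_procV h hmart hX, exists_isDriving h hmart hadapted,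
    fun M W hMW ε hε X hX => isQuadraticVariation_modV h hmart hMW ⟨ε, hε.le⟩ hX⟩
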